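/- Let $F$ be a totally real number field with ring of integers $R$, let $B$ be a totally definite quaternion algebra over $F$ (that is, $B\otimes_{F,\sigma}\mathbb{R}$ is isomorphic to Hamilton's quaternions for every embedding $\sigma\colon F\to\mathbb{R}$), and let $O$ be an $R$-order in $B$. For a nonzero prime $\mathfrak p$ of $R$ let a subscript $\mathfrak p$ denote completion, and put $\widehat O^\times=\prod_{\mathfrak p}O_{\mathfrak p}^\times$. Let $S$ be a finite set of primes containing all $\mathfrak p$ for which $O_{\mathfrak p}$ is not maximal. Let $\mathrm{Cl}_{G(O)}R$ be the group of fractional ideals $\mathfrak a$ of $R$ with $\mathfrak a_{\mathfrak p}=R_{\mathfrak p}$ for all $\mathfrak p\in S$, modulo the subgroup of principal ideals $aR$ with $a\in F^\times$ totally positive and $a\in\mathrm{nrd}(O_{\mathfrak p}^\times)$ for all $\mathfrak p\in S$. Let $\mathrm{Cls}\,O$ be the set of classes $[I]$ of locally principal right fractional $O$-ideals $I\subseteq B$, where $I\sim J$ if $J=\alpha I$ for some $\alpha\in B^\times$. For $X\subseteq\mathrm{Cls}\,O$ put $$\mathrm{mass}(X)=\sum_{[I]\in X}\frac{1}{[O_{\mathsf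 L}(I)^\times:R^\times]},\qquad O_{\mathsf L}(I)=\{\alpha\in B:\alpha I\subseteq I\}.$$ The reduced norm map $\mathrm{Cls}\,O\to\mathrm{Cl}_{G(O)}R$ sends a class to $[\mathrm{nrd}(I)]$, where $I$ is a representative of the class with $I_{\mathfrak p}=O_{\mathfrak p}$ for all $\mathfrak p\in S$. Let $\mathrm{Cls}^{[\mathfrak b]}O$ be its fibre over $[\mathfrak b]$. For another order $O'$ use the same notation, with its own set $S'$. Then the following hold. (a) If $O'$ is an $R$-order in $B$ that is locally isomorphic to $O$ (that is, $O'_{\mathfrak p}\cong O_{\mathfrak p}$ as $R_{\mathfrak p}$-algebras for all $\mathfrak p$), then $\mathrm{mass}(\mathrm{Cls}^{[R]}O)=\mathrm{mass}(\mathrm{Cls}^{[R]}O')$. (b) $\mathrm{mass}(\mathrm{Cls}^{[R]}O)=\dfrac{\mathrm{mass}(\mathrm{Cls}\,O)}{\#\mathrm{Cl}_{G(O)}R}$, and more generally $\mathrm{mass}(\mathrm{Cls}^{[\mathfrak b]}O)=\dfrac{\mathrm{mass}(\mathrm{Cls}\,O)}{\#\mathrm{Cl}_{G(O)}R}$ for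 every $[\mathfrak b]\in\mathrm{Cl}_{G(O)}R$. (c) If $O'\supseteq O$ is an $R$-order in $B$, then $$\mathrm{mass}(\mathrm{Cls}^{[R]}O)=\frac{\#\mathrm{Cl}_{G(O')}R}{\#\mathrm{Cl}_{G(O)}R}\,[\widehat O'^\times:\widehat O^\times]\,\mathrm{mass}(\mathrm{Cls}^{[R]}O').$$ -/

import Mathlib

open scoped NumberField Quaternion nonZeroDivisors ENNReal
open IsDedekindDomain

namespace StablyFreeMass

noncomputable section

/-! ### Quaternion algebras and the reduced norm

`ℍ[K, a, b]` is Mathlib's quaternion algebra `(a, b | K)`, with basis `1, i, j, ij` and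
`i² = a`, `j² = b`, `ji = -ij`. -/

section Quaternion

/-- The reduced norm `nrd x = x * star x`, as a multiplicative map to the base ring. -/
def nrd {K : Type*} [CommRing K] {a b : K} : ℍ[K, a, b] →* K where
  toFun x := (x * star x).re
  map_one' := by simp
  map_mul' x y := by simp; ring

theorem coe_nrd {K : Type*} [CommRing K] {a b : K} (x : ℍ[K, a, b]) :
    ((nrd x : K) : ℍ[K, a, b]) = x * star x := by
  ext <;> simp [nrd] <;> ring

/-- The quaternion algebra `(a, b | F)` is (totally) definite: for every real embedding
`σ : F → ℝ`, the algebra `B ⊗_{F, σ} ℝ = (σ a, σ b | ℝ)` is isomorphic to Hamilton's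
quaternions. -/
def IsDefinite {F : Type*} [Field F] (a b : F) : Prop :=
  ∀ σ : F →+* ℝ, Nonempty (ℍ[ℝ, σ a, σ b] ≃ₐ[ℝ] ℍ[ℝ])

/-- For `B = (a, b | F)` and a field extension `K` of `F`, the `K`-algebra
`B ⊗_F K = (a, b | K)`. -/
abbrev BaseChange {F : Type*} [Field F] (K : Type*) [Field K] [Algebra F K] (a b : F) : Type _ :=
  ℍ[K, algebraMap F K a, algebraMap F K b]

/-- The canonical map `B → B ⊗_F K`. -/
def toBaseChange {F : Type*} [Field F] (K : Type*) [Field K] [Algebra F K] {a b : F} :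
    ℍ[F, a, b] →+* BaseChange K a b where
  toFun x := ⟨algebraMap F K x.re, algebraMap F K x.imI, algebraMap F K x.imJ,
    algebraMap F K x.imK⟩
  map_one' := by ext <;> simp
  map_zero' := by ext <;> simp
  map_mul' x y := by ext <;> simp
  map_add' x y := by ext <;> simp

/-- The `R`-algebra structure on `B = (a, b | F)`, with coordinatewise scalar multiplication. It
takes precedence over Mathlib's `R`-algebra structure on arbitrary `F`-algebras, which has the same
structure map, so that all instances agree definitionally. -/
instance (priority := 2000) ringOfIntegersAlgebra {F : Type*} [Field F] {a b : F} :
    Algebra (𝓞 F) ℍ[F, a, b] :=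
  QuaternionAlgebra.instAlgebra (S := 𝓞 F)

end Quaternion

/-! ### Orders -/

section Orders

/-- `O` is an `A`-order in the quaternion algebra `(a, b | K)`, where `K` is the field of
fractions of `A`: a subring that is a finitely generated `A`-module and spans the algebra
over `K`. -/
def IsOrder {A K : Type*} [CommRing A] [Field K] [Algebra A K] {a b : K}
    (O : Subalgebra A ℍ[K, a, b]) : Prop :=
  (Subalgebra.toSubmodule O).FG ∧ Submodule.span K (O : Set ℍ[K, a, b]) = ⊤

/-- `O` is a maximal `A`-order. -/
def IsMaximalOrder {A K : Type*} [CommRing A] [Field K] [Algebra A K] {a b : K}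
    (O : Subalgebra A ℍ[K, a, b]) : Prop :=
  IsOrder O ∧ ∀ O' : Subalgebra A ℍ[K, a, b], IsOrder O' → O ≤ O' → O' = O

variable {F : Type*} [Field F] [NumberField F] {a b : F}

/-- The completion `I_v = I ⊗_R R_v` of an `R`-submodule `I ⊆ B`, as the `R_v`-submodule of
`B_v = B ⊗_F F_v` generated by `I`. -/
def completion (v : HeightOneSpectrum (𝓞 F)) (I : Submodule (𝓞 F) ℍ[F, a, b]) :
    Submodule (v.adicCompletionIntegers F) (BaseChange (v.adicCompletion F) a b) :=
  Submodule.span (v.adicCompletionIntegers F)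
    (toBaseChange (v.adicCompletion F) '' (I : Set ℍ[F, a, b]))

/-- The completion `O_v = O ⊗_R R_v` of an order `O ⊆ B`, as the `R_v`-subalgebra of
`B_v = B ⊗_F F_v` generated by `O`. -/
def completionOrder (v : HeightOneSpectrum (𝓞 F)) (O : Subalgebra (𝓞 F) ℍ[F, a, b]) :
    Subalgebra (v.adicCompletionIntegers F) (BaseChange (v.adicCompletion F) a b) :=
  Algebra.adjoin (v.adicCompletionIntegers F)
    (toBaseChange (v.adicCompletion F) '' (O : Set ℍ[F, a, b]))

/-- The two completions of an order agree. -/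
theorem toSubmodule_completionOrder (v : HeightOneSpectrum (𝓞 F))
    (O : Subalgebra (𝓞 F) ℍ[F, a, b]) :
    Subalgebra.toSubmodule (completionOrder v O) =
      completion v (Subalgebra.toSubmodule O) := by
  rw [completionOrder, Algebra.adjoin_eq_span, completion]
  congr 1
  have h : toBaseChange (v.adicCompletion F) '' (O : Set ℍ[F, a, b]) =
      ((O.toSubring.toSubmonoid.map (toBaseChange (v.adicCompletion F)).toMonoidHom :
        Submonoid _) : Set (BaseChange (v.adicCompletion F) a b)) := rfl
  have h' : toBaseChange (v.adicCompletion F) '' ((Subalgebra.toSubmodule O : Submodule _ _) :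
      Set ℍ[F, a, b]) = toBaseChange (v.adicCompletion F) '' (O : Set ℍ[F, a, b]) := rfl
  rw [h', h, Submonoid.closure_eq]

/-- The unit group `O_vˣ`, as a subgroup of `B_vˣ`. -/
def localUnits (v : HeightOneSpectrum (𝓞 F)) (O : Subalgebra (𝓞 F) ℍ[F, a, b]) :
    Subgroup (BaseChange (v.adicCompletion F) a b)ˣ :=
  (completionOrder v O).toSubmonoid.units

/-- The group `Ôˣ = ∏_v O_vˣ`, as a subgroup of `∏_v B_vˣ`. -/
def adelicUnits (O : Subalgebra (𝓞 F) ℍ[F, a, b]) :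
    Subgroup (∀ v : HeightOneSpectrum (𝓞 F), (BaseChange (v.adicCompletion F) a b)ˣ) :=
  Subgroup.pi Set.univ fun v => localUnits v O

/-- `O` and `O'` are locally isomorphic: `O_v ≅ O'_v` as `R_v`-algebras for all primes `v`. -/
def LocallyIsomorphic (O O' : Subalgebra (𝓞 F) ℍ[F, a, b]) : Prop :=
  ∀ v : HeightOneSpectrum (𝓞 F),
    Nonempty (completionOrder v O ≃ₐ[v.adicCompletionIntegers F] completionOrder v O')

/-- The finite set `S` of primes contains all primes `v` for which `O_v` is not maximal. -/
def ContainsNonmaximal (S : Finset (HeightOneSpectrum (𝓞 F)))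
    (O : Subalgebra (𝓞 F) ℍ[F, a, b]) : Prop :=
  ∀ v : HeightOneSpectrum (𝓞 F), ¬ IsMaximalOrder (completionOrder v O) → v ∈ S

end Orders

/-! ### The class group `Cl_{G(O)} R` -/

section ClassGroup

variable {F : Type*} [Field F] [NumberField F] {a b : F}

/-- `Idl_S R`: the group of fractional ideals `𝔞` of `R` with `𝔞_v = R_v` for all `v ∈ S`,
that is, of valuation `0` at all `v ∈ S`. -/
def Idl (S : Finset (HeightOneSpectrum (𝓞 F))) : Subgroup (FractionalIdeal (𝓞 F)⁰ F)ˣ where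
  carrier := {I | ∀ v ∈ S, FractionalIdeal.count F v (I : FractionalIdeal (𝓞 F)⁰ F) = 0}
  one_mem' v _ := by simpa using FractionalIdeal.count_one F v
  mul_mem' {I J} hI hJ v hv := by
    rw [Units.val_mul, FractionalIdeal.count_mul F v I.ne_zero J.ne_zero, hI v hv, hJ v hv,
      add_zero]
  inv_mem' {I} hI v hv := by
    rw [Units.val_inv_eq_inv_val, FractionalIdeal.count_inv, hI v hv, neg_zero]

/-- `F_{S,O}ˣ`: the totally positive `x ∈ Fˣ` with `x ∈ nrd(O_vˣ)` for all `v ∈ S`. -/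
def FSO (O : Subalgebra (𝓞 F) ℍ[F, a, b]) (S : Finset (HeightOneSpectrum (𝓞 F))) :
    Subgroup Fˣ where
  carrier := {x | (∀ σ : F →+* ℝ, 0 < σ (x : F)) ∧
    ∀ v ∈ S, ∃ u ∈ localUnits v O, nrd (u : BaseChange (v.adicCompletion F) a b) =
      algebraMap F (v.adicCompletion F) x}
  one_mem' := ⟨fun σ => by simp, fun v _ => ⟨1, one_mem _, by simp⟩⟩
  mul_mem' := by
    rintro x y ⟨hx, hx'⟩ ⟨hy, hy'⟩
    refine ⟨fun σ => by simpa using mul_pos (hx σ) (hy σ), fun v hv => ?_⟩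
    obtain ⟨u, hu, hu'⟩ := hx' v hv
    obtain ⟨w, hw, hw'⟩ := hy' v hv
    exact ⟨u * w, mul_mem hu hw, by simp only [Units.val_mul, map_mul, hu', hw']⟩
  inv_mem' := by
    rintro x ⟨hx, hx'⟩
    refine ⟨fun σ => by simpa using hx σ, fun v hv => ?_⟩
    obtain ⟨u, hu, hu'⟩ := hx' v hv
    refine ⟨u⁻¹, inv_mem hu, ?_⟩
    have h1 : nrd (↑u⁻¹ : BaseChange (v.adicCompletion F) a b) * nrd (u : BaseChange _ a b) = 1 := by
      rw [← map_mul, Units.inv_mul, map_one]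
    rw [hu'] at h1
    rw [Units.val_inv_eq_inv_val, map_inv₀]
    exact eq_inv_of_mul_eq_one_left h1

/-- `PIdl_{S,O} R`: the group of principal fractional ideals `xR` with `x ∈ F_{S,O}ˣ`. -/
def PIdl (O : Subalgebra (𝓞 F) ℍ[F, a, b]) (S : Finset (HeightOneSpectrum (𝓞 F))) :
    Subgroup (FractionalIdeal (𝓞 F)⁰ F)ˣ :=
  (FSO O S).map (toPrincipalIdeal (𝓞 F) F)

/-- `Cl_{G(O)} R = Idl_S R / PIdl_{S,O} R`. -/
abbrev ClG (O : Subalgebra (𝓞 F) ℍ[F, a, b]) (S : Finset (HeightOneSpectrum (𝓞 F))) : Type _ :=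
  Idl S ⧸ (PIdl O S).subgroupOf (Idl S)

end ClassGroup

/-! ### The class set and masses -/

section ClassSet

variable {F : Type*} [Field F] [NumberField F] {a b : F}

/-- A locally principal right fractional `O`-ideal: an `R`-lattice `I ⊆ B` with `I O ⊆ I`, such
that for every prime `v` we have `I_v = α_v O_v` for some `α_v ∈ B_vˣ`. -/
structure LPIdeal (O : Subalgebra (𝓞 F) ℍ[F, a, b]) where
  /-- the underlying `R`-submodule of `B` -/
  carrier : Submodule (𝓞 F) ℍ[F, a, b]
  fg : carrier.FG
  span_eq_top : Submodule.span F (carrier : Set ℍ[F, a, b]) = ⊤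
  mul_mem : ∀ x ∈ carrier, ∀ y ∈ O, x * y ∈ carrier
  locallyPrincipal : ∀ v : HeightOneSpectrum (𝓞 F),
    ∃ α : (BaseChange (v.adicCompletion F) a b)ˣ,
      completion v carrier = (completion v (Subalgebra.toSubmodule O)).map
        (LinearMap.mulLeft (v.adicCompletionIntegers F)
          (α : BaseChange (v.adicCompletion F) a b))

/-- The left translate `α I`. -/
def leftMul (α : ℍ[F, a, b]ˣ) (I : Submodule (𝓞 F) ℍ[F, a, b]) : Submodule (𝓞 F) ℍ[F, a, b] :=
  I.map (LinearMap.mulLeft (𝓞 F) (α : ℍ[F, a, b]))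

theorem mem_leftMul {α : ℍ[F, a, b]ˣ} {I : Submodule (𝓞 F) ℍ[F, a, b]} {x : ℍ[F, a, b]} :
    x ∈ leftMul α I ↔ (↑α⁻¹ : ℍ[F, a, b]) * x ∈ I := by
  constructor
  · rintro ⟨y, hy, rfl⟩
    simpa using hy
  · intro h
    exact ⟨_, h, by simp⟩

/-- Isomorphism of right fractional `O`-ideals: `I ≅ J` if and only if `α I = J` for some
`α ∈ Bˣ`. -/
instance idealSetoid (O : Subalgebra (𝓞 F) ℍ[F, a, b]) : Setoid (LPIdeal O) where
  r I J := ∃ α : ℍ[F, a, b]ˣ, leftMul α I.carrier = J.carrier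
  iseqv :=
    { refl := fun I => ⟨1, by ext x; simp [mem_leftMul]⟩
      symm := by
        rintro I J ⟨α, h⟩
        exact ⟨α⁻¹, by ext x; rw [← h]; simp [mem_leftMul]⟩
      trans := by
        rintro I J K ⟨α, h⟩ ⟨β, h'⟩
        exact ⟨β * α, by ext x; rw [← h', ← h]; simp [mem_leftMul, mul_assoc]⟩ }

/-- The right class set `Cls O`: isomorphism classes of locally principal right fractional
`O`-ideals. -/
def Cls (O : Subalgebra (𝓞 F) ℍ[F, a, b]) : Type _ := Quotient (idealSetoid O)

/-- The class `[I]` of `I`. -/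
def Cls.mk {O : Subalgebra (𝓞 F) ℍ[F, a, b]} (I : LPIdeal O) : Cls O := Quotient.mk _ I

/-- The left order `O_L(I) = {α ∈ B | α I ⊆ I}`. -/
def leftOrder (I : Submodule (𝓞 F) ℍ[F, a, b]) : Subalgebra (𝓞 F) ℍ[F, a, b] where
  carrier := {α | ∀ x ∈ I, α * x ∈ I}
  mul_mem' {α β} hα hβ x hx := by rw [mul_assoc]; exact hα _ (hβ _ hx)
  add_mem' {α β} hα hβ x hx := by rw [add_mul]; exact I.add_mem (hα _ hx) (hβ _ hx)
  algebraMap_mem' r x hx := by rw [← Algebra.smul_def]; exact I.smul_mem r hx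

/-- The unit group `Rˣ`, as a subgroup of `Bˣ`. -/
def scalarUnits (a b : F) : Subgroup ℍ[F, a, b]ˣ :=
  (Units.map (algebraMap (𝓞 F) ℍ[F, a, b] : 𝓞 F →* ℍ[F, a, b])).range

/-- The index `[O_L(I)ˣ : Rˣ]`. -/
def unitIndex (I : Submodule (𝓞 F) ℍ[F, a, b]) : ℕ :=
  (scalarUnits a b).relIndex (leftOrder I).toSubmonoid.units

/-- Replacing `I` by `α I` conjugates the left order and does not change the unit index. -/
theorem unitIndex_leftMul (α : ℍ[F, a, b]ˣ) (I : Submodule (𝓞 F) ℍ[F, a, b]) :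
    unitIndex (leftMul α I) = unitIndex I := by
  have hmem : ∀ (J : Submodule (𝓞 F) ℍ[F, a, b]) (u : ℍ[F, a, b]ˣ),
      u ∈ (leftOrder J).toSubmonoid.units ↔
        (∀ x ∈ J, (u : ℍ[F, a, b]) * x ∈ J) ∧ ∀ x ∈ J, (↑u⁻¹ : ℍ[F, a, b]) * x ∈ J := by
    intro J u
    exact Submonoid.mem_units_iff _ _
  have h1 : (leftOrder (leftMul α I)).toSubmonoid.units =
      (leftOrder I).toSubmonoid.units.map (MulAut.conj α).toMonoidHom := by
    ext u
    rw [Subgroup.mem_map_equiv, hmem, hmem]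
    have key : ∀ w : ℍ[F, a, b]ˣ, (∀ x ∈ leftMul α I, (w : ℍ[F, a, b]) * x ∈ leftMul α I) ↔
        ∀ x ∈ I, (((MulAut.conj α).symm w : ℍ[F, a, b]ˣ) : ℍ[F, a, b]) * x ∈ I := by
      intro w
      simp only [mem_leftMul, MulAut.conj_symm_apply, Units.val_mul]
      constructor
      · intro h x hx
        have := h ((α : ℍ[F, a, b]) * x) (by simpa using hx)
        simpa only [mul_assoc] using this
      · intro h x hx
        have := h _ hx
        simpa only [mul_assoc, Units.mul_inv_cancel_left] using this
    rw [key, key, map_inv]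
  have h2 : scalarUnits a b = (scalarUnits a b).map (MulAut.conj α).toMonoidHom := by
    have hc : ∀ r ∈ scalarUnits a b, (MulAut.conj α) r = r := by
      rintro _ ⟨r, rfl⟩
      ext1
      have := Algebra.commutes (r : 𝓞 F) (α : ℍ[F, a, b])
      simp only [MulAut.conj_apply, Units.val_mul, Units.coe_map, MonoidHom.coe_coe]
      rw [← this, mul_assoc, Units.mul_inv, mul_one]
    ext u
    constructor
    · intro hu
      exact ⟨u, hu, hc u hu⟩
    · rintro ⟨r, hr, rfl⟩
      exact (hc r hr).symm ▸ hr
  rw [unitIndex, h1, h2, unitIndex]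
  exact Subgroup.relIndex_map_map_of_injective _ _ (MulAut.conj α).injective

/-- The mass `1 / [O_L(I)ˣ : Rˣ]` of a class `[I] ∈ Cls O`. -/
def classMass {O : Subalgebra (𝓞 F) ℍ[F, a, b]} : Cls O → ℝ≥0∞ :=
  Quotient.lift (fun I => 1 / (unitIndex I.carrier : ℝ≥0∞)) (by
    rintro I J ⟨α, h⟩
    simp only [← h, unitIndex_leftMul])

/-- The mass of a subset of `Cls O`: the sum of `1 / [O_L(I)ˣ : Rˣ]` over the classes `[I]` in the
subset. It is taken in `[0, ∞]`, where it needs no convention on convergence. -/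
def mass {O : Subalgebra (𝓞 F) ℍ[F, a, b]} (X : Set (Cls O)) : ℝ≥0∞ :=
  ∑' c : X, classMass (c : Cls O)

/-- The reduced norm `nrd(I)` of an `R`-lattice `I ⊆ B`: the `R`-submodule of `F` generated by
the reduced norms of the elements of `I`. -/
def nrdIdeal (I : Submodule (𝓞 F) ℍ[F, a, b]) : Submodule (𝓞 F) F :=
  Submodule.span (𝓞 F) (nrd '' (I : Set ℍ[F, a, b]))

/-- The fibre `Cls^β O` over `β ∈ Cl_{G(O)} R` of the map `Cls O → Cl_{G(O)} R`, `[I] ↦ [nrd(I)]`.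
The class of `nrd(I)` is formed from a representative `I` with `I_v = O_v` for all `v ∈ S` (one
exists in every class, by weak approximation); then `nrd(I) ∈ Idl_S R`. -/
def fibre (O : Subalgebra (𝓞 F) ℍ[F, a, b]) (S : Finset (HeightOneSpectrum (𝓞 F)))
    (β : ClG O S) : Set (Cls O) :=
  {c | ∃ I : LPIdeal O, Cls.mk I = c ∧
    (∀ v ∈ S, completion v I.carrier = completion v (Subalgebra.toSubmodule O)) ∧
    ∃ 𝔞 : Idl S, (((𝔞 : (FractionalIdeal (𝓞 F)⁰ F)ˣ) : FractionalIdeal (𝓞 F)⁰ F) :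
        Submodule (𝓞 F) F) = nrdIdeal I.carrier ∧ (QuotientGroup.mk 𝔞 : ClG O S) = β}

end ClassSet

end

end StablyFreeMass

open StablyFreeMass

/-! A locally principal ideal is determined by its completions I_v = x_v O_v, so Cls O is the set of
double cosets of Bˣ and Ôˣ in the ideles of B, and O_L(I)ˣ is the stabilizer in Bˣ of the coset x
Ôˣ. Masses become weighted counts of orbits, and two formal properties suffice: shrinking the level
U multiplies masses by the index (`cosetMass_of_le`), and right translation by y replaces U by yUy⁻¹
(`cosetMass_mul_right`).

The heart is that all fibres have the same mass (`mass_fibre_const`). The classes δ such that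
multiplication by δ preserves the mass of every fibre form a subgroup of Cl_{G(O)} R, so it suffices
to treat the class of a prime 𝔭 ∉ S, where O_𝔭 is maximal. There B_𝔭 contains a trace-zero unit p
whose norm is a uniformizer (`exists_pure_uniformizer`). The idele y that is p at 𝔭 and 1 elsewhere
carries the fibre over β onto the fibre over β[𝔭], at the price of changing U = Ôˣ into V = yUy⁻¹.
Since p² = -nrd p is a scalar, y² is central and conjugation by y swaps U and V. Hence U ∩ V has the
same index in U and in V, and comparing both levels with U ∩ V gives equal masses; no Haar measure
enters. The class group is finite (`finite_ClG`) and the fibres partition Cls O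
(`ideleFibre_unique`, where definiteness makes reduced norms totally positive), so each fibre has
the total mass divided by the class number.

The other two statements then reduce to total masses and class numbers. Locally isomorphic orders
are conjugate by an idele, by Skolem–Noether at each prime, so their total masses agree
(`mass_univ_of_conj`); their class groups are compared after enlarging both sets of primes to S ∪
S', which does not change the class numbers (`card_ClG_of_subset`). For O ⊆ O' the total masses
differ by the index of the adelic unit groups (`mass_univ_of_le`).

The local input is that a maximal order over R_v contains an element of unit discriminant
(`exists_unit_disc`). It is proved by computing modulo the uniformizer, without the classification
of local quaternion algebras. With Hensel's lemma it gives nrd(O_vˣ) = R_vˣ and the trace-zero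
element of uniformizer norm. -/

namespace StablyFreeMass

noncomputable section

set_option linter.unusedSectionVars false

/-! ### Norm, trace and Skolem–Noether in quaternion algebras over a field. -/

section QuaternionGeneric

variable {K : Type*} [Field K] {a b : K}

/-- The reduced trace `x + star x`. -/
def trd (x : ℍ[K, a, b]) : K := 2 * x.re

theorem nrd_apply (x : ℍ[K, a, b]) :
    nrd x = x.re ^ 2 - a * x.imI ^ 2 - b * x.imJ ^ 2 + a * b * x.imK ^ 2 := by
  simp [nrd]; ring

theorem star_eq (x : ℍ[K, a, b]) : star x = trd x • (1 : ℍ[K, a, b]) - x := by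
  ext <;> simp [trd]; ring

theorem mul_self_eq (x : ℍ[K, a, b]) : x * x = trd x • x - nrd x • (1 : ℍ[K, a, b]) := by
  ext <;> simp [trd, nrd_apply] <;> ring

theorem mul_star_eq (x : ℍ[K, a, b]) : x * star x = nrd x • (1 : ℍ[K, a, b]) := by
  ext <;> simp [nrd_apply] <;> ring

theorem star_mul_eq (x : ℍ[K, a, b]) : star x * x = nrd x • (1 : ℍ[K, a, b]) := by
  ext <;> simp [nrd_apply] <;> ring

theorem nrd_star (x : ℍ[K, a, b]) : nrd (star x) = nrd x := by simp [nrd_apply]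

theorem nrd_add (x y : ℍ[K, a, b]) : nrd (x + y) = nrd x + trd (x * star y) + nrd y := by
  simp only [nrd_apply, trd, QuaternionAlgebra.re_add, QuaternionAlgebra.imI_add, QuaternionAlgebra.imJ_add, QuaternionAlgebra.imK_add, QuaternionAlgebra.re_mul, QuaternionAlgebra.re_star, QuaternionAlgebra.imI_star, QuaternionAlgebra.imJ_star, QuaternionAlgebra.imK_star]; ring

theorem nrd_smul (c : K) (x : ℍ[K, a, b]) : nrd (c • x) = c ^ 2 * nrd x := by
  simp [nrd_apply]; ring

theorem trd_smul (c : K) (x : ℍ[K, a, b]) : trd (c • x) = c * trd x := by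
  simp [trd]; ring

theorem trd_add (x y : ℍ[K, a, b]) : trd (x + y) = trd x + trd y := by
  simp [trd]; ring

theorem star_smul' (c : K) (x : ℍ[K, a, b]) : star (c • x) = c • star x := by
  ext <;> simp

theorem trd_mul_comm (x y : ℍ[K, a, b]) : trd (x * y) = trd (y * x) := by
  simp only [trd, QuaternionAlgebra.re_mul]; ring

theorem trd_one : trd (1 : ℍ[K, a, b]) = 2 := by simp [trd]

theorem isUnit_of_nrd_ne_zero {x : ℍ[K, a, b]} (h : nrd x ≠ 0) : IsUnit x := by
  refine ⟨⟨x, (nrd x)⁻¹ • star x, ?_, ?_⟩, rfl⟩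
  · rw [mul_smul_comm, mul_star_eq, smul_smul, inv_mul_cancel₀ h, one_smul]
  · rw [smul_mul_assoc, star_mul_eq, smul_smul, inv_mul_cancel₀ h, one_smul]

theorem nrd_unit_ne_zero (u : ℍ[K, a, b]ˣ) : nrd (u : ℍ[K, a, b]) ≠ 0 :=
  (u.isUnit.map (nrd : ℍ[K, a, b] →* K)).ne_zero

theorem unit_inv_eq (u : ℍ[K, a, b]ˣ) :
    (↑u⁻¹ : ℍ[K, a, b]) = (nrd (u : ℍ[K, a, b]))⁻¹ • star (u : ℍ[K, a, b]) := by
  have h := nrd_unit_ne_zero u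
  rw [Units.inv_eq_of_mul_eq_one_right]
  rw [mul_smul_comm, mul_star_eq, smul_smul, inv_mul_cancel₀ h, one_smul]

theorem nrd_unit_inv (u : ℍ[K, a, b]ˣ) :
    nrd (↑u⁻¹ : ℍ[K, a, b]) = (nrd (u : ℍ[K, a, b]))⁻¹ := by
  refine eq_inv_of_mul_eq_one_left ?_
  rw [← map_mul, Units.inv_mul, map_one]

/-- The reduced trace form is nondegenerate. -/
theorem eq_zero_of_trd_mul_star (h2 : (2 : K) ≠ 0) (ha : a ≠ 0) (hb : b ≠ 0) {z : ℍ[K, a, b]}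
    (h : ∀ x, trd (x * star z) = 0) : z = 0 := by
  have h0 := h 1
  have h1 := h ⟨0, 1, 0, 0⟩
  have h3 := h ⟨0, 0, 1, 0⟩
  have h4 := h ⟨0, 0, 0, 1⟩
  simp [trd, h2, ha, hb] at h0 h1 h3 h4
  ext <;> assumption

/-- An isotropic norm form is universal. -/
theorem exists_nrd_eq_of_isotropic (h2 : (2 : K) ≠ 0) (ha : a ≠ 0) (hb : b ≠ 0)
    {z : ℍ[K, a, b]} (hz : z ≠ 0) (hn : nrd z = 0) (c : K) : ∃ x : ℍ[K, a, b], nrd x = c := by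
  obtain ⟨x, hx⟩ : ∃ x, trd (x * star z) ≠ 0 := by
    by_contra! h
    exact hz (eq_zero_of_trd_mul_star h2 ha hb h)
  -- As nrd z = 0, the norm of x + t z is affine in t with slope trd (x * star z) ≠ 0; this t solves
  -- for the value c.
  refine ⟨x + ((c - nrd x) / trd (x * star z)) • z, ?_⟩
  rw [nrd_add, nrd_smul, hn, star_smul', mul_smul_comm, trd_smul]
  field_simp
  ring

/-- For `x` not a scalar there is an invertible pure quaternion `p` orthogonal to `x`. -/
theorem exists_pure_orthogonal (h2 : (2 : K) ≠ 0) (ha : a ≠ 0) (hb : b ≠ 0) (x : ℍ[K, a, b])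
    (hx : ∀ c : K, x ≠ c • 1) :
    ∃ p : ℍ[K, a, b], trd p = 0 ∧ nrd p ≠ 0 ∧ trd (star p * x) = 0 := by
  by_contra! h
  -- Three pure quaternions orthogonal to x, analogues of the cross products of its pure part with
  -- the basis vectors. If all three are isotropic, the resulting equations kill the pure part of x.
  have h1 : nrd (⟨0, 0, a * x.imK, x.imJ⟩ : ℍ[K, a, b]) = 0 := by
    by_contra hn
    exact h _ (by simp [trd]) hn (by simp [trd]; right; ring)
  have h3 : nrd (⟨0, b * x.imK, 0, x.imI⟩ : ℍ[K, a, b]) = 0 := by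
    by_contra hn
    exact h _ (by simp [trd]) hn (by simp [trd]; right; ring)
  have h4 : nrd (⟨0, b * x.imJ, - a * x.imI, 0⟩ : ℍ[K, a, b]) = 0 := by
    by_contra hn
    exact h _ (by simp [trd]) hn (by simp [trd]; right; ring)
  simp only [nrd_apply] at h1 h3 h4
  have hab : a * b ≠ 0 := mul_ne_zero ha hb
  have e1 : x.imJ ^ 2 = a * x.imK ^ 2 := mul_left_cancel₀ hab (by linear_combination h1)
  have e2 : x.imI ^ 2 = b * x.imK ^ 2 := mul_left_cancel₀ hab (by linear_combination h3)
  have e3 : b * x.imJ ^ 2 + a * x.imI ^ 2 = 0 := mul_left_cancel₀ hab (by linear_combination -h4)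
  have e4 : x.imK = 0 := by
    have : 2 * (a * b) * x.imK ^ 2 = 0 := by linear_combination e3 - b * e1 - a * e2
    simpa [h2, ha, hb] using this
  refine hx x.re ?_
  ext <;> simp [e4] at * <;> assumption

/-- Two ring-theoretic sums used to average over the standard basis. -/
theorem sum_conj_basis (ha : a ≠ 0) (hb : b ≠ 0) (s : ℍ[K, a, b]) :
    s + a⁻¹ • ((⟨0, 1, 0, 0⟩ : ℍ[K, a, b]) * s * ⟨0, 1, 0, 0⟩) +
      b⁻¹ • ((⟨0, 0, 1, 0⟩ : ℍ[K, a, b]) * s * ⟨0, 0, 1, 0⟩) -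
      (a * b)⁻¹ • ((⟨0, 0, 0, 1⟩ : ℍ[K, a, b]) * s * ⟨0, 0, 0, 1⟩) =
      (2 * trd s) • (1 : ℍ[K, a, b]) := by
  ext <;> simp [trd] <;> field_simp <;> ring

/-- Every term of `sum_conj_basis` at s = star z * w is annihilated by z on the left, while the sum
is the scalar 2 trd s. So trd s = 0 for all w, and nondegeneracy applies. This is where simplicity
of the algebra enters: it excludes nonzero intertwiners of norm zero. -/
theorem eq_zero_of_mul_mul_star (h2 : (2 : K) ≠ 0) (ha : a ≠ 0) (hb : b ≠ 0) {z : ℍ[K, a, b]}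
    (h : ∀ y, z * y * star z = 0) : z = 0 := by
  by_contra hz
  refine hz (eq_zero_of_trd_mul_star h2 ha hb fun w => ?_)
  have h0 : ∀ y t, z * (y * (star z * w) * t) = 0 := by
    intro y t
    rw [← mul_assoc, ← mul_assoc, ← mul_assoc, h, zero_mul, zero_mul]
  have h1 : z * (star z * w) = 0 := by simpa using h0 1 1
  have e := congrArg (z * ·) (sum_conj_basis ha hb (star z * w))
  simp only [mul_add, mul_sub, mul_smul_comm, h0, h1, smul_zero, add_zero, sub_zero,
    mul_one] at e
  have e1 := (smul_eq_zero.mp e.symm).resolve_right hz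
  rw [trd_mul_comm]
  exact (mul_eq_zero.mp e1).resolve_left h2

/-- Skolem–Noether for quaternion algebras: endomorphisms are inner. -/
theorem exists_intertwiner (h2 : (2 : K) ≠ 0) (ha : a ≠ 0) (hb : b ≠ 0)
    (φ : ℍ[K, a, b] →ₐ[K] ℍ[K, a, b]) :
    ∃ u : ℍ[K, a, b]ˣ, ∀ x, φ x * u = u * x := by
  set i : ℍ[K, a, b] := ⟨0, 1, 0, 0⟩ with hi
  set j : ℍ[K, a, b] := ⟨0, 0, 1, 0⟩ with hj
  set k : ℍ[K, a, b] := ⟨0, 0, 0, 1⟩ with hk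
  have hii : i * i = a • 1 := by ext <;> simp [hi]
  have hjj : j * j = b • 1 := by ext <;> simp [hj]
  have hij : i * j = k := by ext <;> simp [hi, hj, hk]
  have hji : j * i = -k := by ext <;> simp [hi, hj, hk]
  have hik : i * k = a • j := by ext <;> simp [hi, hj, hk]
  have hki : k * i = - (a • j) := by ext <;> simp [hi, hj, hk]
  have hjk : j * k = - (b • i) := by ext <;> simp [hi, hj, hk]
  have hkj : k * j = b • i := by ext <;> simp [hi, hj, hk]
  have hdec : ∀ x : ℍ[K, a, b], x = x.re • 1 + x.imI • i + x.imJ • j + x.imK • k := by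
    intro x; ext <;> simp [hi, hj, hk]
  -- The average Σ φ(e) c e⁻¹ over e = 1, i, j, k, with i⁻¹ = a⁻¹ i, j⁻¹ = b⁻¹ j and k⁻¹ = -(ab)⁻¹
  -- k. It intertwines φ with the identity for every c.
  let β : ℍ[K, a, b] → ℍ[K, a, b] := fun c =>
    c + a⁻¹ • (φ i * c * i) + b⁻¹ • (φ j * c * j) - (a * b)⁻¹ • (φ k * c * k)
  have hβi : ∀ c, φ i * β c = β c * i := by
    intro c
    have e1 : φ i * φ i = a • 1 := by rw [← map_mul, hii, map_smul, map_one]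
    have e2 : φ i * φ j = φ k := by rw [← map_mul, hij]
    have e3 : φ i * φ k = a • φ j := by rw [← map_mul, hik, map_smul]
    simp only [β, mul_add, mul_sub, add_mul, sub_mul, mul_smul_comm, smul_mul_assoc]
    simp only [← mul_assoc, e1, e2, e3]
    simp only [mul_assoc, hii, hji, hki, smul_mul_assoc, one_mul, mul_smul_comm, mul_one,
      mul_neg, smul_smul, smul_neg, inv_mul_cancel₀ ha]
    have e4 : (a * b)⁻¹ * a = b⁻¹ := by field_simp
    rw [e4]; simp only [one_smul]; abel
  have hβj : ∀ c, φ j * β c = β c * j := by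
    intro c
    have e1 : φ j * φ j = b • 1 := by rw [← map_mul, hjj, map_smul, map_one]
    have e2 : φ j * φ i = - φ k := by rw [← map_mul, hji, map_neg]
    have e3 : φ j * φ k = - (b • φ i) := by rw [← map_mul, hjk, map_neg, map_smul]
    simp only [β, mul_add, mul_sub, add_mul, sub_mul, mul_smul_comm, smul_mul_assoc]
    simp only [← mul_assoc, e1, e2, e3]
    simp only [mul_assoc, hjj, hij, hkj, smul_mul_assoc, one_mul, mul_smul_comm, mul_one,
      neg_mul, smul_smul, smul_neg, inv_mul_cancel₀ hb]
    have e4 : (a * b)⁻¹ * b = a⁻¹ := by field_simp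
    rw [e4]; simp only [one_smul]; abel
  have hβ : ∀ c x, φ x * β c = β c * x := by
    intro c x
    have hk' : φ k * β c = β c * k := by
      rw [← hij, map_mul, mul_assoc, hβj, ← mul_assoc, hβi, mul_assoc]
    rw [hdec x]
    simp only [map_add, map_smul, map_one, add_mul, mul_add, smul_mul_assoc, mul_smul_comm,
      hβi, hβj, hk', one_mul, mul_one]
  -- Averaging a second time, Σ β(e) e⁻¹ = Σ φ(f) T(f⁻¹), where T(s) = 2 trd s. Only f = 1
  -- contributes, and its value 4 is nonzero.
  obtain ⟨c, hc⟩ : ∃ c, β c ≠ 0 := by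
    by_contra! h
    let T : ℍ[K, a, b] → ℍ[K, a, b] := fun s =>
      s + a⁻¹ • (i * s * i) + b⁻¹ • (j * s * j) - (a * b)⁻¹ • (k * s * k)
    have hT : ∀ s, T s = (2 * trd s) • 1 := sum_conj_basis ha hb
    have e : β 1 + a⁻¹ • (β i * i) + b⁻¹ • (β j * j) - (a * b)⁻¹ • (β k * k) =
        T 1 + a⁻¹ • (φ i * T i) + b⁻¹ • (φ j * T j) - (a * b)⁻¹ • (φ k * T k) := by
      simp only [β, T, add_mul, sub_mul, smul_mul_assoc, mul_assoc, mul_add, mul_sub,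
        one_mul, mul_smul_comm]
      module
    have ti : trd i = 0 := by simp [trd, hi]
    have tj : trd j = 0 := by simp [trd, hj]
    have tk : trd k = 0 := by simp [trd, hk]
    rw [hT, hT, hT, hT, ti, tj, tk, trd_one] at e
    simp only [mul_zero, zero_smul] at e
    simp only [h, zero_mul, smul_zero, add_zero, sub_zero] at e
    have := congrArg QuaternionAlgebra.re e
    simp [h2] at this
  have hn : nrd (β c) ≠ 0 := fun hn => hc <| eq_zero_of_mul_mul_star h2 ha hb fun y => by
    rw [← hβ, mul_assoc, mul_star_eq, hn, zero_smul, mul_zero]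
  obtain ⟨u, hu⟩ := isUnit_of_nrd_ne_zero hn
  exact ⟨u, fun x => by rw [hu]; exact hβ c x⟩

end QuaternionGeneric

/-! ### Integral coordinates, and integrality of norm and trace on orders. -/

section CoordLattice

variable (A : Type*) {K : Type*} [CommRing A] [IsDomain A] [Field K] [Algebra A K]
  [IsFractionRing A K] (a b : K)

/-- The lattice of quaternions with integral coordinates. -/
def coordLattice : Submodule A ℍ[K, a, b] where
  carrier := {x | x.re ∈ (algebraMap A K).range ∧ x.imI ∈ (algebraMap A K).range ∧
    x.imJ ∈ (algebraMap A K).range ∧ x.imK ∈ (algebraMap A K).range}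
  zero_mem' := ⟨zero_mem _, zero_mem _, zero_mem _, zero_mem _⟩
  add_mem' := fun ⟨h1, h2, h3, h4⟩ ⟨g1, g2, g3, g4⟩ =>
    ⟨add_mem h1 g1, add_mem h2 g2, add_mem h3 g3, add_mem h4 g4⟩
  smul_mem' := by
    rintro c x ⟨h1, h2, h3, h4⟩
    have : ∀ y ∈ (algebraMap A K).range, c • y ∈ (algebraMap A K).range := by
      rintro _ ⟨y, rfl⟩
      exact ⟨c * y, by rw [map_mul, Algebra.smul_def]⟩
    exact ⟨this _ h1, this _ h2, this _ h3, this _ h4⟩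

variable {A a b}

theorem mem_coordLattice {x : ℍ[K, a, b]} : x ∈ coordLattice A a b ↔
    x.re ∈ (algebraMap A K).range ∧ x.imI ∈ (algebraMap A K).range ∧
    x.imJ ∈ (algebraMap A K).range ∧ x.imK ∈ (algebraMap A K).range := Iff.rfl

theorem exists_smul_mem_range (x : K) : ∃ d : A, d ≠ 0 ∧ d • x ∈ (algebraMap A K).range := by
  obtain ⟨d, h⟩ := IsLocalization.exists_integer_multiple A⁰ x
  exact ⟨d, nonZeroDivisors.ne_zero d.2, h⟩

theorem smul_mem_range (d : A) {x : K} (hx : x ∈ (algebraMap A K).range) :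
    d • x ∈ (algebraMap A K).range := by
  obtain ⟨y, rfl⟩ := hx
  exact ⟨d * y, by rw [map_mul, Algebra.smul_def]⟩

theorem exists_smul_mem_coordLattice (x : ℍ[K, a, b]) :
    ∃ d : A, d ≠ 0 ∧ d • x ∈ coordLattice A a b := by
  obtain ⟨d1, h1, e1⟩ := exists_smul_mem_range (A := A) x.re
  obtain ⟨d2, h2, e2⟩ := exists_smul_mem_range (A := A) x.imI
  obtain ⟨d3, h3, e3⟩ := exists_smul_mem_range (A := A) x.imJ
  obtain ⟨d4, h4, e4⟩ := exists_smul_mem_range (A := A) x.imK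
  refine ⟨d1 * d2 * d3 * d4, by simp [h1, h2, h3, h4], ?_, ?_, ?_, ?_⟩
  · rw [show d1 * d2 * d3 * d4 = (d2 * d3 * d4) * d1 by ring, mul_smul]
    exact smul_mem_range _ e1
  · rw [show d1 * d2 * d3 * d4 = (d1 * d3 * d4) * d2 by ring, mul_smul]
    exact smul_mem_range _ e2
  · rw [show d1 * d2 * d3 * d4 = (d1 * d2 * d4) * d3 by ring, mul_smul]
    exact smul_mem_range _ e3
  · rw [mul_smul]
    exact smul_mem_range _ e4

/-- A finitely generated module is contained in a multiple of the coordinate lattice. -/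
theorem exists_smul_le_coordLattice {N : Submodule A ℍ[K, a, b]} (hN : N.FG) :
    ∃ d : A, d ≠ 0 ∧ ∀ x ∈ N, d • x ∈ coordLattice A a b := by
  classical
  obtain ⟨s, rfl⟩ := hN
  induction s using Finset.induction_on with
  | empty => exact ⟨1, one_ne_zero, fun x hx => by simp at hx; simp [hx]⟩
  | insert y s _ ih =>
    obtain ⟨d, hd, h⟩ := ih
    obtain ⟨e, he, h'⟩ := exists_smul_mem_coordLattice (A := A) y
    refine ⟨d * e, mul_ne_zero hd he, fun x hx => ?_⟩
    rw [Finset.coe_insert, Submodule.mem_span_insert] at hx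
    obtain ⟨c, z, hz, rfl⟩ := hx
    rw [smul_add]
    refine add_mem ?_ ?_
    · rw [smul_smul, show d * e * c = (d * c) * e by ring, mul_smul]
      exact Submodule.smul_mem _ _ h'
    · rw [mul_comm, mul_smul]
      exact Submodule.smul_mem _ _ (h z hz)

theorem exists_smul_mem_of_mem_span {N : Submodule A ℍ[K, a, b]} {x : ℍ[K, a, b]}
    (hx : x ∈ Submodule.span K (N : Set ℍ[K, a, b])) : ∃ d : A, d ≠ 0 ∧ d • x ∈ N := by
  induction hx using Submodule.span_induction with
  | mem x h => exact ⟨1, one_ne_zero, by simpa using h⟩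
  | zero => exact ⟨1, one_ne_zero, by simp⟩
  | add x y _ _ hx hy =>
    obtain ⟨d, hd, h⟩ := hx
    obtain ⟨e, he, h'⟩ := hy
    refine ⟨d * e, mul_ne_zero hd he, ?_⟩
    rw [smul_add]
    refine add_mem ?_ ?_
    · rw [mul_comm, mul_smul]; exact N.smul_mem _ h
    · rw [mul_smul]; exact N.smul_mem _ h'
  | smul c x _ hx =>
    obtain ⟨d, hd, h⟩ := hx
    obtain ⟨e, he, n, hn⟩ := exists_smul_mem_range (A := A) c
    refine ⟨d * e, mul_ne_zero hd he, ?_⟩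
    have : (d * e) • c • x = n • d • x := by
      have h1 : e • c • x = n • x := by
        rw [← smul_assoc, ← hn, algebraMap_smul]
      rw [mul_smul, h1, smul_comm]
    rw [this]
    exact N.smul_mem _ h

/-- A full lattice contains a multiple of the coordinate lattice. -/
theorem exists_smul_coordLattice_le {N : Submodule A ℍ[K, a, b]}
    (hN : Submodule.span K (N : Set ℍ[K, a, b]) = ⊤) :
    ∃ d : A, d ≠ 0 ∧ ∀ x ∈ coordLattice A a b, d • x ∈ N := by
  have h : ∀ x, ∃ d : A, d ≠ 0 ∧ d • x ∈ N := fun x =>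
    exists_smul_mem_of_mem_span (hN ▸ Submodule.mem_top)
  obtain ⟨d1, h1, e1⟩ := h ⟨1, 0, 0, 0⟩
  obtain ⟨d2, h2, e2⟩ := h ⟨0, 1, 0, 0⟩
  obtain ⟨d3, h3, e3⟩ := h ⟨0, 0, 1, 0⟩
  obtain ⟨d4, h4, e4⟩ := h ⟨0, 0, 0, 1⟩
  refine ⟨d1 * d2 * d3 * d4, by simp [h1, h2, h3, h4], fun x hx => ?_⟩
  obtain ⟨⟨c1, g1⟩, ⟨c2, g2⟩, ⟨c3, g3⟩, ⟨c4, g4⟩⟩ := hx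
  have hx' : x = c1 • (⟨1, 0, 0, 0⟩ : ℍ[K, a, b]) + c2 • (⟨0, 1, 0, 0⟩ : ℍ[K, a, b]) +
      c3 • (⟨0, 0, 1, 0⟩ : ℍ[K, a, b]) + c4 • (⟨0, 0, 0, 1⟩ : ℍ[K, a, b]) := by
    simp only [← algebraMap_smul K c1, ← algebraMap_smul K c2, ← algebraMap_smul K c3,
      ← algebraMap_smul K c4, g1, g2, g3, g4]
    ext <;> simp
  rw [hx']
  simp only [smul_add, smul_smul]
  rw [show d1 * d2 * d3 * d4 * c1 = (d2 * d3 * d4 * c1) * d1 by ring,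
    show d1 * d2 * d3 * d4 * c2 = (d1 * d3 * d4 * c2) * d2 by ring,
    show d1 * d2 * d3 * d4 * c3 = (d1 * d2 * d4 * c3) * d3 by ring,
    show d1 * d2 * d3 * d4 * c4 = (d1 * d2 * d3 * c4) * d4 by ring]
  simp only [mul_smul _ d1, mul_smul _ d2, mul_smul _ d3, mul_smul _ d4]
  exact add_mem (add_mem (add_mem (N.smul_mem _ e1) (N.smul_mem _ e2)) (N.smul_mem _ e3))
    (N.smul_mem _ e4)

theorem exists_smul_nrd_mem_range {N : Submodule A ℍ[K, a, b]} (hN : N.FG) :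
    ∃ d : A, d ≠ 0 ∧ ∀ x ∈ N, d • nrd x ∈ (algebraMap A K).range := by
  obtain ⟨d, hd, h⟩ := exists_smul_le_coordLattice hN
  obtain ⟨e, he, ea, ha⟩ := exists_smul_mem_range (A := A) a
  obtain ⟨f, hf, fb, hb⟩ := exists_smul_mem_range (A := A) b
  rw [Algebra.smul_def] at ha hb
  refine ⟨d ^ 2 * (e * f), by simp [hd, he, hf], fun x hx => ?_⟩
  obtain ⟨⟨c1, g1⟩, ⟨c2, g2⟩, ⟨c3, g3⟩, ⟨c4, g4⟩⟩ := h x hx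
  replace g1 := g1.trans (Algebra.smul_def d x.re)
  replace g2 := g2.trans (Algebra.smul_def d x.imI)
  replace g3 := g3.trans (Algebra.smul_def d x.imJ)
  replace g4 := g4.trans (Algebra.smul_def d x.imK)
  refine ⟨e * f * c1 ^ 2 - f * ea * c2 ^ 2 - e * fb * c3 ^ 2 + ea * fb * c4 ^ 2, ?_⟩
  rw [nrd_apply, Algebra.smul_def]
  simp only [map_add, map_sub, map_mul, map_pow, g1, g2, g3, g4, ha, hb]
  ring

variable [IsNoetherianRing A] [IsIntegrallyClosed A]

/-- All powers of x lie in O, and the norms from O have a common denominator. So nrd x is almost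
integral, hence integral because A is noetherian. -/
theorem nrd_mem_range {O : Subalgebra A ℍ[K, a, b]} (hO : (Subalgebra.toSubmodule O).FG)
    {x : ℍ[K, a, b]} (hx : x ∈ O) : nrd x ∈ (algebraMap A K).range := by
  obtain ⟨d, hd, h⟩ := exists_smul_nrd_mem_range hO
  have h1 : IsAlmostIntegral A (nrd x) :=
    ⟨d, mem_nonZeroDivisors_of_ne_zero hd, fun n => by
      rw [← map_pow]; exact h _ (pow_mem hx n)⟩
  have h2 := h1.isIntegral_of_nonZeroDivisors_le_comap
    (fun y hy => by
      rw [Submonoid.mem_comap]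
      exact mem_nonZeroDivisors_of_ne_zero
        ((map_ne_zero_iff _ (IsFractionRing.injective A K)).mpr (nonZeroDivisors.ne_zero hy)))
  exact IsIntegrallyClosed.isIntegral_iff.mp h2

theorem trd_mem_range {O : Subalgebra A ℍ[K, a, b]} (hO : (Subalgebra.toSubmodule O).FG)
    {x : ℍ[K, a, b]} (hx : x ∈ O) : trd x ∈ (algebraMap A K).range := by
  have h : trd x = nrd (x + 1) - nrd x - 1 := by rw [nrd_add, star_one, mul_one, map_one]; ring
  rw [h]
  exact sub_mem (sub_mem (nrd_mem_range hO (add_mem hx (one_mem _))) (nrd_mem_range hO hx))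
    (one_mem _)

theorem star_mem {O : Subalgebra A ℍ[K, a, b]} (hO : (Subalgebra.toSubmodule O).FG)
    {x : ℍ[K, a, b]} (hx : x ∈ O) : star x ∈ O := by
  obtain ⟨t, ht⟩ := trd_mem_range hO hx
  rw [star_eq, ← ht, algebraMap_smul]
  exact sub_mem (O.smul_mem (one_mem _) t) hx

end CoordLattice

/-! ### Maximal orders over a discrete valuation ring: elements of unit discriminant. -/

section LocalOrder

variable {A K : Type*} [CommRing A] [IsDomain A] [IsDiscreteValuationRing A] [Field K]
  [Algebra A K] [IsFractionRing A K] {a b : K}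

/-- Finitely many elements of `K`, not all zero, become integral with one of them a unit after
scaling. -/
theorem exists_primitive_multiple {ι : Type*} [Finite ι] (g : ι → K) {i₀ : ι} (hg : g i₀ ≠ 0) :
    ∃ (r : K) (c : ι → A) (i : ι), r ≠ 0 ∧ (∀ j, algebraMap A K (c j) = r * g j) ∧ c i = 1 := by
  have : Nonempty ι := ⟨i₀⟩
  obtain ⟨i, hi⟩ := Finite.exists_max (fun j => ValuationRing.valuation A K (g j))
  have hi0 : g i ≠ 0 := by
    intro h0
    have h1 := hi i₀
    rw [h0, map_zero, le_zero_iff, map_eq_zero] at h1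
    exact hg h1
  have : ∀ j, ∃ c : A, algebraMap A K c = (g i)⁻¹ * g j := by
    intro j
    rw [← ValuationRing.mem_integer_iff, Valuation.mem_integer_iff, map_mul, map_inv₀]
    have h2 : ValuationRing.valuation A K (g i) ≠ 0 := (map_ne_zero _).mpr hi0
    exact (mul_le_mul_right (hi j) _).trans_eq (inv_mul_cancel₀ h2)
  choose c hc using this
  refine ⟨(g i)⁻¹, c, i, inv_ne_zero hi0, hc, ?_⟩
  apply IsFractionRing.injective A K
  rw [hc, inv_mul_cancel₀ hi0, map_one]

/-- Five quaternions satisfy a primitive integral linear relation. -/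
theorem exists_primitive_relation (x : Fin 5 → ℍ[K, a, b]) :
    ∃ c : Fin 5 → A, (∃ i, c i = 1) ∧ ∑ i, c i • x i = 0 := by
  have h : ¬ LinearIndependent K x := by
    intro h
    have h1 := h.fintype_card_le_finrank
    rw [QuaternionAlgebra.finrank_eq_four] at h1
    simp at h1
  rw [Fintype.not_linearIndependent_iff] at h
  obtain ⟨g, hg, i₀, hi₀⟩ := h
  obtain ⟨r, c, i, _, hc, hi⟩ := exists_primitive_multiple (A := A) g hi₀
  refine ⟨c, ⟨i, hi⟩, ?_⟩
  have : ∀ j, c j • x j = r • g j • x j := fun j => by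
    rw [← algebraMap_smul K (c j), hc, mul_smul]
  simp only [this, ← Finset.smul_sum, hg, smul_zero]

variable {ϖ : A} {O : Subalgebra A ℍ[K, a, b]}

/-- The multiples `ϖ O`. -/
def uniformizerMul (ϖ : A) (O : Subalgebra A ℍ[K, a, b]) : Submodule A ℍ[K, a, b] :=
  (Subalgebra.toSubmodule O).map (LinearMap.lsmul A ℍ[K, a, b] ϖ)

theorem mul_mem_uniformizerMul_left {x o : ℍ[K, a, b]} (ho : o ∈ O)
    (hx : x ∈ uniformizerMul ϖ O) : o * x ∈ uniformizerMul ϖ O := by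
  obtain ⟨y, hy, rfl⟩ := hx
  exact ⟨o * y, O.mul_mem ho hy, by simp⟩

theorem mul_mem_uniformizerMul_right {x o : ℍ[K, a, b]} (ho : o ∈ O)
    (hx : x ∈ uniformizerMul ϖ O) : x * o ∈ uniformizerMul ϖ O := by
  obtain ⟨y, hy, rfl⟩ := hx
  exact ⟨y * o, O.mul_mem hy ho, by simp⟩

theorem dvd_of_smul_mem (hϖ : Irreducible ϖ) {c : A} {x : ℍ[K, a, b]}
    (hx : x ∉ uniformizerMul ϖ O) (h : c • x ∈ uniformizerMul ϖ O) : ϖ ∣ c := by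
  by_contra hc
  have hu : IsUnit c := by
    by_contra hn
    rw [← mem_nonunits_iff, ← IsLocalRing.mem_maximalIdeal, hϖ.maximalIdeal_eq,
      Ideal.mem_span_singleton] at hn
    exact hc hn
  obtain ⟨u, rfl⟩ := hu
  refine hx ?_
  have := (uniformizerMul ϖ O).smul_mem (↑u⁻¹ : A) h
  rwa [smul_smul, Units.inv_mul, one_smul] at this

/-- An order is not generated by `1` and one further element modulo `ϖ`. -/
theorem not_generated_by_two (hϖ : Irreducible ϖ) (hO : IsOrder O) (m : ℍ[K, a, b])
    (h : ∀ o ∈ O, ∃ c d : A, o - c • 1 - d • m ∈ uniformizerMul ϖ O) : False := by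
  -- Nakayama's lemma: O would be spanned by 1 and m, against its rank 4.
  have h1 : Subalgebra.toSubmodule O ≤ Submodule.span A {1, m} := by
    refine Submodule.le_of_le_smul_of_le_jacobson_bot (I := Ideal.span {ϖ}) hO.1
      (by rw [IsLocalRing.jacobson_eq_maximalIdeal _ bot_ne_top, hϖ.maximalIdeal_eq]) ?_
    intro o ho
    obtain ⟨c, d, y, hy, hoy⟩ := h o ho
    rw [Submodule.mem_sup]
    refine ⟨c • 1 + d • m, Submodule.mem_span_pair.mpr ⟨c, d, rfl⟩, ϖ • y,
      Submodule.smul_mem_smul (Ideal.mem_span_singleton_self ϖ) hy, ?_⟩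
    rw [LinearMap.lsmul_apply] at hoy
    rw [hoy]; abel
  have h2 : Submodule.span K ({1, m} : Set ℍ[K, a, b]) = ⊤ := by
    rw [eq_top_iff, ← hO.2, Submodule.span_le]
    intro o ho
    exact Submodule.span_le_restrictScalars A K _ (h1 ho)
  classical
  have h3 := finrank_span_le_card (R := K) ({1, m} : Set ℍ[K, a, b])
  rw [h2, finrank_top, QuaternionAlgebra.finrank_eq_four] at h3
  have h4 : ({1, m} : Set ℍ[K, a, b]).toFinset.card ≤ 2 := by
    rw [Set.toFinset_insert, Set.toFinset_singleton]
    exact Finset.card_le_two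
  omega

/-- The elements of `O` whose norm is divisible by the uniformizer. -/
def NrdDvd (ϖ : A) (O : Subalgebra A ℍ[K, a, b]) (x : ℍ[K, a, b]) : Prop :=
  x ∈ O ∧ ∃ c : A, algebraMap A K (ϖ * c) = nrd x

/-- All discriminants of elements of `O` are divisible by the uniformizer. -/
def DiscDvd (ϖ : A) (O : Subalgebra A ℍ[K, a, b]) : Prop :=
  ∀ y ∈ O, ∀ t n : A, algebraMap A K t = trd y → algebraMap A K n = nrd y → ϖ ∣ t ^ 2 - 4 * n

theorem NrdDvd.trd (hϖ : Irreducible ϖ) (hO : IsOrder O) (hD : DiscDvd ϖ O) {x : ℍ[K, a, b]}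
    (hx : NrdDvd ϖ O x) : ∃ t : A, algebraMap A K (ϖ * t) = trd x := by
  obtain ⟨hxO, c, hc⟩ := hx
  obtain ⟨t, ht⟩ := trd_mem_range hO.1 hxO
  have h1 := hD x hxO t _ ht hc
  have h2 : ϖ ∣ t ^ 2 := by
    have := dvd_add h1 (Dvd.intro (4 * c) rfl : ϖ ∣ ϖ * (4 * c))
    rwa [show t ^ 2 - 4 * (ϖ * c) + ϖ * (4 * c) = t ^ 2 by ring] at this
  obtain ⟨s, rfl⟩ := hϖ.prime.dvd_of_dvd_pow h2
  exact ⟨s, ht⟩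

theorem NrdDvd.mul_right (hO : IsOrder O) {x o : ℍ[K, a, b]} (hx : NrdDvd ϖ O x) (ho : o ∈ O) :
    NrdDvd ϖ O (x * o) := by
  obtain ⟨hxO, c, hc⟩ := hx
  obtain ⟨n, hn⟩ := nrd_mem_range hO.1 ho
  exact ⟨mul_mem hxO ho, c * n, by rw [map_mul nrd, ← hc, ← hn, ← map_mul]; ring_nf⟩

/-- The cross term trd (x * star y) is divisible by ϖ, since x * star y again has norm divisible by
ϖ. Together with `NrdDvd.mul_right`, the elements of norm divisible by ϖ, called P below, form a
right ideal of O. -/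
theorem NrdDvd.add (hϖ : Irreducible ϖ) (hO : IsOrder O) (hD : DiscDvd ϖ O) {x y : ℍ[K, a, b]}
    (hx : NrdDvd ϖ O x) (hy : NrdDvd ϖ O y) : NrdDvd ϖ O (x + y) := by
  obtain ⟨t, ht⟩ := (hx.mul_right hO (star_mem hO.1 hy.1)).trd hϖ hO hD
  obtain ⟨hxO, c, hc⟩ := hx
  obtain ⟨hyO, d, hd⟩ := hy
  refine ⟨add_mem hxO hyO, c + t + d, ?_⟩
  rw [nrd_add, ← hc, ← ht, ← hd]
  simp only [map_mul, map_add]; ring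

theorem NrdDvd.mul_self (hϖ : Irreducible ϖ) (hO : IsOrder O) (hD : DiscDvd ϖ O)
    {x : ℍ[K, a, b]} (hx : NrdDvd ϖ O x) : x * x ∈ uniformizerMul ϖ O := by
  obtain ⟨t, ht⟩ := hx.trd hϖ hO hD
  obtain ⟨hxO, c, hc⟩ := hx
  refine ⟨t • x - c • 1, sub_mem (O.smul_mem hxO t) (O.smul_mem (one_mem _) c), ?_⟩
  rw [mul_self_eq, ← ht, ← hc, algebraMap_smul, algebraMap_smul, LinearMap.lsmul_apply, smul_sub,
    smul_smul, smul_smul]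

theorem NrdDvd.anticomm (hϖ : Irreducible ϖ) (hO : IsOrder O) (hD : DiscDvd ϖ O)
    {x y : ℍ[K, a, b]} (hx : NrdDvd ϖ O x) (hy : NrdDvd ϖ O y) :
    x * y + y * x ∈ uniformizerMul ϖ O := by
  have h := sub_mem (sub_mem ((hx.add hϖ hO hD hy).mul_self hϖ hO hD) (hx.mul_self hϖ hO hD))
    (hy.mul_self hϖ hO hD)
  have e : (x + y) * (x + y) - x * x - y * y = x * y + y * x := by noncomm_ring
  rwa [e] at h

/-- Modulo ϖ, elements of P anticommute and have square zero, and xyx = (xy + yx)x - y x². -/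
theorem NrdDvd.sandwich (hϖ : Irreducible ϖ) (hO : IsOrder O) (hD : DiscDvd ϖ O)
    {x y : ℍ[K, a, b]} (hx : NrdDvd ϖ O x) (hy : NrdDvd ϖ O y) :
    x * y * x ∈ uniformizerMul ϖ O := by
  have h := sub_mem (mul_mem_uniformizerMul_right hx.1 (hx.anticomm hϖ hO hD hy))
    (mul_mem_uniformizerMul_left hy.1 (hx.mul_self hϖ hO hD))
  have e : (x * y + y * x) * x - y * (x * x) = x * y * x := by noncomm_ring
  rwa [e] at h

/-- If all discriminants vanish modulo `ϖ`, triple products of elements of norm divisible by `ϖ`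
vanish modulo `ϖ`. -/
theorem NrdDvd.triple_product (hϖ : Irreducible ϖ) (hO : IsOrder O) (hD : DiscDvd ϖ O)
    {x y z : ℍ[K, a, b]} (hx : NrdDvd ϖ O x) (hy : NrdDvd ϖ O y) (hz : NrdDvd ϖ O z) :
    x * y * z ∈ uniformizerMul ϖ O := by
  by_contra hw
  -- Suppose xyz ∉ ϖO. Multiplying the relation by yz on the right, by x and z on the two sides, by
  -- xy on the left, and by z on the right isolates in turn c 0, c 1, c 2, c 3 times xyz modulo ϖ; c
  -- 4 is left. So ϖ divides every coefficient, against primitivity.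
  obtain ⟨c, ⟨i, hi⟩, hc⟩ :=
    exists_primitive_relation (A := A) ![x, y, z, x * y, x * y * z]
  simp only [Fin.sum_univ_five, Matrix.cons_val] at hc
  set J := uniformizerMul ϖ O
  have hxO := hx.1
  have hyO := hy.1
  have hzO := hz.1
  have cJ : ∀ {d : A} {t : ℍ[K, a, b]}, ϖ ∣ d → t ∈ O → d • t ∈ J := by
    rintro _ t ⟨d, rfl⟩ ht
    exact ⟨d • t, O.smul_mem ht d, by simp only [LinearMap.lsmul_apply, mul_smul]⟩
  have hxx := hx.mul_self hϖ hO hD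
  have hyy := hy.mul_self hϖ hO hD
  have hzz := hz.mul_self hϖ hO hD
  have hzyz := hz.sandwich hϖ hO hD hy
  have hyzy := hy.sandwich hϖ hO hD hz
  have hyxy := hy.sandwich hϖ hO hD hx
  have h0 : ϖ ∣ c 0 := by
    refine dvd_of_smul_mem hϖ hw ?_
    have e : c 0 • (x * y * z) = -(c 1 • (y * y * z) + c 2 • (z * y * z) + c 3 • (x * (y * y) * z) +
        c 4 • (x * (y * z * y) * z)) := by
      have := congrArg (· * (y * z)) hc
      simp only [add_mul, smul_mul_assoc, zero_mul] at this
      rw [eq_neg_iff_add_eq_zero, ← this]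
      simp only [mul_assoc]; abel
    rw [e]
    refine neg_mem (add_mem (add_mem (add_mem ?_ ?_) ?_) ?_) <;> refine J.smul_mem _ ?_
    · exact mul_mem_uniformizerMul_right hzO hyy
    · exact hzyz
    · exact mul_mem_uniformizerMul_right hzO (mul_mem_uniformizerMul_left hxO hyy)
    · exact mul_mem_uniformizerMul_right hzO (mul_mem_uniformizerMul_left hxO hyzy)
  have h1 : ϖ ∣ c 1 := by
    refine dvd_of_smul_mem hϖ hw ?_
    have e : c 1 • (x * y * z) = -(c 0 • (x * x * z) + c 2 • (x * (z * z)) + c 3 • (x * x * y * z) +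
        c 4 • (x * x * (y * z * z))) := by
      have := congrArg (fun t => x * t * z) hc
      simp only [add_mul, mul_add, smul_mul_assoc, mul_smul_comm, zero_mul, mul_zero] at this
      rw [eq_neg_iff_add_eq_zero, ← this]
      simp only [mul_assoc]; abel
    rw [e]
    refine neg_mem (add_mem (add_mem (add_mem ?_ ?_) ?_) ?_) <;> refine J.smul_mem _ ?_
    · exact mul_mem_uniformizerMul_right hzO hxx
    · exact mul_mem_uniformizerMul_left hxO hzz
    · exact mul_mem_uniformizerMul_right hzO (mul_mem_uniformizerMul_right hyO hxx)
    · exact mul_mem_uniformizerMul_right (mul_mem (mul_mem hyO hzO) hzO) hxx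
  have h2 : ϖ ∣ c 2 := by
    refine dvd_of_smul_mem hϖ hw ?_
    have e : c 2 • (x * y * z) = -(c 0 • (x * y * x) + c 1 • (x * (y * y)) +
        c 3 • (x * (y * x * y)) + c 4 • (x * (y * x * y) * z)) := by
      have := congrArg (fun t => x * y * t) hc
      simp only [mul_add, mul_smul_comm, mul_zero] at this
      rw [eq_neg_iff_add_eq_zero, ← this]
      simp only [mul_assoc]; abel
    rw [e]
    refine neg_mem (add_mem (add_mem (add_mem ?_ ?_) ?_) ?_) <;> refine J.smul_mem _ ?_
    · exact hx.sandwich hϖ hO hD hy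
    · exact mul_mem_uniformizerMul_left hxO hyy
    · exact mul_mem_uniformizerMul_left hxO hyxy
    · exact mul_mem_uniformizerMul_right hzO (mul_mem_uniformizerMul_left hxO hyxy)
  have h3 : ϖ ∣ c 3 := by
    refine dvd_of_smul_mem hϖ hw ?_
    have e : c 3 • (x * y * z) = -(c 0 • (x * z) + c 1 • (y * z) + c 2 • (z * z) +
        c 4 • (x * y * (z * z))) := by
      have := congrArg (fun t => t * z) hc
      simp only [add_mul, smul_mul_assoc, zero_mul] at this
      rw [eq_neg_iff_add_eq_zero, ← this]
      simp only [mul_assoc]; abel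
    rw [e]
    refine neg_mem (add_mem (add_mem (add_mem ?_ ?_) ?_) ?_)
    · exact cJ h0 (mul_mem hxO hzO)
    · exact cJ h1 (mul_mem hyO hzO)
    · exact cJ h2 (mul_mem hzO hzO)
    · exact J.smul_mem _ (mul_mem_uniformizerMul_left (mul_mem hxO hyO) hzz)
  have h4 : ϖ ∣ c 4 := by
    refine dvd_of_smul_mem hϖ hw ?_
    have e : c 4 • (x * y * z) = -(c 0 • x + c 1 • y + c 2 • z + c 3 • (x * y)) := by
      rw [eq_neg_iff_add_eq_zero, ← hc]; abel
    rw [e]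
    exact neg_mem (add_mem (add_mem (add_mem (cJ h0 hxO) (cJ h1 hyO)) (cJ h2 hzO))
      (cJ h3 (mul_mem hxO hyO)))
  have : ϖ ∣ c i := by fin_cases i <;> assumption
  rw [hi] at this
  exact hϖ.not_isUnit (isUnit_of_dvd_one this)

/-- Over a finite residue field, a monic quadratic polynomial of vanishing discriminant has a
root modulo `ϖ`. -/
theorem exists_root_mod (hϖ : Irreducible ϖ) [Finite (IsLocalRing.ResidueField A)] {t n : A}
    (h : ϖ ∣ t ^ 2 - 4 * n) : ∃ c : A, ϖ ∣ c ^ 2 - t * c + n := by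
  have hm : ∀ {y : A}, IsLocalRing.residue A y = 0 ↔ ϖ ∣ y := by
    intro y
    rw [IsLocalRing.residue_eq_zero_iff, hϖ.maximalIdeal_eq, Ideal.mem_span_singleton]
  by_cases h2 : ϖ ∣ 2
  -- Residue characteristic 2: the linear term vanishes modulo ϖ, and n has a square root because
  -- Frobenius is bijective on a finite field.
  · have ht : ϖ ∣ t := by
      refine hϖ.prime.dvd_of_dvd_pow (n := 2) ?_
      have := dvd_add h (h2.mul_right (2 * n))
      rwa [show t ^ 2 - 4 * n + 2 * (2 * n) = t ^ 2 by ring] at this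
    have h20 : (2 : IsLocalRing.ResidueField A) = 0 := by
      rw [← map_ofNat (IsLocalRing.residue A) 2]; exact hm.mpr h2
    have hinj : Function.Injective (fun y : IsLocalRing.ResidueField A => y ^ 2) := by
      intro y z hyz
      have : (y - z) ^ 2 = 0 := by
        linear_combination hyz + (z ^ 2 - y * z) * h20
      exact sub_eq_zero.mp (pow_eq_zero_iff two_ne_zero |>.mp this)
    obtain ⟨s, hs⟩ := Finite.surjective_of_injective hinj (IsLocalRing.residue A n)
    obtain ⟨c, rfl⟩ := IsLocalRing.residue_surjective s
    refine ⟨c, ?_⟩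
    rw [← hm] at ht ⊢
    simp only [map_add, map_sub, map_mul, map_pow, ht]
    simp only at hs
    rw [hs]
    linear_combination (IsLocalRing.residue A n) * h20
  · have hu : IsUnit (2 : A) := by
      by_contra hn
      rw [← mem_nonunits_iff, ← IsLocalRing.mem_maximalIdeal, hϖ.maximalIdeal_eq,
        Ideal.mem_span_singleton] at hn
      exact h2 hn
    obtain ⟨u, hu⟩ := hu.exists_right_inv
    -- Here u = 1/2, and t/2 is the double root.
    refine ⟨t * u, ?_⟩
    have : (t * u) ^ 2 - t * (t * u) + n = - u ^ 2 * (t ^ 2 - 4 * n) := by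
      linear_combination (-t ^ 2 * u + n * (1 + 2 * u)) * (-1 : A) * hu
    rw [this]
    exact h.mul_left _

/-- A maximal order over a discrete valuation ring with finite residue field contains an element
whose discriminant is a unit. -/
theorem exists_unit_disc [Finite (IsLocalRing.ResidueField A)] (hO : IsMaximalOrder O) :
    ∃ y ∈ O, ∃ t n : A, algebraMap A K t = trd y ∧ algebraMap A K n = nrd y ∧
      IsUnit (t ^ 2 - 4 * n) := by
  obtain ⟨ϖ, hϖ⟩ := IsDiscreteValuationRing.exists_irreducible A
  by_contra! hcon
  obtain ⟨hO, hmax⟩ := hO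
  have hD : DiscDvd ϖ O := by
    intro y hy t n ht hn
    have h := hcon y hy t n ht hn
    rwa [← mem_nonunits_iff, ← IsLocalRing.mem_maximalIdeal, hϖ.maximalIdeal_eq,
      Ideal.mem_span_singleton] at h
  set J := uniformizerMul ϖ O with hJ
  -- O = A + P: the norm of o - c is the value at c of the characteristic polynomial of o, which has
  -- a root modulo ϖ as its discriminant vanishes there.
  have hdec : ∀ o ∈ O, ∃ c : A, NrdDvd ϖ O (o - c • 1) := by
    intro o ho
    obtain ⟨t, ht⟩ := trd_mem_range hO.1 ho
    obtain ⟨n, hn⟩ := nrd_mem_range hO.1 ho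
    obtain ⟨c, d, hd⟩ := exists_root_mod hϖ (hD o ho t n ht hn)
    refine ⟨c, sub_mem ho (O.smul_mem (one_mem _) c), d, ?_⟩
    rw [← hd, sub_eq_add_neg o, nrd_add, ← algebraMap_smul K c, ← neg_smul, nrd_smul, star_smul',
      mul_smul_comm, trd_smul, star_one, mul_one, map_one, ← ht, ← hn]
    simp only [map_add, map_sub, map_mul, map_pow]; ring
  -- If PP ⊆ ϖO, any m in P outside ϖO works, and one exists since otherwise O is generated by 1
  -- modulo ϖ. If PP is not contained in ϖO, a product of two elements works by
  -- `NrdDvd.triple_product`.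
  obtain ⟨m, hm, hmP⟩ : ∃ m, (NrdDvd ϖ O m ∧ m ∉ J) ∧ ∀ p, NrdDvd ϖ O p → m * p ∈ J := by
    by_cases h : ∀ x y, NrdDvd ϖ O x → NrdDvd ϖ O y → x * y ∈ J
    · by_contra! hn
      refine not_generated_by_two hϖ hO 0 fun o ho => ?_
      obtain ⟨c, hc⟩ := hdec o ho
      refine ⟨c, 0, ?_⟩
      rw [smul_zero, sub_zero]
      by_contra hJ'
      obtain ⟨p, hp, hp'⟩ := hn _ ⟨hc, hJ'⟩
      exact hp' (h _ _ hc hp)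
    · push Not at h
      obtain ⟨x, y, hx, hy, hxy⟩ := h
      exact ⟨x * y, ⟨hx.mul_right hO hy.1, hxy⟩, fun p hp => hx.triple_product hϖ hO hD hy hp⟩
  obtain ⟨hmN, hmJ⟩ := hm
  have hPm : ∀ p, NrdDvd ϖ O p → p * m ∈ J := by
    intro p hp
    have := sub_mem (hp.anticomm hϖ hO hD hmN) (hmP p hp)
    rwa [add_sub_cancel_right] at this
  have hϖK : algebraMap A K ϖ ≠ 0 :=
    (map_ne_zero_iff _ (IsFractionRing.injective A K)).mpr hϖ.ne_zero
  obtain ⟨t, ht⟩ := hmN.trd hϖ hO hD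
  obtain ⟨hmO, n, hn⟩ := id hmN
  -- Now nrd m = ϖ n. If ϖ ∣ n, then x = m/ϖ is integral, and xP and Px lie in O, so O + Ax is an
  -- order. It is strictly larger than O because m ∉ ϖO, which contradicts maximality.
  by_cases hnϖ : ϖ ∣ n
  · obtain ⟨n', rfl⟩ := hnϖ
    set x : ℍ[K, a, b] := (algebraMap A K ϖ)⁻¹ • m with hx
    have hϖx : ϖ • x = m := by
      rw [hx, ← algebraMap_smul K ϖ, smul_smul, mul_inv_cancel₀ hϖK, one_smul]
    have hdiv : ∀ y ∈ J, (algebraMap A K ϖ)⁻¹ • y ∈ O := by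
      rintro _ ⟨o, ho, rfl⟩
      rwa [LinearMap.lsmul_apply, ← algebraMap_smul K ϖ o, smul_smul, inv_mul_cancel₀ hϖK,
        one_smul]
    have hxo : ∀ o ∈ O, ∃ o' ∈ O, ∃ c : A, x * o = o' + c • x := by
      intro o ho
      obtain ⟨c, hc⟩ := hdec o ho
      refine ⟨x * (o - c • 1), ?_, c, ?_⟩
      · rw [hx, smul_mul_assoc]; exact hdiv _ (hmP _ hc)
      · rw [mul_sub, mul_smul_comm, mul_one]; abel
    have hox : ∀ o ∈ O, ∃ o' ∈ O, ∃ c : A, o * x = o' + c • x := by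
      intro o ho
      obtain ⟨c, hc⟩ := hdec o ho
      refine ⟨(o - c • 1) * x, ?_, c, ?_⟩
      · rw [hx, mul_smul_comm]; exact hdiv _ (hPm _ hc)
      · rw [sub_mul, smul_mul_assoc, one_mul]; abel
    have hxx : x * x = -(n' • 1) + t • x := by
      rw [mul_self_eq, hx, trd_smul, nrd_smul, ← ht, ← hn, ← algebraMap_smul K n',
        ← algebraMap_smul K t]
      have e1 : (algebraMap A K ϖ)⁻¹ * algebraMap A K (ϖ * t) = algebraMap A K t := by
        rw [map_mul]; field_simp
      have e2 : (algebraMap A K ϖ)⁻¹ ^ 2 * algebraMap A K (ϖ * (ϖ * n')) = algebraMap A K n' := by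
        rw [map_mul, map_mul]; field_simp
      rw [e1, e2]; abel
    let O' : Subalgebra A ℍ[K, a, b] :=
      { carrier := {z | ∃ o ∈ O, ∃ c : A, z = o + c • x}
        mul_mem' := by
          rintro _ _ ⟨o, ho, c, rfl⟩ ⟨o', ho', c', rfl⟩
          obtain ⟨p, hp, d, hd⟩ := hxo o' ho'
          obtain ⟨q, hq, e, he⟩ := hox o ho
          refine ⟨o * o' + c' • q + c • p - (c * c' * n') • 1,
            sub_mem (add_mem (add_mem (mul_mem ho ho') (O.smul_mem hq _)) (O.smul_mem hp _))
              (O.smul_mem (one_mem _) _), c' * e + c * d + c * c' * t, ?_⟩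
          have : (o + c • x) * (o' + c' • x) = o * o' + c' • (o * x) + c • (x * o') +
              (c * c') • (x * x) := by
            simp only [add_mul, mul_add, smul_mul_assoc, mul_smul_comm]; module
          rw [this, hd, he, hxx]
          module
        add_mem' := by
          rintro _ _ ⟨o, ho, c, rfl⟩ ⟨o', ho', c', rfl⟩
          exact ⟨o + o', add_mem ho ho', c + c', by module⟩
        algebraMap_mem' := fun r => ⟨_, O.algebraMap_mem r, 0, by simp⟩ }
    have hle : O ≤ O' := fun o ho => ⟨o, ho, 0, by simp⟩
    have hO' : IsOrder O' := by
      refine ⟨?_, ?_⟩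
      · have : Subalgebra.toSubmodule O' = Subalgebra.toSubmodule O ⊔ Submodule.span A {x} := by
          ext z
          rw [Submodule.mem_sup]
          constructor
          · rintro ⟨o, ho, c, rfl⟩
            exact ⟨o, ho, c • x, Submodule.smul_mem _ _ (Submodule.mem_span_singleton_self x), rfl⟩
          · rintro ⟨o, ho, y, hy, rfl⟩
            obtain ⟨c, rfl⟩ := Submodule.mem_span_singleton.mp hy
            exact ⟨o, ho, c, rfl⟩
        rw [this]
        exact hO.1.sup (Submodule.fg_span_singleton x)
      · rw [eq_top_iff, ← hO.2]
        exact Submodule.span_mono hle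
    have hxO' : x ∈ O' := ⟨0, zero_mem _, 1, by simp⟩
    rw [hmax O' hO' hle] at hxO'
    exact hmJ ⟨x, hxO', hϖx⟩
  · have hu : IsUnit n := by
      by_contra h
      rw [← mem_nonunits_iff, ← IsLocalRing.mem_maximalIdeal, hϖ.maximalIdeal_eq,
        Ideal.mem_span_singleton] at h
      exact hnϖ h
    obtain ⟨u, rfl⟩ := hu
    -- For n a unit: star m annihilates P modulo ϖ, so multiplying star m * (o - c) = ϖ q by m and
    -- cancelling ϖ shows that o - c is a unit times m q. Since q is a scalar modulo P and mP ⊆ ϖO,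
    -- the elements 1 and m generate O modulo ϖ.
    refine not_generated_by_two hϖ hO m fun o ho => ?_
    obtain ⟨c, hc⟩ := hdec o ho
    have h1 : star m * (o - c • 1) ∈ J := by
      rw [star_eq, ← ht, sub_mul, algebraMap_smul, smul_mul_assoc, one_mul, mul_smul]
      exact sub_mem ⟨_, O.smul_mem hc.1 t, rfl⟩ (hmP _ hc)
    obtain ⟨q, hq, hq'⟩ := h1
    have h2 : o - c • 1 = (↑u⁻¹ : A) • (m * q) := by
      have h3 : m * (ϖ • q) = ϖ • (u : A) • (o - c • 1) := by
        rw [LinearMap.lsmul_apply] at hq'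
        rw [hq', ← mul_assoc, mul_star_eq, ← hn, algebraMap_smul, smul_mul_assoc, one_mul, mul_smul]
      rw [mul_smul_comm] at h3
      have h4 : m * q = (u : A) • (o - c • 1) := by
        have := congrArg ((algebraMap A K ϖ)⁻¹ • ·) h3
        simpa only [← algebraMap_smul K ϖ, smul_smul, inv_mul_cancel₀ hϖK, one_smul] using this
      rw [h4, smul_smul, Units.inv_mul, one_smul]
    obtain ⟨d, hd⟩ := hdec q hq
    refine ⟨c, ↑u⁻¹ * d, ?_⟩
    rw [h2, mul_smul, ← smul_sub]
    refine J.smul_mem _ ?_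
    have : m * q - d • m = m * (q - d • 1) := by rw [mul_sub, mul_smul_comm, mul_one]
    rw [this]
    exact hmP _ hd

end LocalOrder

/-! ### Norms from maximal local orders: units and uniformizers. -/

section LocalNorm

/-- Hensel's lemma for quadratic polynomials with a simple root at `0`. -/
theorem exists_root_of_henselian {A : Type*} [CommRing A] [HenselianLocalRing A] {α β γ : A}
    (hβ : IsUnit β) (hγ : γ ∈ IsLocalRing.maximalIdeal A) : ∃ z, α * z ^ 2 + β * z + γ = 0 := by
  -- The given polynomial need not be monic. With Y the root near -β of the monic polynomial Y² + βY
  -- + αγ, which is a unit, z = γ/Y is the desired root.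
  open Polynomial in
  obtain ⟨y, hy, hy'⟩ := HenselianLocalRing.is_henselian (X ^ 2 + C β * X + C (α * γ))
    (by monicity!) (-β)
    (by simpa [sq] using Ideal.mul_mem_left _ α hγ) (by
      have : (derivative (X ^ 2 + C β * X + C (α * γ))).eval (-β) = -β := by
        simp; ring
      rw [this]; exact hβ.neg)
  have hyu : IsUnit y := by
    by_contra h
    rw [← mem_nonunits_iff, ← IsLocalRing.mem_maximalIdeal] at h
    have h1 := sub_mem hy' h
    rw [show y - -β - y = β by ring] at h1
    exact (IsLocalRing.mem_maximalIdeal _).mp h1 hβ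
  obtain ⟨u, rfl⟩ := hyu
  have h2 : (u : A) ^ 2 + β * u + α * γ = 0 := by simpa using hy
  refine ⟨γ * ↑u⁻¹, ?_⟩
  have h3 : (u : A) * ↑u⁻¹ = 1 := u.mul_inv
  linear_combination (γ * (↑u⁻¹) ^ 2) * h2 - (γ + γ * ↑u⁻¹ * u + γ * ↑u⁻¹ * β) * h3

variable {A K : Type*} [CommRing A] [IsDomain A] [IsDiscreteValuationRing A] [Field K]
  [Algebra A K] [IsFractionRing A K] {a b : K}

/-- A binary quadratic norm form of unit discriminant represents all units. -/
theorem exists_binary_form_eq [HenselianLocalRing A] [Finite (IsLocalRing.ResidueField A)]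
    {t n : A} (hD : IsUnit (t ^ 2 - 4 * n)) (u : Aˣ) :
    ∃ s r : A, s ^ 2 + s * r * t + r ^ 2 * n = u := by
  have hm : ∀ {y : A}, IsLocalRing.residue A y = 0 ↔ y ∈ IsLocalRing.maximalIdeal A :=
    fun {y} => IsLocalRing.residue_eq_zero_iff y
  have hun : ∀ {y : A}, IsUnit y ↔ IsLocalRing.residue A y ≠ 0 := by
    intro y
    rw [ne_eq, hm, IsLocalRing.mem_maximalIdeal, mem_nonunits_iff, not_not]
  -- A solution modulo the maximal ideal lifts along r, and in `lift2` along s, when the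
  -- corresponding partial derivative is a unit.
  have lift1 : ∀ s r : A, s ^ 2 + s * r * t + r ^ 2 * n - u ∈ IsLocalRing.maximalIdeal A →
      IsUnit (s * t + 2 * r * n) → ∃ s r : A, s ^ 2 + s * r * t + r ^ 2 * n = u := by
    intro s r h h'
    obtain ⟨z, hz⟩ := exists_root_of_henselian (α := n) h' h
    exact ⟨s, r + z, by linear_combination hz⟩
  have lift2 : ∀ s r : A, s ^ 2 + s * r * t + r ^ 2 * n - u ∈ IsLocalRing.maximalIdeal A →
      IsUnit (2 * s + r * t) → ∃ s r : A, s ^ 2 + s * r * t + r ^ 2 * n = u := by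
    intro s r h h'
    obtain ⟨z, hz⟩ := exists_root_of_henselian (α := 1) h' h
    exact ⟨s + z, r, by linear_combination hz⟩
  rw [hun] at hD
  have hu := hun.mp u.isUnit
  by_cases h2 : (2 : IsLocalRing.ResidueField A) = 0
  · have hinj : Function.Injective (fun y : IsLocalRing.ResidueField A => y ^ 2) := by
      intro y z hyz
      have : (y - z) ^ 2 = 0 := by
        linear_combination hyz + (z ^ 2 - y * z) * h2
      exact sub_eq_zero.mp (pow_eq_zero_iff two_ne_zero |>.mp this)
    obtain ⟨s', hs⟩ := Finite.surjective_of_injective hinj (IsLocalRing.residue A u)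
    obtain ⟨s, rfl⟩ := IsLocalRing.residue_surjective s'
    simp only at hs
    -- In residue characteristic 2 take r = 0 and s² = u. The derivative in r is st, and t is a unit
    -- because the discriminant reduces to t².
    refine lift1 s 0 ?_ ?_
    · rw [← hm]; simp [hs]
    · rw [hun]
      simp only [map_sub, map_mul, map_pow, map_ofNat, mul_zero, zero_mul,
        add_zero] at hD ⊢
      refine mul_ne_zero ?_ ?_
      · intro h; rw [h] at hs; exact hu (by simpa using hs.symm)
      · intro h
        refine hD ?_
        rw [h]
        linear_combination (-2 * IsLocalRing.residue A n) * h2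
  · have := Fintype.ofFinite (IsLocalRing.ResidueField A)
    -- Completing the square, four times the form is p² - D q² with p = 2s + rt, q = r and D = t² -
    -- 4n. Over the finite residue field p² - D q² = 4u is solvable.
    open Polynomial in
    obtain ⟨p, q, hpq⟩ := FiniteField.exists_root_sum_quadratic
      (R := IsLocalRing.ResidueField A) (f := X ^ 2)
      (g := C (-(IsLocalRing.residue A (t ^ 2 - 4 * n))) * X ^ 2 + C 0 * X +
        C (-4 * IsLocalRing.residue A u)) (degree_X_pow 2)
      (degree_quadratic (neg_ne_zero.mpr hD)) (by
        by_contra h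
        have h := FiniteField.even_card_iff_char_two.mpr (Nat.mod_two_ne_one.mp h)
        refine h2 ?_
        have := ringChar.spec (IsLocalRing.ResidueField A) 2
        rw [h] at this
        simpa using this.mpr dvd_rfl)
    obtain ⟨r, rfl⟩ := IsLocalRing.residue_surjective q
    obtain ⟨s, hs⟩ := IsLocalRing.residue_surjective ((p - IsLocalRing.residue A (r * t)) / 2)
    have hp : p = 2 * IsLocalRing.residue A s + IsLocalRing.residue A (r * t) := by
      rw [hs]; field_simp; ring
    subst hp
    simp only [Polynomial.eval_add, Polynomial.eval_mul, Polynomial.eval_pow, Polynomial.eval_X,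
      Polynomial.eval_C, map_sub, map_mul, map_pow, map_ofNat] at hpq
    have h4 : (4 : IsLocalRing.ResidueField A) ≠ 0 := by
      rw [show (4 : IsLocalRing.ResidueField A) = 2 * 2 by norm_num]
      exact mul_ne_zero h2 h2
    have hf : IsLocalRing.residue A (s ^ 2 + s * r * t + r ^ 2 * n - u) = 0 := by
      simp only [map_sub, map_mul, map_pow, map_add]
      refine mul_left_cancel₀ h4 ?_
      linear_combination hpq
    -- Both derivatives cannot vanish modulo the maximal ideal: by Euler's identity s ∂_s + r ∂_r is
    -- twice the form, that is 2u ≠ 0.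
    by_cases h5 : IsUnit (2 * s + r * t)
    · exact lift2 s r (hm.mp hf) h5
    · refine lift1 s r (hm.mp hf) ?_
      rw [hun] at h5 ⊢
      push Not at h5
      intro h6
      simp only [map_sub, map_mul, map_pow, map_add, map_ofNat] at h5 h6 hf
      refine hu (mul_left_cancel₀ h2 ?_)
      linear_combination IsLocalRing.residue A s * h5 + IsLocalRing.residue A r * h6 - 2 * hf

theorem nrd_pair {y : ℍ[K, a, b]} {t n : A} (ht : algebraMap A K t = trd y)
    (hn : algebraMap A K n = nrd y) (s r : A) :
    nrd (s • (1 : ℍ[K, a, b]) + r • y) = algebraMap A K (s ^ 2 + s * r * t + r ^ 2 * n) := by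
  rw [← algebraMap_smul K s, ← algebraMap_smul K r, nrd_add, nrd_smul, nrd_smul, star_smul',
    smul_mul_assoc, one_mul, trd_smul, trd_smul, ← hn]
  have : trd (star y) = trd y := by simp [trd]
  rw [this, ← ht]
  simp only [map_add, map_mul, map_pow, map_one]; ring

variable {O : Subalgebra A ℍ[K, a, b]}

/-- The reduced norm of a maximal order is surjective on units. -/
theorem exists_mem_nrd_eq_unit [HenselianLocalRing A] [Finite (IsLocalRing.ResidueField A)]
    (hO : IsMaximalOrder O) (u : Aˣ) : ∃ x ∈ O, nrd x = algebraMap A K u := by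
  obtain ⟨y, hy, t, n, ht, hn, hD⟩ := exists_unit_disc hO
  obtain ⟨s, r, h⟩ := exists_binary_form_eq hD u
  refine ⟨s • 1 + r • y, add_mem (O.smul_mem (one_mem _) s) (O.smul_mem hy r), ?_⟩
  rw [nrd_pair ht hn, h]

theorem eq_unit_mul_sq_or {ϖ : A} (hϖ : Irreducible ϖ) {x : K} (hx : x ≠ 0) :
    ∃ (r : K) (u : Aˣ), r ≠ 0 ∧
      (x = r ^ 2 * algebraMap A K u ∨ x = r ^ 2 * algebraMap A K (u * ϖ)) := by
  obtain ⟨n, u, h⟩ := IsDiscreteValuationRing.exists_units_eq_smul_zpow_of_irreducible hϖ hx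
  have h0 : algebraMap A K ϖ ≠ 0 :=
    (map_ne_zero_iff _ (IsFractionRing.injective A K)).mpr hϖ.ne_zero
  have h1 : x = algebraMap A K u * algebraMap A K ϖ ^ n := by
    rw [h, Units.smul_def, Algebra.smul_def]
  obtain ⟨m, rfl | rfl⟩ := Int.even_or_odd' n
  · refine ⟨algebraMap A K ϖ ^ m, u, zpow_ne_zero _ h0, Or.inl ?_⟩
    rw [h1, mul_comm 2 m, zpow_mul, zpow_ofNat]; ring
  · refine ⟨algebraMap A K ϖ ^ m, u, zpow_ne_zero _ h0, Or.inr ?_⟩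
    rw [h1, zpow_add₀ h0, mul_comm 2 m, zpow_mul, map_mul]
    rw [zpow_ofNat, zpow_one]; ring

/-- There is a pure quaternion whose norm is a uniformizer. -/
theorem exists_pure_uniformizer [HenselianLocalRing A] [Finite (IsLocalRing.ResidueField A)]
    (h2 : (2 : K) ≠ 0) (ha : a ≠ 0) (hb : b ≠ 0) (hO : IsMaximalOrder O) {ϖ : A}
    (hϖ : Irreducible ϖ) :
    ∃ (p : ℍ[K, a, b]) (u : Aˣ), trd p = 0 ∧ nrd p = algebraMap A K (u * ϖ) := by
  have h0 : algebraMap A K ϖ ≠ 0 :=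
    (map_ne_zero_iff _ (IsFractionRing.injective A K)).mpr hϖ.ne_zero
  have hu0 : ∀ u : Aˣ, algebraMap A K u ≠ 0 := fun u =>
    (map_ne_zero_iff _ (IsFractionRing.injective A K)).mpr u.ne_zero
  obtain ⟨y, hy, t, n, ht, hn, hD⟩ := exists_unit_disc hO
  -- First find any x whose norm has odd valuation. An isotropic norm form is universal, so only the
  -- anisotropic case needs an argument.
  obtain ⟨x, r, u, hr, hx⟩ : ∃ (x : ℍ[K, a, b]) (r : K) (u : Aˣ), r ≠ 0 ∧
      nrd x = r ^ 2 * algebraMap A K (u * ϖ) := by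
    suffices hiso : (∀ z : ℍ[K, a, b], nrd z = 0 → z = 0) →
        ∃ (x : ℍ[K, a, b]) (r : K) (u : Aˣ), r ≠ 0 ∧
          nrd x = r ^ 2 * algebraMap A K (u * ϖ) by
      by_cases h : ∀ z : ℍ[K, a, b], nrd z = 0 → z = 0
      · exact hiso h
      · push Not at h
        obtain ⟨z, hz, hz0⟩ := h
        obtain ⟨x, hx⟩ := exists_nrd_eq_of_isotropic h2 ha hb hz0 hz (algebraMap A K ϖ)
        exact ⟨x, 1, 1, one_ne_zero, by simp [hx]⟩
    intro hiso
    -- Take j ≠ 0 orthogonal to 1 and y; two linear conditions in dimension 4 leave room. If nrd j =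
    -- r²u with u a unit, some w in A + Ay has norm -u and is orthogonal to j. Then j/r + w is
    -- isotropic, hence zero, so w is orthogonal to itself and 2 nrd w = 0, a contradiction.
    let L : ℍ[K, a, b] →ₗ[K] (Fin 2 → K) := LinearMap.pi
      ![{ toFun := fun z => trd z, map_add' := trd_add, map_smul' := trd_smul },
        { toFun := fun z => trd (z * star y)
          map_add' := fun z w => by rw [add_mul, trd_add]
          map_smul' := fun c z => by rw [smul_mul_assoc, trd_smul]; rfl }]
    obtain ⟨j, hj, hj0⟩ := Submodule.exists_mem_ne_zero_of_ne_bot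
      (LinearMap.ker_ne_bot_of_finrank_lt (f := L) (by
        rw [QuaternionAlgebra.finrank_eq_four]; simp))
    have hj1 : trd j = 0 := congrFun (LinearMap.mem_ker.mp hj) 0
    have hjy : trd (j * star y) = 0 := congrFun (LinearMap.mem_ker.mp hj) 1
    have hnj : nrd j ≠ 0 := fun h => hj0 (hiso j h)
    obtain ⟨r, u, hr, h | h⟩ := eq_unit_mul_sq_or hϖ hnj
    · obtain ⟨s, q, hsq⟩ := exists_binary_form_eq hD (-u)
      set w := s • (1 : ℍ[K, a, b]) + q • y with hw
      have hnw : nrd w = - algebraMap A K u := by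
        rw [hw, nrd_pair ht hn, hsq]; simp
      have horth : trd (j * star w) = 0 := by
        rw [hw, ← algebraMap_smul K s, ← algebraMap_smul K q, star_add, star_smul', star_smul',
          mul_add, mul_smul_comm, mul_smul_comm, trd_add, trd_smul, trd_smul, star_one, mul_one,
          hj1, hjy]
        simp
      have hz : nrd (r⁻¹ • j + w) = 0 := by
        rw [nrd_add, nrd_smul, smul_mul_assoc, trd_smul, horth, hnw, h]
        field_simp; ring
      have hz' := hiso _ hz
      have hw2 : trd (w * star w) = 0 := by
        have h3 : w = -(r⁻¹ • j) := by rw [eq_neg_iff_add_eq_zero, add_comm]; exact hz'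
        have h4 : trd (w * star w) = - (r⁻¹ * trd (j * star w)) := by
          have h5 : trd (w * star w) = trd (((-1 : K) • (r⁻¹ • j)) * star w) := by
            rw [neg_one_smul, ← h3]
          rw [h5, smul_mul_assoc, smul_mul_assoc, trd_smul, trd_smul, neg_one_mul]
        rw [h4, horth]; simp
      rw [mul_star_eq, trd_smul, trd_one, hnw] at hw2
      exact absurd hw2 (mul_ne_zero (neg_ne_zero.mpr (hu0 u)) h2)
    · exact ⟨j, r, u, hr, h⟩
  have scale : ∀ (p : ℍ[K, a, b]) (r : K) (u : Aˣ), r ≠ 0 → trd p = 0 →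
      nrd p = r ^ 2 * algebraMap A K (u * ϖ) →
      ∃ (p : ℍ[K, a, b]) (u : Aˣ), trd p = 0 ∧ nrd p = algebraMap A K (u * ϖ) := by
    intro p r u hr hp h
    refine ⟨r⁻¹ • p, u, by rw [trd_smul, hp, mul_zero], ?_⟩
    rw [nrd_smul, h, ← mul_assoc, ← mul_pow, inv_mul_cancel₀ hr, one_pow, one_mul]
  -- Replacing x by a pure element: x is not a scalar, since the norm of a scalar is a square. If
  -- nrd p has even valuation, star p * x is pure by orthogonality and its norm has odd valuation;
  -- otherwise p itself serves.
  obtain ⟨p, hp, hp0, hpx⟩ := exists_pure_orthogonal h2 ha hb x (by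
    rintro c rfl
    rw [nrd_smul, map_one, mul_one] at hx
    have h3 : (c * r⁻¹) ^ 2 = algebraMap A K (u * ϖ) := by
      rw [mul_pow, hx]; field_simp
    have h4 : IsIntegral A (c * r⁻¹) := by
      refine IsIntegral.of_pow two_pos ?_
      rw [h3]; exact isIntegral_algebraMap
    obtain ⟨e, he⟩ := IsIntegrallyClosed.isIntegral_iff.mp h4
    rw [← he, ← map_pow] at h3
    have h5 : e ^ 2 = u * ϖ := IsFractionRing.injective A K h3
    obtain ⟨f, rfl⟩ := hϖ.prime.dvd_of_dvd_pow (Dvd.intro_left _ h5.symm)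
    have h6 : ϖ * (ϖ * f ^ 2 * ↑u⁻¹) = ϖ * 1 := by
      have h7 : (u : A) * ↑u⁻¹ = 1 := u.mul_inv
      linear_combination (↑u⁻¹ : A) * h5 + ϖ * h7
    exact hϖ.not_isUnit (IsUnit.of_mul_eq_one (f ^ 2 * ↑u⁻¹)
      (by rw [← mul_assoc]; exact mul_left_cancel₀ hϖ.ne_zero h6)))
  obtain ⟨r', u', hr', h | h⟩ := eq_unit_mul_sq_or hϖ hp0
  · refine scale (star p * x) (r' * r) (u' * u) (mul_ne_zero hr' hr) hpx ?_
    rw [map_mul, nrd_star, h, hx]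
    rw [Units.val_mul]
    simp only [map_mul]; ring
  · exact scale p r' u' hr' hp h

end LocalNorm

/-! ### The completions of R: density, Hensel's lemma and finite quotients. -/

section Completion

open WithZero

variable {F : Type*} [Field F] [NumberField F] (v : HeightOneSpectrum (𝓞 F))

instance charZero_adicCompletion : CharZero (v.adicCompletion F) :=
  charZero_of_injective_algebraMap (algebraMap F (v.adicCompletion F)).injective

theorem valued_algebraMap (x : F) :
    Valued.v (algebraMap F (v.adicCompletion F) x) = v.valuation F x :=
  HeightOneSpectrum.valuedAdicCompletion_eq_valuation' v x

/-- Inequality of valuations of integers of `F` in terms of powers of the prime. -/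
theorem valuation_le_exp_iff (r : 𝓞 F) (n : ℕ) :
    v.valuation F (algebraMap (𝓞 F) F r) ≤ exp (-(n : ℤ)) ↔ r ∈ v.asIdeal ^ n := by
  rw [HeightOneSpectrum.valuation_of_algebraMap, HeightOneSpectrum.intValuation_le_pow_iff_mem]

theorem mem_range_iff_valued_le_one {x : v.adicCompletion F} :
    x ∈ (algebraMap (v.adicCompletionIntegers F) (v.adicCompletion F)).range ↔
      Valued.v x ≤ 1 := by
  rw [← HeightOneSpectrum.mem_adicCompletionIntegers]
  constructor
  · rintro ⟨y, rfl⟩; exact y.2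
  · intro h; exact ⟨⟨x, h⟩, rfl⟩

theorem exists_valuation_eq_exp (n : ℤ) : ∃ x : F, x ≠ 0 ∧ v.valuation F x = exp n := by
  obtain ⟨p, hp⟩ := v.valuation_exists_uniformizer F
  have hp0 : p ≠ 0 := by rintro rfl; simp [exp_ne_zero.symm] at hp
  refine ⟨p ^ (-n), zpow_ne_zero _ hp0, ?_⟩
  rw [map_zpow₀, hp, ← exp_zsmul]; simp

theorem valued_eq_exp_log {x : v.adicCompletion F} (hx : x ≠ 0) :
    ∃ n : ℤ, Valued.v x = exp n :=
  ⟨log (Valued.v x), (exp_log ((Valuation.ne_zero_iff _).mpr hx)).symm⟩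

theorem ball_mem_nhds (x : v.adicCompletion F) (n : ℤ) :
    {y : v.adicCompletion F | Valued.v (y - x) ≤ exp n} ∈ nhds x := by
  obtain ⟨p, hp0, hp⟩ := exists_valuation_eq_exp v n
  have hp' : (Valued.v (algebraMap F (v.adicCompletion F) p)) = exp n := by
    rw [valued_algebraMap, hp]
  have h0 : (Valued.v : Valuation (v.adicCompletion F) ℤᵐ⁰).restrict
      (algebraMap F (v.adicCompletion F) p) ≠ 0 := by
    rw [ne_eq, map_eq_zero, map_eq_zero]; exact hp0
  rw [Valued.mem_nhds]
  refine ⟨Units.mk0 _ h0, fun y hy => ?_⟩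
  simp only [Set.mem_ofPred_eq, Units.val_mk0, Valuation.restrict_lt_iff] at hy
  exact hy.le.trans_eq hp'

theorem isClosed_ball (x : v.adicCompletion F) (n : ℤ) :
    IsClosed {y : v.adicCompletion F | Valued.v (y - x) ≤ exp n} := by
  obtain ⟨p, hp0, hp⟩ := exists_valuation_eq_exp v n
  have h := (Valued.isClosed_closedBall (v.adicCompletion F)
    (Valued.v.restrict (algebraMap F (v.adicCompletion F) p))).preimage
    (continuous_sub_right x)
  convert h using 1
  ext y
  simp only [Set.mem_ofPred_eq, Set.mem_preimage, Valuation.restrict_le_iff, valued_algebraMap, hp]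

theorem exists_approx (x : v.adicCompletion F) (n : ℤ) :
    ∃ y : F, Valued.v (algebraMap F (v.adicCompletion F) y - x) ≤ exp n := by
  obtain ⟨_, hy, y, rfl⟩ := mem_closure_iff_nhds.mp
    (HeightOneSpectrum.denseRange_algebraMap F v x) _ (ball_mem_nhds v x n)
  exact ⟨y, hy⟩

theorem exists_int_approx {x : v.adicCompletion F} (hx : Valued.v x ≤ 1) (n : ℤ) :
    ∃ r : 𝓞 F, Valued.v (algebraMap F (v.adicCompletion F) r - x) ≤ exp n := by
  obtain ⟨y, hy⟩ := exists_approx v x (min n 0)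
  have hy1 : v.valuation F y ≤ 1 := by
    rw [← valued_algebraMap, ← sub_add_cancel (algebraMap F (v.adicCompletion F) y) x]
    refine (Valuation.map_add _ _ _).trans (max_le (hy.trans ?_) hx)
    rw [← exp_zero, exp_le_exp]; exact min_le_right _ _
  obtain ⟨r, hr⟩ := v.exists_valuation_sub_lt_of_integer hy1 (Units.mk0 (exp n) exp_ne_zero)
  refine ⟨r, ?_⟩
  rw [← sub_add_sub_cancel _ (algebraMap F (v.adicCompletion F) y)]
  refine (Valuation.map_add _ _ _).trans (max_le ?_ (hy.trans ?_))
  · rw [← map_sub, valued_algebraMap]; exact hr.le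
  · rw [exp_le_exp]; exact min_le_left _ _

theorem exists_uniformizer_integers : ∃ ϖ : v.adicCompletionIntegers F,
    Irreducible ϖ ∧ Valued.v (ϖ : v.adicCompletion F) = exp (-1 : ℤ) := by
  obtain ⟨p, hp0, hp⟩ := exists_valuation_eq_exp v (-1)
  have hv : Valued.v (algebraMap F (v.adicCompletion F) p) = exp (-1 : ℤ) := by
    rw [valued_algebraMap, hp]
  refine ⟨⟨algebraMap F (v.adicCompletion F) p, ?_⟩, ?_, hv⟩
  · rw [HeightOneSpectrum.mem_adicCompletionIntegers, hv, ← exp_zero, exp_le_exp]; simp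
  · rw [irreducible_iff]
    constructor
    · rw [HeightOneSpectrum.adicCompletionIntegers.isUnit_iff_valued_eq_one, hv, ← exp_zero,
        exp_inj]
      simp
    · rintro ⟨x, hx⟩ ⟨y, hy⟩ h
      have hxy : algebraMap F (v.adicCompletion F) p = x * y := congrArg Subtype.val h
      have h0 : algebraMap F (v.adicCompletion F) p ≠ 0 := by simpa using hp0
      rw [hxy] at h0 hv
      obtain ⟨n, hn⟩ := valued_eq_exp_log v (left_ne_zero_of_mul h0)
      obtain ⟨m, hm⟩ := valued_eq_exp_log v (right_ne_zero_of_mul h0)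
      rw [map_mul, hn, hm, ← exp_add, exp_inj] at hv
      rw [HeightOneSpectrum.mem_adicCompletionIntegers, hn, ← exp_zero, exp_le_exp] at hx
      rw [HeightOneSpectrum.mem_adicCompletionIntegers, hm, ← exp_zero, exp_le_exp] at hy
      rw [HeightOneSpectrum.adicCompletionIntegers.isUnit_iff_valued_eq_one,
        HeightOneSpectrum.adicCompletionIntegers.isUnit_iff_valued_eq_one]
      simp only [hn, hm]
      rw [← exp_zero, exp_inj, exp_inj]
      omega

theorem dvd_iff_valued_le {x y : v.adicCompletionIntegers F} :
    x ∣ y ↔ Valued.v (y : v.adicCompletion F) ≤ Valued.v (x : v.adicCompletion F) :=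
  ⟨fun h => (HeightOneSpectrum.adicCompletionIntegers.integers F v).le_of_dvd h,
    fun h => (HeightOneSpectrum.adicCompletionIntegers.integers F v).dvd_of_le h⟩

theorem mem_maximalIdeal_pow_iff (n : ℕ) (x : v.adicCompletionIntegers F) :
    x ∈ IsLocalRing.maximalIdeal (v.adicCompletionIntegers F) ^ n ↔
      Valued.v (x : v.adicCompletion F) ≤ exp (-(n : ℤ)) := by
  obtain ⟨ϖ, hϖ, hv⟩ := exists_uniformizer_integers v
  rw [hϖ.maximalIdeal_eq, Ideal.span_singleton_pow, Ideal.mem_span_singleton, dvd_iff_valued_le]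
  have : Valued.v ((ϖ ^ n : v.adicCompletionIntegers F) : v.adicCompletion F) =
      exp (-(n : ℤ)) := by
    push_cast
    rw [map_pow, hv, ← exp_nsmul]; simp
  rw [this]

/-- A sequence compatible modulo powers of the maximal ideal is Cauchy in the complete field F_v,
and closed balls control the congruences of its limit. The purpose is Hensel's lemma in
`henselian_integers`. -/
instance isAdicComplete_integers :
    IsAdicComplete (IsLocalRing.maximalIdeal (v.adicCompletionIntegers F))
      (v.adicCompletionIntegers F) where
  haus' := by
    intro x hx
    by_contra h0
    have h0' : (x : v.adicCompletion F) ≠ 0 := by simpa using h0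
    obtain ⟨n, hn⟩ := valued_eq_exp_log v h0'
    have h1 := hx (n.natAbs + 1)
    rw [SModEq.zero, smul_eq_mul, Ideal.mul_top, mem_maximalIdeal_pow_iff, hn, exp_le_exp] at h1
    omega
  prec' := by
    intro f hf
    have hf' : ∀ {m n : ℕ}, m ≤ n →
        Valued.v ((f n : v.adicCompletion F) - f m) ≤ exp (-(m : ℤ)) := by
      intro m n h
      have h1 := hf h
      rw [SModEq.sub_mem, smul_eq_mul, Ideal.mul_top, mem_maximalIdeal_pow_iff] at h1
      rw [Valuation.map_sub_swap]; exact h1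
    have hc : CauchySeq (fun n => (f n : v.adicCompletion F)) := by
      rw [CauchySeq, Valued.cauchy_iff]
      refine ⟨inferInstance, fun γ => ?_⟩
      obtain ⟨y, hy⟩ := MonoidWithZeroHom.ValueGroup₀.restrict₀_surjective
        (.ofClass (Valued.v : Valuation (v.adicCompletion F) ℤᵐ⁰)) γ
      rw [← Valuation.restrict_def] at hy
      have hy0 : y ≠ 0 := by rintro rfl; rw [map_zero] at hy; exact γ.ne_zero hy.symm
      obtain ⟨n, hn⟩ := valued_eq_exp_log v hy0
      refine ⟨(fun n => (f n : v.adicCompletion F)) '' Set.Ici (n.natAbs + 1),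
        Filter.image_mem_map (Filter.Ici_mem_atTop _), ?_⟩
      have hlt : exp (-((n.natAbs + 1 : ℕ) : ℤ)) < exp n := by
        rw [exp_lt_exp]; omega
      rintro _ ⟨k, hk, rfl⟩ _ ⟨l, hl, rfl⟩
      rw [← hy, Valuation.restrict_lt_iff, hn]
      refine lt_of_le_of_lt ?_ hlt
      rw [← sub_sub_sub_cancel_right _ _ (f (n.natAbs + 1) : v.adicCompletion F)]
      exact (Valuation.map_sub _ _ _).trans (max_le (hf' hl) (hf' hk))
    obtain ⟨L, hL⟩ := cauchySeq_tendsto_of_complete hc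
    have hLn : ∀ n : ℕ, Valued.v (L - f n) ≤ exp (-(n : ℤ)) := fun n =>
      (isClosed_ball v (f n : v.adicCompletion F) (-(n : ℤ))).mem_of_tendsto hL
        (Filter.eventually_atTop.mpr ⟨n, fun m hm => hf' hm⟩)
    have hL1 : Valued.v L ≤ 1 := by
      rw [← sub_add_cancel L (f 0 : v.adicCompletion F)]
      refine (Valuation.map_add _ _ _).trans (max_le ((hLn 0).trans (by simp)) ?_)
      exact (f 0).2
    refine ⟨⟨L, hL1⟩, fun n => ?_⟩
    rw [SModEq.sub_mem, smul_eq_mul, Ideal.mul_top, mem_maximalIdeal_pow_iff]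
    have := hLn n
    rw [Valuation.map_sub_swap] at this
    exact this

instance henselian_integers : HenselianLocalRing (v.adicCompletionIntegers F) where
  is_henselian f hf a₀ h₁ h₂ :=
    HenselianRing.is_henselian f hf a₀ h₁ (h₂.map _)

/-- By density of R in R_v, the finite ring R/𝔭^k surjects onto the quotient, k being the valuation
of r. -/
theorem finite_quotient_integers {r : v.adicCompletionIntegers F} (hr : r ≠ 0) :
    Finite (v.adicCompletionIntegers F ⧸ Ideal.span {r}) := by
  have hr' : (r : v.adicCompletion F) ≠ 0 := by simpa using hr
  obtain ⟨n, hn⟩ := valued_eq_exp_log v hr'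
  have hn0 : n ≤ 0 := by
    have := r.2
    rwa [HeightOneSpectrum.mem_adicCompletionIntegers, hn, ← exp_zero, exp_le_exp] at this
  obtain ⟨k, rfl⟩ := Int.exists_eq_neg_ofNat hn0
  have hI : v.asIdeal ^ k ≠ ⊥ := pow_ne_zero _ v.ne_bot
  have := Ideal.finiteQuotientOfFreeOfNeBot _ hI
  have key : ∀ s : 𝓞 F, Valued.v ((algebraMap (𝓞 F) (v.adicCompletionIntegers F) s :
      v.adicCompletionIntegers F) : v.adicCompletion F) = v.valuation F s := fun s =>
    valued_algebraMap v _
  let f : (𝓞 F ⧸ v.asIdeal ^ k) →+* (v.adicCompletionIntegers F ⧸ Ideal.span {r}) :=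
    Ideal.Quotient.lift _ ((Ideal.Quotient.mk _).comp
      (algebraMap (𝓞 F) (v.adicCompletionIntegers F))) (fun s hs => by
        rw [RingHom.comp_apply, Ideal.Quotient.eq_zero_iff_mem, Ideal.mem_span_singleton,
          dvd_iff_valued_le, hn, key]
        exact (valuation_le_exp_iff v s k).mpr hs)
  refine Finite.of_surjective f fun y => ?_
  obtain ⟨y, rfl⟩ := Ideal.Quotient.mk_surjective y
  obtain ⟨s, hs⟩ := exists_int_approx v y.2 (-(k : ℤ))
  refine ⟨Ideal.Quotient.mk _ s, ?_⟩
  rw [Ideal.Quotient.lift_mk, RingHom.comp_apply, Ideal.Quotient.eq, Ideal.mem_span_singleton,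
    dvd_iff_valued_le, hn]
  exact hs

instance finite_residueField_integers :
    Finite (IsLocalRing.ResidueField (v.adicCompletionIntegers F)) := by
  obtain ⟨ϖ, hϖ⟩ := IsDiscreteValuationRing.exists_irreducible (v.adicCompletionIntegers F)
  have := finite_quotient_integers v hϖ.ne_zero
  rw [← hϖ.maximalIdeal_eq] at this
  exact this

end Completion

/-! ### Weighted orbit counts under equivariant maps. -/

section OrbitMass

variable {Γ : Type*} [Group Γ] (Z : Subgroup Γ) [hZ : Z.Normal]

theorem relIndex_stabilizer_smul {X : Type*} [MulAction Γ X] (g : Γ) (x : X) :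
    Z.relIndex (MulAction.stabilizer Γ (g • x)) = Z.relIndex (MulAction.stabilizer Γ x) := by
  rw [MulAction.stabilizer_smul_eq_stabilizer_map_conj]
  have hmap : Z.map (MulAut.conj g).toMonoidHom = Z := by
    ext z
    rw [Subgroup.mem_map_equiv, MulAut.conj_symm_apply]
    refine ⟨fun h => ?_, fun h => by simpa using hZ.conj_mem z h g⁻¹⟩
    simpa [mul_assoc] using hZ.conj_mem _ h g
  conv_lhs => rw [← hmap]
  exact Subgroup.relIndex_map_map_of_injective _ _ (MulAut.conj g).injective

/-- The weight `1 / [Γ_x : Z]` of an orbit. -/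
def orbitWeight {X : Type*} [MulAction Γ X] : MulAction.orbitRel.Quotient Γ X → ℝ≥0∞ :=
  Quotient.lift (fun x => 1 / (Z.relIndex (MulAction.stabilizer Γ x) : ℝ≥0∞)) (by
    rintro _ x ⟨g, rfl⟩
    simp only [relIndex_stabilizer_smul])

/-- The sum of the weights of the orbits meeting `Ω`. -/
def orbitMass {X : Type*} [MulAction Γ X] (Ω : Set X) : ℝ≥0∞ :=
  ∑' o : MulAction.orbitRel.Quotient Γ X,
    Set.indicator {o | ∃ x ∈ Ω, Quotient.mk _ x = o} (orbitWeight Z) o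

variable {X Y : Type*} [MulAction Γ X] [MulAction Γ Y]

/-- Inside the fibre over p x, the orbit of x under Γ is the orbit of x under the stabilizer of p x;
then apply orbit–stabilizer. -/
theorem card_orbit_inter_fibre {p : X → Y} (hp : ∀ (g : Γ) x, p (g • x) = g • p x) (x : X) :
    Nat.card {e : p ⁻¹' {p x} // (Quotient.mk _ (e : X) : MulAction.orbitRel.Quotient Γ X) =
      Quotient.mk _ x} =
    (MulAction.stabilizer Γ x).relIndex (MulAction.stabilizer Γ (p x)) := by
  have h1 : (MulAction.stabilizer Γ x).relIndex (MulAction.stabilizer Γ (p x)) =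
      (MulAction.stabilizer (MulAction.stabilizer Γ (p x)) x).index := by
    rw [Subgroup.relIndex]; congr 1
  rw [h1, MulAction.index_stabilizer, ← Nat.card_coe_set_eq]
  refine Nat.card_congr
    { toFun := fun e => ⟨e.1.1, ?_⟩
      invFun := fun e => ⟨⟨e.1, ?_⟩, ?_⟩
      left_inv := fun e => rfl
      right_inv := fun e => rfl }
  · obtain ⟨g, hg⟩ := MulAction.orbitRel_apply.mp (Quotient.exact e.2)
    have hg' : g • x = e.1.1 := hg
    refine ⟨⟨g, ?_⟩, hg'⟩
    rw [MulAction.mem_stabilizer_iff, ← hp, hg']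
    exact e.1.2
  · obtain ⟨⟨g, hg⟩, hge⟩ := e.2
    have hg' : g • x = e.1 := hge
    rw [Set.mem_preimage, ← hg', hp]
    exact hg
  · obtain ⟨⟨g, hg⟩, hge⟩ := e.2
    exact Quotient.sound (MulAction.orbitRel_apply.mpr ⟨g, hge⟩)

/-- Masses are multiplied by the cardinality of the fibres of an equivariant map. -/
theorem orbitMass_preimage {p : X → Y} (hp : ∀ (g : Γ) x, p (g • x) = g • p x) {n : ℕ}
    (hn : n ≠ 0) (hcard : ∀ y, Nat.card (p ⁻¹' {y}) = n)
    (hfix : ∀ x, Z ≤ MulAction.stabilizer Γ (x : X)) {Ω : Set Y}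
    (hΩ : ∀ (g : Γ), ∀ y ∈ Ω, g • y ∈ Ω) :
    orbitMass Z (p ⁻¹' Ω) = n * orbitMass Z Ω := by
  let P : MulAction.orbitRel.Quotient Γ X → MulAction.orbitRel.Quotient Γ Y :=
    Quotient.map p (by rintro _ x ⟨g, rfl⟩; exact ⟨g, (hp g x).symm⟩)
  have hstab : ∀ x, MulAction.stabilizer Γ x ≤ MulAction.stabilizer Γ (p x) := by
    intro x g hg
    rw [MulAction.mem_stabilizer_iff] at hg ⊢
    rw [← hp, hg]
  have hfin : ∀ y, Finite (p ⁻¹' {y}) := fun y =>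
    Nat.finite_of_card_ne_zero (by rw [hcard]; exact hn)
  -- The n points over y are partitioned by the orbits above the orbit of y. The part of x has [Γ_y
  -- : Γ_x] points, and [Γ_y : Γ_x] / [Γ_y : Z] = 1 / [Γ_x : Z].
  have key : ∀ q : MulAction.orbitRel.Quotient Γ Y,
      ∑' o : {o // P o = q}, orbitWeight Z o.1 = n * orbitWeight Z q := by
    intro q
    induction q using Quotient.inductionOn with | _ y
    let π : p ⁻¹' {y} → {o // P o = Quotient.mk _ y} := fun e => ⟨Quotient.mk _ e.1, by
      have : p e.1 = y := e.2
      simp only [P, Quotient.map_mk, this]⟩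
    have h1 : (n : ℝ≥0∞) * orbitWeight Z (Quotient.mk _ y) =
        ∑' _ : p ⁻¹' {y}, orbitWeight Z (Quotient.mk _ y : MulAction.orbitRel.Quotient Γ Y) := by
      rw [ENNReal.tsum_const, ENat.card_eq_coe_natCard, hcard]; simp
    rw [h1, ← (Equiv.sigmaFiberEquiv π).tsum_eq]
    rw [ENNReal.tsum_sigma (fun o (_ : {e // π e = o}) => orbitWeight Z (Quotient.mk _ y))]
    refine tsum_congr ?_
    rintro ⟨o, ho⟩
    induction o using Quotient.inductionOn with | _ x
    have hx : ∃ g : Γ, g • y = p x := by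
      have := MulAction.orbitRel_apply.mp (Quotient.exact ho)
      exact this
    obtain ⟨g, hg⟩ := hx
    set x' := g⁻¹ • x with hx'
    have hpx' : p x' = y := by rw [hx', hp, ← hg, inv_smul_smul]
    have hxx : (Quotient.mk _ x : MulAction.orbitRel.Quotient Γ X) = Quotient.mk _ x' :=
      Quotient.sound (MulAction.orbitRel_apply.mpr ⟨g, smul_inv_smul g x⟩)
    subst hpx'
    rw [ENNReal.tsum_const]
    have hc : Nat.card {e // π e = ⟨Quotient.mk _ x, ho⟩} =
        (MulAction.stabilizer Γ x').relIndex (MulAction.stabilizer Γ (p x')) := by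
      rw [← card_orbit_inter_fibre hp x']
      refine Nat.card_congr (Equiv.subtypeEquivRight fun e => ?_)
      simp only [π, Subtype.mk.injEq, hxx]
    have := hfin (p x')
    rw [ENat.card_eq_coe_natCard, hc]
    change orbitWeight Z (Quotient.mk _ x) = _
    rw [hxx]
    -- This index is finite and nonzero, so it cancels. The identity persists when Z has infinite
    -- index in a stabilizer: its relative index is then 0, and both weights are ∞.
    have hk : (MulAction.stabilizer Γ x').relIndex (MulAction.stabilizer Γ (p x')) ≠ 0 := by
      rw [← hc]
      have : Nonempty {e // π e = ⟨Quotient.mk _ x, ho⟩} :=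
        ⟨⟨⟨x', rfl⟩, by simp only [π, hxx]⟩⟩
      exact Nat.card_pos.ne'
    have hmul := Subgroup.relIndex_mul_relIndex Z _ _ (hfix x') (hstab x')
    simp only [orbitWeight, Quotient.lift_mk]
    rw [← hmul]
    push_cast
    rw [mul_comm (Z.relIndex _ : ℝ≥0∞), one_div, one_div, ENNReal.mul_inv (by simp) (by simp),
      ← mul_assoc]
    have h0 : ((MulAction.stabilizer Γ x').relIndex (MulAction.stabilizer Γ (p x')) : ℝ≥0∞) ≠ 0 := by
      exact_mod_cast hk
    rw [ENNReal.mul_inv_cancel h0 (by simp), one_mul]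
  rw [orbitMass, orbitMass, ← ENNReal.tsum_mul_left, ← (Equiv.sigmaFiberEquiv P).tsum_eq]
  refine (ENNReal.tsum_sigma (fun q (o : {o // P o = q}) =>
    Set.indicator {o | ∃ x ∈ p ⁻¹' Ω, Quotient.mk _ x = o} (orbitWeight Z) o.1)).trans ?_
  refine tsum_congr fun q => ?_
  have hiff : ∀ o : {o // P o = q},
      (o.1 ∈ {o : MulAction.orbitRel.Quotient Γ X | ∃ x ∈ p ⁻¹' Ω, Quotient.mk _ x = o}) ↔
      q ∈ {o : MulAction.orbitRel.Quotient Γ Y | ∃ x ∈ Ω, Quotient.mk _ x = o} := by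
    rintro ⟨o, rfl⟩
    induction o using Quotient.inductionOn with | _ x
    constructor
    · rintro ⟨x', hx', h⟩
      exact ⟨p x', hx', congrArg P h⟩
    · rintro ⟨y, hy, h⟩
      obtain ⟨g, hg⟩ := MulAction.orbitRel_apply.mp (Quotient.exact h.symm)
      have hg' : g • y = p x := hg
      exact ⟨x, by rw [Set.mem_preimage, ← hg']; exact hΩ g y hy, rfl⟩
  by_cases hq : q ∈ {o : MulAction.orbitRel.Quotient Γ Y | ∃ x ∈ Ω, Quotient.mk _ x = o}
  · rw [Set.indicator_of_mem hq, ← key q]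
    exact tsum_congr fun o => Set.indicator_of_mem ((hiff o).mpr hq) _
  · rw [Set.indicator_of_notMem hq, mul_zero, ENNReal.tsum_eq_zero]
    exact fun o => Set.indicator_of_notMem (fun h => hq ((hiff o).mp h)) _

end OrbitMass

/-! ### Masses of double cosets: change of level and right translation. -/

section CosetMass

variable {Γ G : Type*} [Group Γ] [Group G]

/-- The coset space `G ⧸ U` with the action of `Γ` through `ι : Γ → G`. -/
def CosetSpace (_ι : Γ →* G) (U : Subgroup G) : Type _ := G ⧸ U

instance cosetSpaceAction (ι : Γ →* G) (U : Subgroup G) : MulAction Γ (CosetSpace ι U) :=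
  MulAction.compHom (G ⧸ U) ι

/-- The class of `g` in the coset space. -/
def CosetSpace.mk (ι : Γ →* G) (U : Subgroup G) (g : G) : CosetSpace ι U := (g : G ⧸ U)

theorem CosetSpace.smul_mk {ι : Γ →* G} {U : Subgroup G} (γ : Γ) (g : G) :
    γ • CosetSpace.mk ι U g = CosetSpace.mk ι U (ι γ * g) := rfl

theorem CosetSpace.mk_eq_iff {ι : Γ →* G} {U : Subgroup G} {g h : G} :
    CosetSpace.mk ι U g = CosetSpace.mk ι U h ↔ g⁻¹ * h ∈ U := QuotientGroup.eq

theorem CosetSpace.mk_surjective {ι : Γ →* G} {U : Subgroup G} :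
    Function.Surjective (CosetSpace.mk ι U) := Quotient.mk_surjective

variable (ι : Γ →* G) (Z : Subgroup Γ) [Z.Normal]

/-- The mass of the double cosets in `Γ \ G / U` meeting `Ω`. -/
def cosetMass (U : Subgroup G) (Ω : Set G) : ℝ≥0∞ :=
  orbitMass Z (CosetSpace.mk ι U '' Ω)

variable {ι Z}

theorem le_stabilizer_cosetSpace (hcent : ∀ z ∈ Z, ∀ g : G, ι z * g = g * ι z) {U : Subgroup G}
    (hU : ∀ z ∈ Z, ι z ∈ U) (x : CosetSpace ι U) : Z ≤ MulAction.stabilizer Γ x := by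
  intro z hz
  obtain ⟨g, rfl⟩ := CosetSpace.mk_surjective x
  rw [MulAction.mem_stabilizer_iff, CosetSpace.smul_mk, CosetSpace.mk_eq_iff, hcent z hz]
  simpa using hU z hz

/-- Passing to a smaller level multiplies masses by the index. -/
theorem cosetMass_of_le (hcent : ∀ z ∈ Z, ∀ g : G, ι z * g = g * ι z) {U V : Subgroup G}
    (hUV : U ≤ V) (hfin : U.relIndex V ≠ 0) (hU : ∀ z ∈ Z, ι z ∈ U) {Ω : Set G}
    (hΩ : ∀ γ : Γ, ∀ g ∈ Ω, ι γ * g ∈ Ω) (hΩV : ∀ v ∈ V, ∀ g ∈ Ω, g * v ∈ Ω) :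
    cosetMass ι Z U Ω = U.relIndex V * cosetMass ι Z V Ω := by
  let p : CosetSpace ι U → CosetSpace ι V := Subgroup.quotientMapOfLE hUV
  have hp : ∀ g, p (CosetSpace.mk ι U g) = CosetSpace.mk ι V g := fun g => rfl
  -- Stability of Ω under V makes its image in G/U a full preimage from G/V, so `orbitMass_preimage`
  -- applies; the fibre over gV is V/U through v ↦ gvU.
  have hpre : CosetSpace.mk ι U '' Ω = p ⁻¹' (CosetSpace.mk ι V '' Ω) := by
    ext x
    obtain ⟨g, rfl⟩ := CosetSpace.mk_surjective x
    rw [Set.mem_preimage, hp]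
    constructor
    · rintro ⟨h, hh, e⟩
      exact ⟨h, hh, by rw [← hp, e, hp]⟩
    · rintro ⟨h, hh, e⟩
      rw [CosetSpace.mk_eq_iff] at e
      exact ⟨g, by simpa using hΩV _ e _ hh, rfl⟩
  rw [cosetMass, cosetMass, hpre]
  refine orbitMass_preimage Z ?_ hfin ?_ (le_stabilizer_cosetSpace hcent hU) ?_
  · intro γ x
    obtain ⟨g, rfl⟩ := CosetSpace.mk_surjective x
    rfl
  · intro y
    obtain ⟨g, rfl⟩ := CosetSpace.mk_surjective y
    let f : V ⧸ U.subgroupOf V → p ⁻¹' {CosetSpace.mk ι V g} :=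
      Quotient.lift (fun v => ⟨CosetSpace.mk ι U (g * v), by
        rw [Set.mem_preimage, hp, Set.mem_singleton_iff, CosetSpace.mk_eq_iff]; simp⟩) (by
        intro v w h
        have h' := QuotientGroup.leftRel_apply.mp h
        rw [Subgroup.mem_subgroupOf] at h'
        refine Subtype.ext (CosetSpace.mk_eq_iff.mpr ?_)
        simpa [mul_assoc] using h')
    refine (Nat.card_congr (Equiv.ofBijective f ⟨?_, ?_⟩)).symm
    · intro v w h
      obtain ⟨v, rfl⟩ := QuotientGroup.mk_surjective v
      obtain ⟨w, rfl⟩ := QuotientGroup.mk_surjective w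
      have h' := CosetSpace.mk_eq_iff.mp (congrArg Subtype.val h)
      rw [QuotientGroup.eq, Subgroup.mem_subgroupOf]
      simpa [mul_assoc] using h'
    · rintro ⟨x, hx⟩
      obtain ⟨h, rfl⟩ := CosetSpace.mk_surjective x
      rw [Set.mem_preimage, hp, Set.mem_singleton_iff, eq_comm, CosetSpace.mk_eq_iff] at hx
      refine ⟨QuotientGroup.mk ⟨g⁻¹ * h, hx⟩, Subtype.ext ?_⟩
      show CosetSpace.mk ι U (g * (g⁻¹ * h)) = _
      rw [mul_inv_cancel_left]
  · rintro γ _ ⟨g, hg, rfl⟩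
    exact ⟨ι γ * g, hΩ γ g hg, rfl⟩

/-- Right translation by `β` identifies level `U` with level `β U β⁻¹`. -/
theorem cosetMass_mul_right (hcent : ∀ z ∈ Z, ∀ g : G, ι z * g = g * ι z) {U : Subgroup G}
    (hU : ∀ z ∈ Z, ι z ∈ U) {Ω : Set G} (hΩ : ∀ γ : Γ, ∀ g ∈ Ω, ι γ * g ∈ Ω) (β : G) :
    cosetMass ι Z U ((· * β) '' Ω) = cosetMass ι Z (U.map (MulAut.conj β).toMonoidHom) Ω := by
  set V := U.map (MulAut.conj β).toMonoidHom with hV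
  have hmem : ∀ {g}, g ∈ V ↔ β⁻¹ * g * β ∈ U := by
    intro g
    rw [hV, Subgroup.mem_map_equiv, MulAut.conj_symm_apply]
  -- The map gU ↦ gβ⁻¹V is well defined and bijective because V = βUβ⁻¹, and it commutes with left
  -- multiplication. It is then used as an equivariant map with fibres of size 1.
  let e : CosetSpace ι U ≃ CosetSpace ι V := Quotient.congr (Equiv.mulRight β⁻¹) (by
    intro g h
    rw [QuotientGroup.leftRel_apply, QuotientGroup.leftRel_apply, hmem]
    simp [mul_assoc])
  have he : ∀ g, e (CosetSpace.mk ι U g) = CosetSpace.mk ι V (g * β⁻¹) := fun g => rfl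
  have hpre : CosetSpace.mk ι U '' ((· * β) '' Ω) = e ⁻¹' (CosetSpace.mk ι V '' Ω) := by
    ext x
    obtain ⟨g, rfl⟩ := CosetSpace.mk_surjective x
    rw [Set.mem_preimage]
    constructor
    · rintro ⟨_, ⟨h, hh, rfl⟩, e'⟩
      exact ⟨h, hh, by rw [← e', he, mul_inv_cancel_right]⟩
    · rintro ⟨h, hh, e'⟩
      refine ⟨_, ⟨h, hh, rfl⟩, e.injective ?_⟩
      rw [he, mul_inv_cancel_right, e']
  rw [cosetMass, cosetMass, hpre, orbitMass_preimage Z (n := 1) _ one_ne_zero _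
    (le_stabilizer_cosetSpace hcent hU), Nat.cast_one, one_mul]
  · rintro γ _ ⟨g, hg, rfl⟩
    exact ⟨ι γ * g, hΩ γ g hg, rfl⟩
  · intro γ x
    obtain ⟨g, rfl⟩ := CosetSpace.mk_surjective x
    rw [CosetSpace.smul_mk, he, he, CosetSpace.smul_mk, mul_assoc]
  · intro y
    rw [Nat.card_eq_one_iff_unique]
    exact ⟨⟨fun s t => Subtype.ext (e.injective (s.2.trans t.2.symm))⟩,
      ⟨⟨e.symm y, e.apply_symm_apply y⟩⟩⟩

end CosetMass

/-! ### Additive approximation in F at finitely many primes. -/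

section StrongApproximation

open WithZero

variable {F : Type*} [Field F] [NumberField F]

theorem finite_valuation_ne_one {d : F} (hd : d ≠ 0) :
    {v : HeightOneSpectrum (𝓞 F) | v.valuation F d ≠ 1}.Finite := by
  have key : ∀ r : 𝓞 F, r ≠ 0 →
      {v : HeightOneSpectrum (𝓞 F) | v.valuation F (algebraMap (𝓞 F) F r) ≠ 1}.Finite := by
    intro r hr
    refine (Ideal.finite_factors (I := Ideal.span {r}) (by simpa using hr)).subset ?_
    intro v hv
    rw [Set.mem_ofPred_eq] at hv ⊢
    rw [← v.valuation_lt_one_iff_dvd (K := F)]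
    exact lt_of_le_of_ne (v.valuation_le_one r) hv
  obtain ⟨n, m, hm, rfl⟩ := IsFractionRing.div_surjective (A := 𝓞 F) d
  have hm0 := nonZeroDivisors.ne_zero hm
  have hn0 : n ≠ 0 := by rintro rfl; simp at hd
  refine ((key n hn0).union (key m hm0)).subset fun v hv => ?_
  by_contra h
  simp only [Set.mem_union, Set.mem_ofPred_eq, not_or, not_not] at h hv
  rw [map_div₀, h.1, h.2, div_one] at hv
  exact hv rfl

theorem valuation_ne_zero (v : HeightOneSpectrum (𝓞 F)) {d : F} (hd : d ≠ 0) :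
    v.valuation F d ≠ 0 := (Valuation.ne_zero_iff _).mpr hd

/-- A nonzero integer that is divisible by a given power of given primes. -/
theorem exists_int_valuation_le (T : Finset (HeightOneSpectrum (𝓞 F))) (n : ℕ) :
    ∃ d : 𝓞 F, d ≠ 0 ∧ ∀ v ∈ T, v.valuation F (algebraMap (𝓞 F) F d) ≤ exp (-(n : ℤ)) := by
  have h0 : (∏ v ∈ T, v.asIdeal ^ n) ≠ ⊥ :=
    Finset.prod_ne_zero_iff.mpr fun v _ => pow_ne_zero _ v.ne_bot
  obtain ⟨d, hd, hd0⟩ := Submodule.exists_mem_ne_zero_of_ne_bot h0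
  refine ⟨d, hd0, fun v hv => ?_⟩
  rw [valuation_le_exp_iff]
  exact Ideal.le_of_dvd (Finset.dvd_prod_of_mem _ hv) hd

/-- Strong approximation for the additive group of `F`. -/
theorem exists_approx_finset (T : Finset (HeightOneSpectrum (𝓞 F)))
    (z : ∀ v : HeightOneSpectrum (𝓞 F), v.adicCompletion F) (n : ℤ) :
    ∃ f : F, (∀ v ∈ T, Valued.v (algebraMap F (v.adicCompletion F) f - z v) ≤ exp n) ∧
      ∀ v ∉ T, Valued.v (algebraMap F (v.adicCompletion F) f) ≤ 1 := by
  classical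
  choose y hy using fun v => exists_approx v (z v) n
  obtain ⟨⟨s, hs⟩, hsy⟩ := IsLocalization.exist_integer_multiples (𝓞 F)⁰ T (fun v => y v)
  have hs0 : s ≠ 0 := nonZeroDivisors.ne_zero hs
  have hsF : algebraMap (𝓞 F) F s ≠ 0 := by simpa using hs0
  have hfin := finite_valuation_ne_one hsF
  let D := hfin.toFinset
  have hr : ∀ v, ∃ r : 𝓞 F, v ∈ T → algebraMap (𝓞 F) F r = algebraMap (𝓞 F) F s * y v := by
    intro v
    by_cases hv : v ∈ T
    · obtain ⟨r, hr⟩ := hsy v hv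
      exact ⟨r, fun _ => by rw [hr, ← Algebra.smul_def]⟩
    · exact ⟨0, fun h => absurd h hv⟩
  choose r hr using hr
  -- After clearing denominators by s, the Chinese remainder theorem is applied to sf. The exponents
  -- are large enough that division by s leaves precision min(n, 0); at primes of s outside T the
  -- target is 0, so f is integral there.
  let e : HeightOneSpectrum (𝓞 F) → ℕ := fun v =>
    (-(min n 0 + log (v.valuation F (algebraMap (𝓞 F) F s)))).toNat
  have he : ∀ v, exp (-(e v : ℤ)) ≤ exp (min n 0) * v.valuation F (algebraMap (𝓞 F) F s) := by
    intro v
    rw [← exp_log (valuation_ne_zero v hsF), ← exp_add, exp_le_exp]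
    simp only [e]
    have := Int.self_le_toNat (-(min n 0 + log (v.valuation F (algebraMap (𝓞 F) F s))))
    linarith
  obtain ⟨c, hc⟩ := IsDedekindDomain.exists_forall_sub_mem_ideal (s := T ∪ D)
    (fun v : HeightOneSpectrum (𝓞 F) => v.asIdeal) e (fun v _ => v.prime)
    (fun v _ w _ h h' => h (HeightOneSpectrum.ext h'))
    (fun v => if (v : HeightOneSpectrum (𝓞 F)) ∈ T then r v else 0)
  have hn1 : exp (min n 0) ≤ (1 : ℤᵐ⁰) := by rw [← exp_zero, exp_le_exp]; exact min_le_right _ _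
  have hnn : exp (min n 0) ≤ (exp n : ℤᵐ⁰) := by rw [exp_le_exp]; exact min_le_left _ _
  have key : ∀ v (t : F), v.valuation F (algebraMap (𝓞 F) F s * t) ≤ exp (-(e v : ℤ)) →
      v.valuation F t ≤ exp (min n 0) := by
    intro v t ht
    have := ht.trans (he v)
    rw [map_mul, mul_comm] at this
    exact le_of_mul_le_mul_right this (zero_lt_iff.mpr (valuation_ne_zero v hsF))
  have hmul : ∀ t : F, algebraMap (𝓞 F) F s * (algebraMap (𝓞 F) F c / algebraMap (𝓞 F) F s - t) =
      algebraMap (𝓞 F) F c - algebraMap (𝓞 F) F s * t := by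
    intro t; field_simp
  refine ⟨algebraMap (𝓞 F) F c / algebraMap (𝓞 F) F s, fun v hv => ?_, fun v hv => ?_⟩
  · have h1 := hc v (Finset.mem_union_left _ hv)
    rw [if_pos hv, ← valuation_le_exp_iff, map_sub, hr v hv, ← hmul] at h1
    rw [← sub_add_sub_cancel _ (algebraMap F (v.adicCompletion F) (y v))]
    refine (Valuation.map_add _ _ _).trans (max_le ?_ (hy v))
    rw [← map_sub, valued_algebraMap]
    exact (key v _ h1).trans hnn
  · rw [valued_algebraMap]
    by_cases hvD : v ∈ D
    · have h1 := hc v (Finset.mem_union_right _ hvD)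
      rw [if_neg hv, sub_zero, ← valuation_le_exp_iff,
        ← mul_div_cancel₀ (algebraMap (𝓞 F) F c) hsF] at h1
      refine (key v _ ?_).trans hn1
      convert h1 using 2
    · have : v.valuation F (algebraMap (𝓞 F) F s) = 1 := by
        simpa [D] using hvD
      rw [map_div₀, this, div_one]
      exact v.valuation_le_one c

end StrongApproximation

/-! ### Balls in B_v and approximation in B. -/

section Ball

open WithZero

variable {F : Type*} [Field F] [NumberField F] (v : HeightOneSpectrum (𝓞 F)) (a b : F)

/-- The lattice of all quaternions whose coordinates have absolute value at most `exp n`. -/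
def ball (n : ℤ) :
    Submodule (v.adicCompletionIntegers F) (BaseChange (v.adicCompletion F) a b) where
  carrier := {x | Valued.v x.re ≤ exp n ∧ Valued.v x.imI ≤ exp n ∧ Valued.v x.imJ ≤ exp n ∧
    Valued.v x.imK ≤ exp n}
  zero_mem' := by simp
  add_mem' := fun ⟨h1, h2, h3, h4⟩ ⟨g1, g2, g3, g4⟩ =>
    ⟨(Valuation.map_add _ _ _).trans (max_le h1 g1), (Valuation.map_add _ _ _).trans (max_le h2 g2),
      (Valuation.map_add _ _ _).trans (max_le h3 g3), (Valuation.map_add _ _ _).trans (max_le h4 g4)⟩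
  smul_mem' := by
    rintro c x ⟨h1, h2, h3, h4⟩
    have : ∀ y : v.adicCompletion F, Valued.v y ≤ exp n → Valued.v (c • y) ≤ exp n := by
      intro y hy
      rw [Algebra.smul_def, map_mul]
      exact (mul_le_of_le_one_left' c.2).trans hy
    exact ⟨this _ h1, this _ h2, this _ h3, this _ h4⟩

variable {v a b}

theorem mem_ball {n : ℤ} {x : BaseChange (v.adicCompletion F) a b} : x ∈ ball v a b n ↔
    Valued.v x.re ≤ exp n ∧ Valued.v x.imI ≤ exp n ∧ Valued.v x.imJ ≤ exp n ∧
    Valued.v x.imK ≤ exp n := Iff.rfl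

theorem ball_mono {m n : ℤ} (h : m ≤ n) : ball v a b m ≤ ball v a b n := by
  rintro x ⟨h1, h2, h3, h4⟩
  have : (exp m : ℤᵐ⁰) ≤ exp n := exp_le_exp.mpr h
  exact ⟨h1.trans this, h2.trans this, h3.trans this, h4.trans this⟩

theorem smul_mem_ball {c : v.adicCompletion F} {x : BaseChange (v.adicCompletion F) a b} {m n : ℤ}
    (hc : Valued.v c ≤ exp m) (hx : x ∈ ball v a b n) : c • x ∈ ball v a b (m + n) := by
  obtain ⟨h1, h2, h3, h4⟩ := hx
  have : ∀ y : v.adicCompletion F, Valued.v y ≤ exp n → Valued.v (c • y) ≤ exp (m + n) := by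
    intro y hy
    rw [smul_eq_mul, map_mul, exp_add]
    exact mul_le_mul' hc hy
  exact ⟨this _ h1, this _ h2, this _ h3, this _ h4⟩

theorem exists_valued_le_exp (v : HeightOneSpectrum (𝓞 F)) (x : v.adicCompletion F) :
    ∃ n : ℕ, Valued.v x ≤ exp (n : ℤ) := by
  by_cases hx : x = 0
  · exact ⟨0, by simp [hx]⟩
  · obtain ⟨n, hn⟩ := valued_eq_exp_log v hx
    exact ⟨n.toNat, by rw [hn, exp_le_exp]; exact Int.self_le_toNat n⟩

theorem exists_mem_ball (x : BaseChange (v.adicCompletion F) a b) :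
    ∃ n : ℕ, x ∈ ball v a b n := by
  obtain ⟨n1, h1⟩ := exists_valued_le_exp v x.re
  obtain ⟨n2, h2⟩ := exists_valued_le_exp v x.imI
  obtain ⟨n3, h3⟩ := exists_valued_le_exp v x.imJ
  obtain ⟨n4, h4⟩ := exists_valued_le_exp v x.imK
  refine ⟨n1 + n2 + n3 + n4, h1.trans ?_, h2.trans ?_, h3.trans ?_, h4.trans ?_⟩ <;>
  · rw [exp_le_exp]; push_cast; omega

theorem eq_sum_basis {K : Type*} [Field K] {a b : K} (x : ℍ[K, a, b]) :
    x = x.re • (⟨1, 0, 0, 0⟩ : ℍ[K, a, b]) + x.imI • (⟨0, 1, 0, 0⟩ : ℍ[K, a, b]) +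
      x.imJ • (⟨0, 0, 1, 0⟩ : ℍ[K, a, b]) + x.imK • (⟨0, 0, 0, 1⟩ : ℍ[K, a, b]) := by
  ext <;> simp

/-- Linear maps are bounded. -/
theorem exists_map_ball_le (L : BaseChange (v.adicCompletion F) a b →ₗ[v.adicCompletion F]
    BaseChange (v.adicCompletion F) a b) :
    ∃ m : ℕ, ∀ n : ℤ, ∀ x ∈ ball v a b n, L x ∈ ball v a b (n + m) := by
  obtain ⟨n1, h1⟩ := exists_mem_ball (L ⟨1, 0, 0, 0⟩)
  obtain ⟨n2, h2⟩ := exists_mem_ball (L ⟨0, 1, 0, 0⟩)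
  obtain ⟨n3, h3⟩ := exists_mem_ball (L ⟨0, 0, 1, 0⟩)
  obtain ⟨n4, h4⟩ := exists_mem_ball (L ⟨0, 0, 0, 1⟩)
  refine ⟨n1 + n2 + n3 + n4, fun n x hx => ?_⟩
  obtain ⟨g1, g2, g3, g4⟩ := hx
  rw [eq_sum_basis x, map_add, map_add, map_add, map_smul, map_smul, map_smul, map_smul]
  refine add_mem (add_mem (add_mem ?_ ?_) ?_) ?_
  · exact ball_mono (by push_cast; omega) (smul_mem_ball g1 h1)
  · exact ball_mono (by push_cast; omega) (smul_mem_ball g2 h2)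
  · exact ball_mono (by push_cast; omega) (smul_mem_ball g3 h3)
  · exact ball_mono (by push_cast; omega) (smul_mem_ball g4 h4)

/-- Strong approximation for the additive group of `B`. -/
theorem exists_quaternion_approx (T : Finset (HeightOneSpectrum (𝓞 F)))
    (z : ∀ v : HeightOneSpectrum (𝓞 F), BaseChange (v.adicCompletion F) a b) (n : ℤ) :
    ∃ x : ℍ[F, a, b], (∀ v ∈ T, toBaseChange (v.adicCompletion F) x - z v ∈ ball v a b n) ∧
      ∀ v ∉ T, toBaseChange (v.adicCompletion F) x ∈ ball v a b 0 := by
  obtain ⟨f1, h1, g1⟩ := exists_approx_finset T (fun v => (z v).re) n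
  obtain ⟨f2, h2, g2⟩ := exists_approx_finset T (fun v => (z v).imI) n
  obtain ⟨f3, h3, g3⟩ := exists_approx_finset T (fun v => (z v).imJ) n
  obtain ⟨f4, h4, g4⟩ := exists_approx_finset T (fun v => (z v).imK) n
  refine ⟨⟨f1, f2, f3, f4⟩, fun v hv => ⟨h1 v hv, h2 v hv, h3 v hv, h4 v hv⟩, fun v hv => ?_⟩
  rw [mem_ball, exp_zero]
  exact ⟨g1 v hv, g2 v hv, g3 v hv, g4 v hv⟩

theorem toBaseChange_smul {K : Type*} [Field K] [Algebra F K] (c : F) (x : ℍ[F, a, b]) :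
    toBaseChange K (c • x) = algebraMap F K c • toBaseChange K x := by
  ext <;> simp [toBaseChange, Algebra.smul_def]

theorem toBaseChange_algebraMap {K : Type*} [Field K] [Algebra F K] (c : F) :
    toBaseChange K (algebraMap F ℍ[F, a, b] c) = algebraMap K (BaseChange K a b) (algebraMap F K c) := by
  ext <;> simp [toBaseChange]

theorem nrd_toBaseChange {K : Type*} [Field K] [Algebra F K] (x : ℍ[F, a, b]) :
    nrd (toBaseChange K x) = algebraMap F K (nrd x) := by
  simp [nrd_apply, toBaseChange]

end Ball

/-! ### Lattices in B and their completions: the local-global dictionary. -/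

section Lattice

open WithZero

variable {F : Type*} [Field F] [NumberField F] {a b : F}

theorem integers_smul_def {v : HeightOneSpectrum (𝓞 F)} (c : v.adicCompletionIntegers F)
    (x : BaseChange (v.adicCompletion F) a b) : c • x = (c : v.adicCompletion F) • x := rfl

theorem ringOfIntegers_smul_def (c : 𝓞 F) (x : ℍ[F, a, b]) :
    c • x = (algebraMap (𝓞 F) F c) • x := rfl

/-- The ideal of all r with r x ∈ M is contained in no maximal ideal, hence contains 1. -/
theorem mem_of_locally {N : Type*} [AddCommGroup N] [Module (𝓞 F) N] {M : Submodule (𝓞 F) N}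
    {x : N}
    (h : ∀ v : HeightOneSpectrum (𝓞 F), ∃ s ∉ v.asIdeal, s • x ∈ M) : x ∈ M := by
  let J : Ideal (𝓞 F) := M.comap (LinearMap.toSpanSingleton (𝓞 F) N x)
  have hJ : J = ⊤ := by
    by_contra hJ
    obtain ⟨m, hm, hJm⟩ := Ideal.exists_le_maximal J hJ
    have hm0 : m ≠ ⊥ := Ring.ne_bot_of_isMaximal_of_not_isField hm
      (NumberField.RingOfIntegers.not_isField F)
    obtain ⟨s, hs, hsx⟩ := h ⟨m, hm.isPrime, hm0⟩
    exact hs (hJm hsx)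
  have : (1 : 𝓞 F) ∈ J := hJ ▸ Submodule.mem_top
  simpa [J] using this

theorem mem_coordLattice_ringOfIntegers {x : ℍ[F, a, b]} :
    x ∈ coordLattice (𝓞 F) a b ↔
      ∀ v : HeightOneSpectrum (𝓞 F), toBaseChange (v.adicCompletion F) x ∈ ball v a b 0 := by
  have key : ∀ f : F, f ∈ (algebraMap (𝓞 F) F).range ↔
      ∀ v : HeightOneSpectrum (𝓞 F), Valued.v (algebraMap F (v.adicCompletion F) f) ≤ 1 := by
    intro f
    constructor
    · rintro ⟨r, rfl⟩ v
      rw [valued_algebraMap]; exact v.valuation_le_one r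
    · intro h
      refine HeightOneSpectrum.mem_integers_of_valuation_le_one F f fun v => ?_
      rw [← valued_algebraMap]; exact h v
  rw [mem_coordLattice, key, key, key, key, ← forall_and, ← forall_and, ← forall_and]
  refine forall_congr' fun v => ?_
  rw [mem_ball, exp_zero]
  rfl

theorem exists_smul_mem_coordLattice_of_mem_ball {v : HeightOneSpectrum (𝓞 F)} {x : ℍ[F, a, b]}
    (hx : toBaseChange (v.adicCompletion F) x ∈ ball v a b 0) :
    ∃ s ∉ v.asIdeal, s • x ∈ coordLattice (𝓞 F) a b := by
  have key : ∀ f : F, Valued.v (algebraMap F (v.adicCompletion F) f) ≤ exp 0 →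
      ∃ s ∉ v.asIdeal, s • f ∈ (algebraMap (𝓞 F) F).range := by
    intro f hf
    rw [valued_algebraMap, exp_zero] at hf
    obtain ⟨n, d, h⟩ := HeightOneSpectrum.exists_primeCompl_mul_eq_of_integer v f hf
    exact ⟨d, d.2, n, by rw [Algebra.smul_def, mul_comm]; exact h.symm⟩
  obtain ⟨h1, h2, h3, h4⟩ := hx
  obtain ⟨s1, m1, e1⟩ := key x.re h1
  obtain ⟨s2, m2, e2⟩ := key x.imI h2
  obtain ⟨s3, m3, e3⟩ := key x.imJ h3
  obtain ⟨s4, m4, e4⟩ := key x.imK h4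
  have hp := v.isPrime
  refine ⟨s1 * s2 * s3 * s4, fun h => ?_, ?_, ?_, ?_, ?_⟩
  · rcases hp.mem_or_mem h with h | h
    · rcases hp.mem_or_mem h with h | h
      · rcases hp.mem_or_mem h with h | h
        · exact m1 h
        · exact m2 h
      · exact m3 h
    · exact m4 h
  · rw [show s1 * s2 * s3 * s4 = (s2 * s3 * s4) * s1 by ring, mul_smul]
    exact smul_mem_range _ e1
  · rw [show s1 * s2 * s3 * s4 = (s1 * s3 * s4) * s2 by ring, mul_smul]
    exact smul_mem_range _ e2
  · rw [show s1 * s2 * s3 * s4 = (s1 * s2 * s4) * s3 by ring, mul_smul]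
    exact smul_mem_range _ e3
  · rw [mul_smul]
    exact smul_mem_range _ e4

theorem toBaseChange_mem_completion {v : HeightOneSpectrum (𝓞 F)}
    {I : Submodule (𝓞 F) ℍ[F, a, b]} {x : ℍ[F, a, b]} (hx : x ∈ I) :
    toBaseChange (v.adicCompletion F) x ∈ completion v I :=
  Submodule.subset_span ⟨x, hx, rfl⟩

/-- Elements of `I` are dense in `I_v`. -/
theorem exists_mem_sub_mem_ball {v : HeightOneSpectrum (𝓞 F)} {I : Submodule (𝓞 F) ℍ[F, a, b]}
    {z : BaseChange (v.adicCompletion F) a b} (hz : z ∈ completion v I) (n : ℤ) :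
    ∃ x ∈ I, z - toBaseChange (v.adicCompletion F) x ∈ ball v a b n := by
  induction hz using Submodule.span_induction with
  | mem z h =>
    obtain ⟨x, hx, rfl⟩ := h
    exact ⟨x, hx, by simp⟩
  | zero => exact ⟨0, I.zero_mem, by simp⟩
  | add z w _ _ hz hw =>
    obtain ⟨x, hx, h⟩ := hz
    obtain ⟨y, hy, g⟩ := hw
    exact ⟨x + y, I.add_mem hx hy, by rw [map_add, add_sub_add_comm]; exact add_mem h g⟩
  | smul c z _ hz =>
    obtain ⟨x, hx, h⟩ := hz
    obtain ⟨m, hm⟩ := exists_mem_ball (toBaseChange (v.adicCompletion F) x)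
    obtain ⟨r, hr⟩ := exists_int_approx v c.2 (n - m)
    refine ⟨r • x, I.smul_mem r hx, ?_⟩
    have e : c • z - toBaseChange (v.adicCompletion F) (r • x) =
        c • (z - toBaseChange (v.adicCompletion F) x) -
        (algebraMap F (v.adicCompletion F) r - c) • toBaseChange (v.adicCompletion F) x := by
      rw [ringOfIntegers_smul_def, toBaseChange_smul, integers_smul_def, integers_smul_def, smul_sub,
        sub_smul]
      abel
    rw [e]
    refine sub_mem (Submodule.smul_mem _ _ h) ?_
    have := smul_mem_ball hr hm
    rwa [sub_add_cancel] at this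

/-- A family of local lattices that comes from a global lattice. -/
def IsAdelicLattice (M : ∀ v : HeightOneSpectrum (𝓞 F),
    Submodule (v.adicCompletionIntegers F) (BaseChange (v.adicCompletion F) a b)) : Prop :=
  (∀ v, ∃ n : ℕ, ball v a b (-(n : ℤ)) ≤ M v ∧ M v ≤ ball v a b n) ∧
    {v | M v ≠ ball v a b 0}.Finite

theorem IsAdelicLattice.exists_scalar {M : ∀ v : HeightOneSpectrum (𝓞 F),
    Submodule (v.adicCompletionIntegers F) (BaseChange (v.adicCompletion F) a b)}
    (hM : IsAdelicLattice M) : ∃ d : 𝓞 F, d ≠ 0 ∧ ∀ v,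
      (∀ x ∈ ball v a b 0, algebraMap F (v.adicCompletion F) d • x ∈ M v) ∧
      ∀ x ∈ M v, algebraMap F (v.adicCompletion F) d • x ∈ ball v a b 0 := by
  obtain ⟨h1, h2⟩ := hM
  choose n hn hn' using h1
  obtain ⟨d, hd, h⟩ := exists_int_valuation_le h2.toFinset (h2.toFinset.sup n)
  refine ⟨d, hd, fun v => ?_⟩
  by_cases hv : M v = ball v a b 0
  · have : Valued.v (algebraMap F (v.adicCompletion F) d) ≤ exp (0 : ℤ) := by
      rw [valued_algebraMap, exp_zero]; exact v.valuation_le_one d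
    rw [hv]
    exact ⟨fun x hx => smul_mem_ball this hx, fun x hx => smul_mem_ball this hx⟩
  · have hv' : v ∈ h2.toFinset := by simpa using hv
    have h3 : Valued.v (algebraMap F (v.adicCompletion F) d) ≤ exp (-(n v : ℤ)) := by
      rw [valued_algebraMap]
      refine (h v hv').trans ?_
      rw [exp_le_exp]
      have := Finset.le_sup (f := n) hv'
      omega
    refine ⟨fun x hx => hn v ?_, fun x hx => ?_⟩
    · simpa using smul_mem_ball h3 hx
    · simpa using smul_mem_ball h3 (hn' v hx)

/-- I lies between two nonzero multiples dL and e⁻¹L of the coordinate lattice L, and d and e are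
units at almost all primes. -/
theorem isAdelicLattice_completion {I : Submodule (𝓞 F) ℍ[F, a, b]} (hfg : I.FG)
    (hI : Submodule.span F (I : Set ℍ[F, a, b]) = ⊤) :
    IsAdelicLattice fun v => completion v I := by
  obtain ⟨d, hd, hdI⟩ := exists_smul_coordLattice_le (A := 𝓞 F) hI
  obtain ⟨e, he, heI⟩ := exists_smul_le_coordLattice (A := 𝓞 F) hfg
  have hd' : (algebraMap (𝓞 F) F d) ≠ 0 := by simpa using hd
  have he' : (algebraMap (𝓞 F) F e) ≠ 0 := by simpa using he
  have hlow : ∀ v : HeightOneSpectrum (𝓞 F), ∀ x ∈ ball v a b 0,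
      algebraMap F (v.adicCompletion F) d • x ∈ completion v I := by
    intro v x hx
    have hb : ∀ x : ℍ[F, a, b], x ∈ coordLattice (𝓞 F) a b →
        algebraMap F (v.adicCompletion F) d • toBaseChange (v.adicCompletion F) x ∈
          completion v I := by
      intro x hx
      rw [← toBaseChange_smul, ← ringOfIntegers_smul_def]
      exact toBaseChange_mem_completion (hdI x hx)
    have hs : ∀ (c : v.adicCompletion F) (y : BaseChange (v.adicCompletion F) a b),
        Valued.v c ≤ exp 0 → algebraMap F (v.adicCompletion F) d • y ∈ completion v I →
          algebraMap F (v.adicCompletion F) d • c • y ∈ completion v I := by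
      intro c y hc hy
      rw [smul_comm]
      rw [exp_zero] at hc
      exact Submodule.smul_mem _ (⟨c, hc⟩ : v.adicCompletionIntegers F) hy
    obtain ⟨g1, g2, g3, g4⟩ := hx
    have h0 : (0 : F) ∈ (algebraMap (𝓞 F) F).range := zero_mem _
    have h1 : (1 : F) ∈ (algebraMap (𝓞 F) F).range := one_mem _
    rw [eq_sum_basis x, smul_add, smul_add, smul_add]
    refine add_mem (add_mem (add_mem (hs _ _ g1 ?_) (hs _ _ g2 ?_)) (hs _ _ g3 ?_)) (hs _ _ g4 ?_)
    · simpa [toBaseChange] using hb ⟨1, 0, 0, 0⟩ ⟨h1, h0, h0, h0⟩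
    · simpa [toBaseChange] using hb ⟨0, 1, 0, 0⟩ ⟨h0, h1, h0, h0⟩
    · simpa [toBaseChange] using hb ⟨0, 0, 1, 0⟩ ⟨h0, h0, h1, h0⟩
    · simpa [toBaseChange] using hb ⟨0, 0, 0, 1⟩ ⟨h0, h0, h0, h1⟩
  have hup : ∀ v : HeightOneSpectrum (𝓞 F), ∀ x ∈ completion v I,
      algebraMap F (v.adicCompletion F) e • x ∈ ball v a b 0 := by
    intro v x hx
    induction hx using Submodule.span_induction with
    | mem z h =>
      obtain ⟨x, hx, rfl⟩ := h
      rw [← toBaseChange_smul, ← ringOfIntegers_smul_def]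
      exact mem_coordLattice_ringOfIntegers.mp (heI x hx) v
    | zero => simp
    | add z w _ _ hz hw => rw [smul_add]; exact add_mem hz hw
    | smul c z _ hz =>
      rw [integers_smul_def, smul_comm]
      exact Submodule.smul_mem _ c hz
  have hinv : ∀ v : HeightOneSpectrum (𝓞 F), ∀ f : F, f ≠ 0 →
      ∀ x : BaseChange (v.adicCompletion F) a b,
      algebraMap F (v.adicCompletion F) f • (algebraMap F (v.adicCompletion F) f⁻¹) • x = x := by
    intro v f hf x
    rw [smul_smul, ← map_mul, mul_inv_cancel₀ hf, map_one, one_smul]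
  refine ⟨fun v => ?_, ?_⟩
  · obtain ⟨n, hn⟩ := exists_valued_le_exp v (algebraMap F (v.adicCompletion F)
      (algebraMap (𝓞 F) F d)⁻¹)
    obtain ⟨m, hm⟩ := exists_valued_le_exp v (algebraMap F (v.adicCompletion F)
      (algebraMap (𝓞 F) F e)⁻¹)
    refine ⟨n + m, fun x hx => ?_, fun x hx => ?_⟩
    · rw [← hinv v _ hd' x]
      exact hlow v _ (ball_mono (by push_cast; omega) (smul_mem_ball hn hx))
    · rw [← hinv v _ he' x, smul_comm]
      exact ball_mono (by push_cast; omega) (smul_mem_ball hm (hup v _ hx))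
  · refine ((finite_valuation_ne_one hd').union (finite_valuation_ne_one he')).subset
      fun v hv => ?_
    by_contra h
    simp only [Set.mem_union, Set.mem_ofPred_eq, not_or, not_not] at h
    have hone : ∀ f : F, v.valuation F f = 1 →
        Valued.v (algebraMap F (v.adicCompletion F) f⁻¹) ≤ exp (0 : ℤ) := by
      intro f hf
      rw [valued_algebraMap, map_inv₀, hf, exp_zero, inv_one]
    refine hv (le_antisymm (fun x hx => ?_) (fun x hx => ?_))
    · rw [← hinv v _ he' x, smul_comm]
      exact smul_mem_ball (hone _ h.2) (hup v _ hx)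
    · rw [← hinv v _ hd' x]
      exact hlow v _ (smul_mem_ball (hone _ h.1) hx)

/-- A lattice is determined by its completions. -/
theorem mem_iff_forall_mem_completion {I : Submodule (𝓞 F) ℍ[F, a, b]}
    (hI : Submodule.span F (I : Set ℍ[F, a, b]) = ⊤) {x : ℍ[F, a, b]} :
    x ∈ I ↔ ∀ v : HeightOneSpectrum (𝓞 F),
      toBaseChange (v.adicCompletion F) x ∈ completion v I := by
  refine ⟨fun hx v => toBaseChange_mem_completion hx, fun h => mem_of_locally fun v => ?_⟩
  obtain ⟨d, hd, hdI⟩ := exists_smul_coordLattice_le (A := 𝓞 F) hI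
  have hd' : (algebraMap (𝓞 F) F d) ≠ 0 := by simpa using hd
  obtain ⟨n, hn⟩ := exists_valued_le_exp v (algebraMap F (v.adicCompletion F)
    (algebraMap (𝓞 F) F d)⁻¹)
  -- The precision makes (x - y)/d integral at v. A multiplier s prime to v removes the remaining
  -- denominators, so s(x - y) ∈ I, and y is already in I.
  obtain ⟨y, hy, hxy⟩ := exists_mem_sub_mem_ball (h v) (-n)
  have h1 := smul_mem_ball hn hxy
  rw [← map_sub, ← toBaseChange_smul, add_neg_cancel] at h1
  obtain ⟨s, hs, hsx⟩ := exists_smul_mem_coordLattice_of_mem_ball h1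
  refine ⟨s, hs, ?_⟩
  have h2 := hdI _ hsx
  rw [ringOfIntegers_smul_def d, ringOfIntegers_smul_def s, smul_smul, smul_smul, mul_right_comm,
    mul_inv_cancel₀ hd', one_mul, ← ringOfIntegers_smul_def, smul_sub] at h2
  have := I.add_mem h2 (I.smul_mem s hy)
  rwa [sub_add_cancel] at this

theorem eq_of_completion_eq {I J : Submodule (𝓞 F) ℍ[F, a, b]}
    (hI : Submodule.span F (I : Set ℍ[F, a, b]) = ⊤)
    (hJ : Submodule.span F (J : Set ℍ[F, a, b]) = ⊤)
    (h : ∀ v : HeightOneSpectrum (𝓞 F), completion v I = completion v J) : I = J := by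
  ext x
  rw [mem_iff_forall_mem_completion hI, mem_iff_forall_mem_completion hJ]
  simp only [h]

theorem integers_tower_smul {v : HeightOneSpectrum (𝓞 F)} (r : 𝓞 F) (x : ℍ[F, a, b]) :
    toBaseChange (v.adicCompletion F) (r • x) =
      (algebraMap (𝓞 F) (v.adicCompletionIntegers F) r) • toBaseChange (v.adicCompletion F) x := by
  rw [ringOfIntegers_smul_def, toBaseChange_smul]
  rfl

/-- The lattice with prescribed completions. -/
def globalLattice (M : ∀ v : HeightOneSpectrum (𝓞 F),
    Submodule (v.adicCompletionIntegers F) (BaseChange (v.adicCompletion F) a b)) :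
    Submodule (𝓞 F) ℍ[F, a, b] where
  carrier := {x | ∀ v, toBaseChange (v.adicCompletion F) x ∈ M v}
  zero_mem' v := by simp
  add_mem' hx hy v := by rw [map_add]; exact add_mem (hx v) (hy v)
  smul_mem' r x hx v := by rw [integers_tower_smul]; exact Submodule.smul_mem _ _ (hx v)

theorem fg_of_smul_le_coordLattice {I : Submodule (𝓞 F) ℍ[F, a, b]} {d : 𝓞 F} (hd : d ≠ 0)
    (h : ∀ x ∈ I, d • x ∈ coordLattice (𝓞 F) a b) : I.FG := by
  have hfg : (coordLattice (𝓞 F) a b).FG := by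
    have : coordLattice (𝓞 F) a b = Submodule.span (𝓞 F)
        {(⟨1, 0, 0, 0⟩ : ℍ[F, a, b]), ⟨0, 1, 0, 0⟩, ⟨0, 0, 1, 0⟩, ⟨0, 0, 0, 1⟩} := by
      refine le_antisymm ?_ (Submodule.span_le.mpr ?_)
      · rintro x ⟨⟨r1, h1⟩, ⟨r2, h2⟩, ⟨r3, h3⟩, ⟨r4, h4⟩⟩
        rw [eq_sum_basis x, ← h1, ← h2, ← h3, ← h4, ← ringOfIntegers_smul_def,
          ← ringOfIntegers_smul_def, ← ringOfIntegers_smul_def, ← ringOfIntegers_smul_def]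
        refine add_mem (add_mem (add_mem ?_ ?_) ?_) ?_ <;>
        · refine Submodule.smul_mem _ _ (Submodule.subset_span ?_)
          simp
      · have h0 : (0 : F) ∈ (algebraMap (𝓞 F) F).range := zero_mem _
        have h1 : (1 : F) ∈ (algebraMap (𝓞 F) F).range := one_mem _
        rintro x (rfl | rfl | rfl | rfl)
        exacts [⟨h1, h0, h0, h0⟩, ⟨h0, h1, h0, h0⟩, ⟨h0, h0, h1, h0⟩, ⟨h0, h0, h0, h1⟩]
    rw [this]
    exact Submodule.fg_span (Set.toFinite _)
  have hnoeth : IsNoetherian (𝓞 F) (coordLattice (𝓞 F) a b) :=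
    isNoetherian_of_fg_of_noetherian _ hfg
  let L : I →ₗ[𝓞 F] coordLattice (𝓞 F) a b :=
    { toFun := fun x => ⟨d • (x : ℍ[F, a, b]), h x x.2⟩
      map_add' := fun x y => Subtype.ext (by simp)
      map_smul' := fun r x => Subtype.ext (smul_comm d r (x : ℍ[F, a, b])) }
  have hd' : (algebraMap (𝓞 F) F d) ≠ 0 := by simpa using hd
  have hL : Function.Injective L := by
    intro x y hxy
    have h1 : d • (x : ℍ[F, a, b]) = d • (y : ℍ[F, a, b]) := congrArg Subtype.val hxy
    rw [ringOfIntegers_smul_def, ringOfIntegers_smul_def] at h1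
    exact Subtype.ext (smul_right_injective _ hd' h1)
  have := isNoetherian_of_injective L hL
  exact (Module.Finite.iff_fg (N := I)).mp inferInstance

section Global

variable {M : ∀ v : HeightOneSpectrum (𝓞 F),
    Submodule (v.adicCompletionIntegers F) (BaseChange (v.adicCompletion F) a b)}

theorem IsAdelicLattice.fg_globalLattice (hM : IsAdelicLattice M) : (globalLattice M).FG := by
  obtain ⟨d, hd, h⟩ := hM.exists_scalar
  refine fg_of_smul_le_coordLattice hd fun x hx => mem_coordLattice_ringOfIntegers.mpr fun v => ?_
  rw [ringOfIntegers_smul_def, toBaseChange_smul]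
  exact (h v).2 _ (hx v)

theorem IsAdelicLattice.exists_smul_mem_globalLattice (hM : IsAdelicLattice M) :
    ∃ d : 𝓞 F, d ≠ 0 ∧ ∀ x ∈ coordLattice (𝓞 F) a b, d • x ∈ globalLattice M := by
  obtain ⟨d, hd, h⟩ := hM.exists_scalar
  refine ⟨d, hd, fun x hx v => ?_⟩
  rw [ringOfIntegers_smul_def, toBaseChange_smul]
  exact (h v).1 _ (mem_coordLattice_ringOfIntegers.mp hx v)

theorem span_eq_top_of_smul_mem {I : Submodule (𝓞 F) ℍ[F, a, b]} {d : 𝓞 F} (hd : d ≠ 0)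
    (h : ∀ x ∈ coordLattice (𝓞 F) a b, d • x ∈ I) :
    Submodule.span F (I : Set ℍ[F, a, b]) = ⊤ := by
  refine eq_top_iff.mpr fun x _ => ?_
  obtain ⟨e, he, hx⟩ := exists_smul_mem_coordLattice (A := 𝓞 F) x
  have h1 := h _ hx
  rw [ringOfIntegers_smul_def, ringOfIntegers_smul_def, smul_smul] at h1
  have hde : algebraMap (𝓞 F) F d * algebraMap (𝓞 F) F e ≠ 0 := by simp [hd, he]
  have := Submodule.smul_mem (Submodule.span F (I : Set ℍ[F, a, b]))
    (algebraMap (𝓞 F) F d * algebraMap (𝓞 F) F e)⁻¹ (Submodule.subset_span h1)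
  rwa [smul_smul, inv_mul_cancel₀ hde, one_smul] at this

theorem IsAdelicLattice.span_globalLattice (hM : IsAdelicLattice M) :
    Submodule.span F (globalLattice M : Set ℍ[F, a, b]) = ⊤ := by
  obtain ⟨d, hd, h⟩ := hM.exists_smul_mem_globalLattice
  exact span_eq_top_of_smul_mem hd h

theorem IsAdelicLattice.completion_globalLattice (hM : IsAdelicLattice M)
    (v : HeightOneSpectrum (𝓞 F)) : completion v (globalLattice M) = M v := by
  classical
  refine le_antisymm (Submodule.span_le.mpr ?_) fun z hz => ?_
  · rintro _ ⟨x, hx, rfl⟩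
    exact hx v
  -- The completion of the global lattice contains some ball of radius exp(-k). A global x within
  -- this radius of z at v, small at the other exceptional primes and integral elsewhere, lies in
  -- the global lattice, so z differs from x by an element of the completion.
  obtain ⟨k, hk, -⟩ := (isAdelicLattice_completion hM.fg_globalLattice hM.span_globalLattice).1 v
  obtain ⟨h1, h2⟩ := hM
  choose n hn hn' using h1
  let T := insert v h2.toFinset
  obtain ⟨x, hx, hx'⟩ := exists_quaternion_approx T
    (fun w => if h : v = w then h ▸ z else 0) (-((T.sup n + k : ℕ) : ℤ))
  have hxv := hx v (Finset.mem_insert_self _ _)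
  rw [dif_pos rfl] at hxv
  have hle : ∀ w ∈ T, ball w a b (-((T.sup n + k : ℕ) : ℤ)) ≤ M w := fun w hw =>
    (ball_mono (by have := Finset.le_sup (f := n) hw; push_cast; omega)).trans (hn w)
  have hxI : x ∈ globalLattice M := by
    intro w
    by_cases hw : w ∈ T
    · by_cases hvw : v = w
      · subst hvw
        have := add_mem (hle v hw hxv) hz
        rwa [sub_add_cancel] at this
      · have := hx w hw
        rw [dif_neg hvw, sub_zero] at this
        exact hle w hw this
    · have hw' : M w = ball w a b 0 := by
        by_contra h
        exact hw (Finset.mem_insert_of_mem (by simpa using h))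
      rw [hw']
      exact hx' w hw
  have h3 : z - toBaseChange (v.adicCompletion F) x ∈ completion v (globalLattice M) := by
    rw [← neg_mem_iff, neg_sub]
    exact hk (ball_mono (by push_cast; omega) hxv)
  have := add_mem h3 (toBaseChange_mem_completion hxI)
  rwa [sub_add_cancel] at this

end Global

end Lattice

/-! ### Fractional ideals through their valuations. -/

section IdealCount

open WithZero

variable {F : Type*} [Field F] [NumberField F]

theorem valuation_eq_exp_neg_count (v : HeightOneSpectrum (𝓞 F)) {f : F} (hf : f ≠ 0) :
    v.valuation F f = exp (-FractionalIdeal.count F v (FractionalIdeal.spanSingleton (𝓞 F)⁰ f)) := by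
  classical
  have key : ∀ r : 𝓞 F, r ≠ 0 → v.valuation F (algebraMap (𝓞 F) F r) =
      exp (-FractionalIdeal.count F v
        (FractionalIdeal.spanSingleton (𝓞 F)⁰ (algebraMap (𝓞 F) F r))) := by
    intro r hr
    rw [HeightOneSpectrum.valuation_of_algebraMap, HeightOneSpectrum.intValuation_if_neg _ hr,
      ← FractionalIdeal.coeIdeal_span_singleton, FractionalIdeal.count_coe]
    simpa using hr
  obtain ⟨n, d, hd, rfl⟩ := IsFractionRing.div_surjective (A := 𝓞 F) f
  have hd0 := nonZeroDivisors.ne_zero hd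
  have hn0 : n ≠ 0 := by rintro rfl; simp at hf
  have hdF : algebraMap (𝓞 F) F d ≠ 0 := by simpa using hd0
  have h1 : FractionalIdeal.spanSingleton (𝓞 F)⁰ (algebraMap (𝓞 F) F n) =
      FractionalIdeal.spanSingleton (𝓞 F)⁰ (algebraMap (𝓞 F) F n / algebraMap (𝓞 F) F d) *
      FractionalIdeal.spanSingleton (𝓞 F)⁰ (algebraMap (𝓞 F) F d) := by
    rw [FractionalIdeal.spanSingleton_mul_spanSingleton, div_mul_cancel₀ _ hdF]
  have h2 := congrArg (FractionalIdeal.count F v) h1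
  rw [FractionalIdeal.count_mul _ _ (FractionalIdeal.spanSingleton_ne_zero_iff.mpr hf)
    (FractionalIdeal.spanSingleton_ne_zero_iff.mpr hdF)] at h2
  rw [map_div₀, key n hn0, key d hd0, h2, ← exp_sub]
  congr 1; ring

theorem fractionalIdeal_le_one_of_count_nonneg {I : FractionalIdeal (𝓞 F)⁰ F} (hI : I ≠ 0)
    (h : ∀ v : HeightOneSpectrum (𝓞 F), 0 ≤ FractionalIdeal.count F v I) : I ≤ 1 := by
  rw [← FractionalIdeal.finprod_heightOneSpectrum_factorization' F hI]
  refine finprod_induction (fun J : FractionalIdeal (𝓞 F)⁰ F => J ≤ 1) le_rfl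
    (fun J K hJ hK => mul_le_one' hJ hK) fun v => ?_
  lift FractionalIdeal.count F v I to ℕ using h v with n
  rw [zpow_natCast]
  exact pow_le_one' FractionalIdeal.coeIdeal_le_one n

theorem mem_fractionalIdeal_iff {I : FractionalIdeal (𝓞 F)⁰ F} (hI : I ≠ 0) {f : F} :
    f ∈ I ↔ ∀ v : HeightOneSpectrum (𝓞 F),
      v.valuation F f ≤ exp (-FractionalIdeal.count F v I) := by
  by_cases hf : f = 0
  · subst hf; simp [I.zero_mem]
  have hf' : FractionalIdeal.spanSingleton (𝓞 F)⁰ f ≠ 0 :=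
    FractionalIdeal.spanSingleton_ne_zero_iff.mpr hf
  have : (∀ v : HeightOneSpectrum (𝓞 F),
      v.valuation F f ≤ exp (-FractionalIdeal.count F v I)) ↔
      ∀ v : HeightOneSpectrum (𝓞 F), FractionalIdeal.count F v I ≤
        FractionalIdeal.count F v (FractionalIdeal.spanSingleton (𝓞 F)⁰ f) := by
    refine forall_congr' fun v => ?_
    rw [valuation_eq_exp_neg_count v hf, exp_le_exp, neg_le_neg_iff]
  rw [this, ← FractionalIdeal.spanSingleton_le_iff_mem]
  refine ⟨fun h v => FractionalIdeal.count_mono F v hf' h, fun h => ?_⟩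
  have h1 : FractionalIdeal.spanSingleton (𝓞 F)⁰ f * I⁻¹ ≤ 1 := by
    refine fractionalIdeal_le_one_of_count_nonneg (mul_ne_zero hf' (inv_ne_zero hI)) fun v => ?_
    rw [FractionalIdeal.count_mul _ _ hf' (inv_ne_zero hI), FractionalIdeal.count_inv]
    have := h v
    omega
  have h2 := mul_le_mul_left h1 I
  rwa [mul_assoc, inv_mul_cancel₀ hI, mul_one, one_mul] at h2

theorem fractionalIdeal_ext_count {I J : (FractionalIdeal (𝓞 F)⁰ F)ˣ}
    (h : ∀ v : HeightOneSpectrum (𝓞 F), FractionalIdeal.count F v (I : FractionalIdeal (𝓞 F)⁰ F) =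
      FractionalIdeal.count F v (J : FractionalIdeal (𝓞 F)⁰ F)) : I = J := by
  ext1
  rw [← FractionalIdeal.finprod_heightOneSpectrum_factorization' F I.ne_zero,
    ← FractionalIdeal.finprod_heightOneSpectrum_factorization' F J.ne_zero]
  simp only [h]

theorem exists_fractionalIdeal_count (n : HeightOneSpectrum (𝓞 F) → ℤ) (hn : {v | n v ≠ 0}.Finite) :
    ∃ I : (FractionalIdeal (𝓞 F)⁰ F)ˣ,
      ∀ v, FractionalIdeal.count F v (I : FractionalIdeal (𝓞 F)⁰ F) = n v := by
  have h0 : (∏ᶠ v : HeightOneSpectrum (𝓞 F),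
      (v.asIdeal : FractionalIdeal (𝓞 F)⁰ F) ^ n v) ≠ 0 := by
    refine finprod_induction (fun J : FractionalIdeal (𝓞 F)⁰ F => J ≠ 0) one_ne_zero
      (fun J K hJ hK => mul_ne_zero hJ hK) fun v => ?_
    exact zpow_ne_zero _ (FractionalIdeal.coeIdeal_ne_zero.mpr v.ne_bot)
  refine ⟨Units.mk0 _ h0, fun v => ?_⟩
  rw [Units.val_mk0, FractionalIdeal.count_finprod F v n]
  exact hn

theorem count_toPrincipalIdeal (v : HeightOneSpectrum (𝓞 F)) (x : Fˣ) :
    exp (-FractionalIdeal.count F v (toPrincipalIdeal (𝓞 F) F x : FractionalIdeal (𝓞 F)⁰ F)) =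
      v.valuation F x := by
  rw [coe_toPrincipalIdeal, valuation_eq_exp_neg_count v x.ne_zero]

end IdealCount

/-! ### Units of local orders and weak approximation in Bˣ. -/

section LocalOrder

open WithZero

variable {F : Type*} [Field F] [NumberField F] {a b : F}

theorem mem_completionOrder_iff {v : HeightOneSpectrum (𝓞 F)} {O : Subalgebra (𝓞 F) ℍ[F, a, b]}
    {z : BaseChange (v.adicCompletion F) a b} :
    z ∈ completionOrder v O ↔ z ∈ completion v (Subalgebra.toSubmodule O) := by
  rw [← toSubmodule_completionOrder, Subalgebra.mem_toSubmodule]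

theorem fg_completion (v : HeightOneSpectrum (𝓞 F)) {I : Submodule (𝓞 F) ℍ[F, a, b]}
    (hI : I.FG) : (completion v I).FG := by
  classical
  obtain ⟨s, hs⟩ := hI
  refine ⟨s.image (toBaseChange (v.adicCompletion F)), le_antisymm ?_ ?_⟩
  · refine Submodule.span_le.mpr ?_
    intro z hz
    obtain ⟨x, hx, rfl⟩ := Finset.mem_image.mp (Finset.mem_coe.mp hz)
    exact toBaseChange_mem_completion (hs ▸ Submodule.subset_span hx)
  · refine Submodule.span_le.mpr ?_
    rintro _ ⟨x, hx, rfl⟩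
    rw [← hs] at hx
    change toBaseChange (v.adicCompletion F) x ∈ Submodule.span _ _
    induction hx using Submodule.span_induction with
    | mem x h => exact Submodule.subset_span (by simpa using ⟨x, h, rfl⟩)
    | zero => rw [map_zero]; exact zero_mem _
    | add x y _ _ hx hy => rw [map_add]; exact add_mem hx hy
    | smul r x _ hx => rw [integers_tower_smul]; exact Submodule.smul_mem _ _ hx

theorem exists_ball_le_completionOrder (v : HeightOneSpectrum (𝓞 F))
    {O : Subalgebra (𝓞 F) ℍ[F, a, b]} (hO : IsOrder O) :
    ∃ n : ℕ, ∀ z ∈ ball v a b (-(n : ℤ)), z ∈ completionOrder v O := by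
  obtain ⟨n, hn, -⟩ := (isAdelicLattice_completion hO.1 hO.2).1 v
  exact ⟨n, fun z hz => mem_completionOrder_iff.mpr (hn hz)⟩

theorem isOrder_completionOrder (v : HeightOneSpectrum (𝓞 F)) {O : Subalgebra (𝓞 F) ℍ[F, a, b]}
    (hO : IsOrder O) : IsOrder (completionOrder v O) := by
  refine ⟨toSubmodule_completionOrder v O ▸ fg_completion v hO.1, eq_top_iff.mpr fun z _ => ?_⟩
  obtain ⟨n, hn⟩ := exists_ball_le_completionOrder v hO
  obtain ⟨m, hm⟩ := exists_mem_ball z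
  obtain ⟨f, hf0, hf⟩ := exists_valuation_eq_exp v (-(n + m : ℤ))
  have hf' : algebraMap F (v.adicCompletion F) f ≠ 0 := by simpa using hf0
  have h1 := smul_mem_ball (c := algebraMap F (v.adicCompletion F) f)
    (by rw [valued_algebraMap, hf]) hm
  have h2 := Submodule.smul_mem (Submodule.span (v.adicCompletion F)
    (completionOrder v O : Set (BaseChange (v.adicCompletion F) a b)))
    (algebraMap F (v.adicCompletion F) f)⁻¹ (Submodule.subset_span (hn _ (ball_mono (by omega) h1)))
  rwa [smul_smul, inv_mul_cancel₀ hf', one_smul] at h2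

theorem mem_localUnits {v : HeightOneSpectrum (𝓞 F)} {O : Subalgebra (𝓞 F) ℍ[F, a, b]}
    {u : (BaseChange (v.adicCompletion F) a b)ˣ} : u ∈ localUnits v O ↔
      (u : BaseChange (v.adicCompletion F) a b) ∈ completionOrder v O ∧
      (↑u⁻¹ : BaseChange (v.adicCompletion F) a b) ∈ completionOrder v O :=
  Submonoid.mem_units_iff _ _

theorem valued_nrd_le_one {v : HeightOneSpectrum (𝓞 F)} {O : Subalgebra (𝓞 F) ℍ[F, a, b]}
    (hO : IsOrder O) {z : BaseChange (v.adicCompletion F) a b} (hz : z ∈ completionOrder v O) :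
    Valued.v (nrd z) ≤ 1 := by
  rw [← mem_range_iff_valued_le_one]
  exact nrd_mem_range (isOrder_completionOrder v hO).1 hz

theorem valued_nrd_localUnits {v : HeightOneSpectrum (𝓞 F)} {O : Subalgebra (𝓞 F) ℍ[F, a, b]}
    (hO : IsOrder O) {u : (BaseChange (v.adicCompletion F) a b)ˣ} (hu : u ∈ localUnits v O) :
    Valued.v (nrd (u : BaseChange (v.adicCompletion F) a b)) = 1 := by
  obtain ⟨h1, h2⟩ := mem_localUnits.mp hu
  refine le_antisymm (valued_nrd_le_one hO h1) ?_
  have h3 := valued_nrd_le_one hO h2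
  rw [nrd_unit_inv, map_inv₀] at h3
  exact (inv_le_one₀ (zero_lt_iff.mpr
    ((Valuation.ne_zero_iff _).mpr (nrd_unit_ne_zero u)))).mp h3

/-- An element of a local order whose reduced norm is a unit is a unit. -/
theorem exists_localUnits_of_valued_nrd {v : HeightOneSpectrum (𝓞 F)}
    {O : Subalgebra (𝓞 F) ℍ[F, a, b]}
    (hO : IsOrder O) {z : BaseChange (v.adicCompletion F) a b} (hz : z ∈ completionOrder v O)
    (hn : Valued.v (nrd z) = 1) : ∃ u ∈ localUnits v O, (u : BaseChange (v.adicCompletion F) a b) = z := by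
  have h0 : nrd z ≠ 0 := by
    intro h; rw [h, map_zero] at hn; exact zero_ne_one hn
  obtain ⟨u, rfl⟩ := isUnit_of_nrd_ne_zero h0
  refine ⟨u, mem_localUnits.mpr ⟨hz, ?_⟩, rfl⟩
  rw [unit_inv_eq]
  have h1 : Valued.v ((nrd (u : BaseChange (v.adicCompletion F) a b))⁻¹) ≤ 1 := by
    rw [map_inv₀, hn, inv_one]
  exact Subalgebra.smul_mem _ (star_mem (isOrder_completionOrder v hO).1 hz)
    (⟨_, h1⟩ : v.adicCompletionIntegers F)

/-- A radius one step smaller than needed for z ∈ O_v makes z = ϖw with ϖ a uniformizer and w ∈ O_v.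
Then nrd(1 + z) is 1 plus a multiple of ϖ, hence a unit. -/
theorem exists_ball_one_add (v : HeightOneSpectrum (𝓞 F)) {O : Subalgebra (𝓞 F) ℍ[F, a, b]}
    (hO : IsOrder O) : ∃ n : ℕ, ∀ z ∈ ball v a b (-(n : ℤ)),
      ∃ u ∈ localUnits v O, (u : BaseChange (v.adicCompletion F) a b) = 1 + z := by
  obtain ⟨n, hn⟩ := exists_ball_le_completionOrder v hO
  refine ⟨n + 1, fun z hz => ?_⟩
  obtain ⟨f, hf0, hf⟩ := exists_valuation_eq_exp v 1
  have hf' : algebraMap F (v.adicCompletion F) f ≠ 0 := by simpa using hf0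
  have hw := hn _ (ball_mono (by push_cast; omega) (smul_mem_ball
    (c := algebraMap F (v.adicCompletion F) f) (m := 1) (by rw [valued_algebraMap, hf]) hz))
  set w := algebraMap F (v.adicCompletion F) f • z with hw'
  have hz' : z = (algebraMap F (v.adicCompletion F) f)⁻¹ • w := by
    rw [hw', smul_smul, inv_mul_cancel₀ hf', one_smul]
  have hzO : z ∈ completionOrder v O := hn _ (ball_mono (by push_cast; omega) hz)
  have hloc := isOrder_completionOrder v hO
  refine exists_localUnits_of_valued_nrd hO (add_mem (one_mem _) hzO) ?_
  have h1 : Valued.v ((algebraMap F (v.adicCompletion F) f)⁻¹) < 1 := by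
    rw [map_inv₀, valued_algebraMap, hf, ← exp_neg, ← exp_zero, exp_lt_exp]; omega
  have h2 : nrd (1 + z) = 1 + (algebraMap F (v.adicCompletion F) f)⁻¹ *
      (trd (star w) + (algebraMap F (v.adicCompletion F) f)⁻¹ * nrd w) := by
    rw [nrd_add, hz', star_smul', mul_smul_comm, trd_smul, nrd_smul, map_one, one_mul]
    ring
  rw [h2]
  refine Valuation.map_one_add_of_lt _ ?_
  rw [map_mul]
  refine mul_lt_one_of_lt_of_le h1 ?_
  refine (Valuation.map_add _ _ _).trans (max_le ?_ ?_)
  · rw [← mem_range_iff_valued_le_one]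
    exact trd_mem_range hloc.1 (star_mem hloc.1 hw)
  · rw [map_mul]
    exact mul_le_one' h1.le (valued_nrd_le_one hO hw)

theorem exists_ball_mul (v : HeightOneSpectrum (𝓞 F)) {O : Subalgebra (𝓞 F) ℍ[F, a, b]}
    (hO : IsOrder O) (x : (BaseChange (v.adicCompletion F) a b)ˣ) :
    ∃ n : ℕ, ∀ z : BaseChange (v.adicCompletion F) a b,
      z - (↑x⁻¹ : BaseChange (v.adicCompletion F) a b) ∈ ball v a b (-(n : ℤ)) →
      ∃ u ∈ localUnits v O, (u : BaseChange (v.adicCompletion F) a b) = z * x := by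
  obtain ⟨n, hn⟩ := exists_ball_one_add v hO
  obtain ⟨m, hm⟩ := exists_map_ball_le (LinearMap.mulRight (v.adicCompletion F)
    (x : BaseChange (v.adicCompletion F) a b))
  refine ⟨n + m, fun z hz => ?_⟩
  obtain ⟨u, hu, h⟩ := hn _ (ball_mono (by push_cast; omega) (hm _ _ hz))
  refine ⟨u, hu, h.trans ?_⟩
  rw [LinearMap.mulRight_apply, sub_mul, Units.inv_mul]
  abel

/-- The diagonal embedding of `Bˣ` in `∏ v, B_vˣ`. -/
def diagUnits (a b : F) : ℍ[F, a, b]ˣ →*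
    ∀ v : HeightOneSpectrum (𝓞 F), (BaseChange (v.adicCompletion F) a b)ˣ :=
  MonoidHom.pi fun v => Units.map
    (toBaseChange (v.adicCompletion F) :
      ℍ[F, a, b] →+* BaseChange (v.adicCompletion F) a b).toMonoidHom

theorem coe_diagUnits (γ : ℍ[F, a, b]ˣ) (v : HeightOneSpectrum (𝓞 F)) :
    (diagUnits a b γ v : BaseChange (v.adicCompletion F) a b) =
      toBaseChange (v.adicCompletion F) (γ : ℍ[F, a, b]) := rfl

theorem nrd_diagUnits (γ : ℍ[F, a, b]ˣ) (v : HeightOneSpectrum (𝓞 F)) :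
    nrd (diagUnits a b γ v : BaseChange (v.adicCompletion F) a b) =
      algebraMap F (v.adicCompletion F) (nrd (γ : ℍ[F, a, b])) := nrd_toBaseChange _

/-- Weak approximation for `Bˣ`. -/
theorem exists_diagUnits_mul_mem_localUnits {O : Subalgebra (𝓞 F) ℍ[F, a, b]} (hO : IsOrder O)
    (T : Finset (HeightOneSpectrum (𝓞 F)))
    (x : ∀ v : HeightOneSpectrum (𝓞 F), (BaseChange (v.adicCompletion F) a b)ˣ) :
    ∃ γ : ℍ[F, a, b]ˣ, ∀ v ∈ T, diagUnits a b γ v * x v ∈ localUnits v O := by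
  -- A prime in T is needed to see that the approximating quaternion has nonzero norm.
  rcases T.eq_empty_or_nonempty with rfl | ⟨w, hw⟩
  · exact ⟨1, by simp⟩
  choose n hn using fun v => exists_ball_mul v hO (x v)
  obtain ⟨y, hy, -⟩ := exists_quaternion_approx T
    (fun v => (↑(x v)⁻¹ : BaseChange (v.adicCompletion F) a b)) (-((T.sup n : ℕ) : ℤ))
  have h1 : ∀ v ∈ T, ∃ u ∈ localUnits v O,
      (u : BaseChange (v.adicCompletion F) a b) = toBaseChange (v.adicCompletion F) y *
        (x v : BaseChange (v.adicCompletion F) a b) := fun v hv =>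
    hn v _ (ball_mono (by have := Finset.le_sup (f := n) hv; omega) (hy v hv))
  have hy0 : nrd y ≠ 0 := by
    intro h
    obtain ⟨u, -, hu⟩ := h1 w hw
    refine nrd_unit_ne_zero u ?_
    rw [hu, map_mul, nrd_toBaseChange, h, map_zero, zero_mul]
  obtain ⟨γ, rfl⟩ := isUnit_of_nrd_ne_zero hy0
  refine ⟨γ, fun v hv => ?_⟩
  obtain ⟨u, hu, h⟩ := h1 v hv
  convert hu using 1
  ext1
  rw [h]; rfl

/-- Elements of a lattice with prescribed behaviour at one prime. -/
theorem exists_mem_eq_mul_localUnits {O : Subalgebra (𝓞 F) ℍ[F, a, b]} (hO : IsOrder O)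
    {v : HeightOneSpectrum (𝓞 F)} {I : Submodule (𝓞 F) ℍ[F, a, b]}
    {x : (BaseChange (v.adicCompletion F) a b)ˣ}
    (hx : (x : BaseChange (v.adicCompletion F) a b) ∈ completion v I) :
    ∃ y ∈ I, ∃ u ∈ localUnits v O, toBaseChange (v.adicCompletion F) y = u * x := by
  obtain ⟨n, hn⟩ := exists_ball_one_add v hO
  obtain ⟨m, hm⟩ := exists_map_ball_le (LinearMap.mulRight (v.adicCompletion F)
    (↑x⁻¹ : BaseChange (v.adicCompletion F) a b))
  obtain ⟨y, hy, hxy⟩ := exists_mem_sub_mem_ball hx (-((n + m : ℕ) : ℤ))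
  obtain ⟨u, hu, h⟩ := hn _ (neg_mem (ball_mono (by push_cast; omega) (hm _ _ hxy)))
  refine ⟨y, hy, u, hu, ?_⟩
  rw [h, LinearMap.mulRight_apply, sub_mul, Units.mul_inv, neg_sub, add_sub_cancel, mul_assoc,
    Units.inv_mul, mul_one]

theorem exists_localUnits_nrd_eq {O : Subalgebra (𝓞 F) ℍ[F, a, b]} {v : HeightOneSpectrum (𝓞 F)}
    (hO : IsOrder O) (hmax : IsMaximalOrder (completionOrder v O)) {x : v.adicCompletion F}
    (hx : Valued.v x = 1) :
    ∃ u ∈ localUnits v O, nrd (u : BaseChange (v.adicCompletion F) a b) = x := by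
  have hu : IsUnit (⟨x, hx.le⟩ : v.adicCompletionIntegers F) :=
    HeightOneSpectrum.adicCompletionIntegers.isUnit_iff_valued_eq_one.mpr hx
  obtain ⟨u, hu⟩ := hu
  obtain ⟨z, hz, h⟩ := exists_mem_nrd_eq_unit hmax u
  have h' : nrd z = x := by rw [h, hu]; rfl
  obtain ⟨w, hw, rfl⟩ := exists_localUnits_of_valued_nrd hO hz (by rw [h', hx])
  exact ⟨w, hw, h'⟩

/-- Trace zero is required so that p² = -nrd p is a scalar; the comparison of fibres depends on this
centrality. -/
theorem exists_pure_unit_valued_nrd {O : Subalgebra (𝓞 F) ℍ[F, a, b]} (ha : a ≠ 0) (hb : b ≠ 0)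
    {v : HeightOneSpectrum (𝓞 F)} (hmax : IsMaximalOrder (completionOrder v O)) :
    ∃ p : (BaseChange (v.adicCompletion F) a b)ˣ,
      trd (p : BaseChange (v.adicCompletion F) a b) = 0 ∧
      Valued.v (nrd (p : BaseChange (v.adicCompletion F) a b)) = exp (-1 : ℤ) := by
  obtain ⟨ϖ, hϖ, hv⟩ := exists_uniformizer_integers v
  obtain ⟨p, u, ht, hn⟩ := exists_pure_uniformizer two_ne_zero
    (by simpa using ha) (by simpa using hb) hmax hϖ
  have hn' : Valued.v (nrd p) = exp (-1 : ℤ) := by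
    have hu := HeightOneSpectrum.adicCompletionIntegers.isUnit_iff_valued_eq_one.mp u.isUnit
    rw [hn, map_mul, map_mul]
    change Valued.v ((u : v.adicCompletionIntegers F) : v.adicCompletion F) *
      Valued.v (ϖ : v.adicCompletion F) = _
    rw [hu, hv, one_mul]
  have h0 : nrd p ≠ 0 := by
    intro h; rw [h, map_zero] at hn'; exact exp_ne_zero hn'.symm
  obtain ⟨p, rfl⟩ := isUnit_of_nrd_ne_zero h0
  exact ⟨p, ht, hn'⟩

end LocalOrder

/-! ### Ideles of B and translates of local orders. -/

section Translates

open WithZero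

variable {F : Type*} [Field F] [NumberField F] {a b : F}

/-- The translate `α O_v`. -/
def localTranslate (v : HeightOneSpectrum (𝓞 F)) (O : Subalgebra (𝓞 F) ℍ[F, a, b])
    (α : (BaseChange (v.adicCompletion F) a b)ˣ) :
    Submodule (v.adicCompletionIntegers F) (BaseChange (v.adicCompletion F) a b) :=
  (completion v (Subalgebra.toSubmodule O)).map (LinearMap.mulLeft (v.adicCompletionIntegers F)
    (α : BaseChange (v.adicCompletion F) a b))

variable {v : HeightOneSpectrum (𝓞 F)} {O : Subalgebra (𝓞 F) ℍ[F, a, b]}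

theorem mem_localTranslate {α : (BaseChange (v.adicCompletion F) a b)ˣ}
    {z : BaseChange (v.adicCompletion F) a b} :
    z ∈ localTranslate v O α ↔ ↑α⁻¹ * z ∈ completionOrder v O := by
  rw [mem_completionOrder_iff]
  constructor
  · rintro ⟨y, hy, rfl⟩
    simpa using hy
  · intro h
    exact ⟨_, h, by simp⟩

theorem self_mem_localTranslate (α : (BaseChange (v.adicCompletion F) a b)ˣ) :
    (α : BaseChange (v.adicCompletion F) a b) ∈ localTranslate v O α := by
  rw [mem_localTranslate, Units.inv_mul]; exact one_mem _

theorem localTranslate_one : localTranslate v O 1 = completion v (Subalgebra.toSubmodule O) := by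
  ext z
  rw [mem_localTranslate, inv_one, Units.val_one, one_mul, mem_completionOrder_iff]

theorem localTranslate_eq_iff {α β : (BaseChange (v.adicCompletion F) a b)ˣ} :
    localTranslate v O α = localTranslate v O β ↔ α⁻¹ * β ∈ localUnits v O := by
  constructor
  · intro h
    rw [mem_localUnits]
    constructor
    · rw [Units.val_mul, ← mem_localTranslate, h]; exact self_mem_localTranslate β
    · rw [mul_inv_rev, inv_inv, Units.val_mul, ← mem_localTranslate, ← h]
      exact self_mem_localTranslate α
  · intro h
    obtain ⟨h1, h2⟩ := mem_localUnits.mp h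
    ext z
    rw [mem_localTranslate, mem_localTranslate]
    constructor
    · intro hz
      have := mul_mem h2 hz
      rwa [mul_inv_rev, inv_inv, Units.val_mul, ← mul_assoc, Units.mul_inv_cancel_right] at this
    · intro hz
      have := mul_mem h1 hz
      rwa [Units.val_mul, ← mul_assoc, Units.mul_inv_cancel_right] at this

theorem completion_leftMul (γ : ℍ[F, a, b]ˣ) (I : Submodule (𝓞 F) ℍ[F, a, b]) :
    completion v (leftMul γ I) = (completion v I).map
      (LinearMap.mulLeft (v.adicCompletionIntegers F)
        (toBaseChange (v.adicCompletion F) (γ : ℍ[F, a, b]))) := by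
  rw [completion, completion, Submodule.map_span]
  congr 1
  ext z
  constructor
  · rintro ⟨_, ⟨x, hx, rfl⟩, rfl⟩
    exact ⟨_, ⟨x, hx, rfl⟩, by simp⟩
  · rintro ⟨_, ⟨x, hx, rfl⟩, rfl⟩
    exact ⟨_, ⟨x, hx, rfl⟩, by simp⟩

theorem completion_leftMul_of_eq {γ : ℍ[F, a, b]ˣ} {I : Submodule (𝓞 F) ℍ[F, a, b]}
    {α : (BaseChange (v.adicCompletion F) a b)ˣ} (h : completion v I = localTranslate v O α) :
    completion v (leftMul γ I) = localTranslate v O (diagUnits a b γ v * α) := by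
  rw [completion_leftMul, h]
  ext z
  rw [mem_localTranslate]
  constructor
  · rintro ⟨y, hy, rfl⟩
    rw [mul_inv_rev, Units.val_mul, mul_assoc, LinearMap.mulLeft_apply, ← coe_diagUnits,
      Units.inv_mul_cancel_left]
    exact mem_localTranslate.mp hy
  · intro hz
    rw [mul_inv_rev, Units.val_mul, mul_assoc] at hz
    refine ⟨_, mem_localTranslate.mpr hz, ?_⟩
    rw [LinearMap.mulLeft_apply, ← coe_diagUnits, Units.mul_inv_cancel_left]

theorem span_leftMul (γ : ℍ[F, a, b]ˣ) {I : Submodule (𝓞 F) ℍ[F, a, b]}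
    (hI : Submodule.span F (I : Set ℍ[F, a, b]) = ⊤) :
    Submodule.span F (leftMul γ I : Set ℍ[F, a, b]) = ⊤ := by
  refine eq_top_iff.mpr fun x _ => ?_
  have h1 : (↑γ⁻¹ : ℍ[F, a, b]) * x ∈ Submodule.span F (I : Set ℍ[F, a, b]) := hI ▸ Submodule.mem_top
  have h2 := Submodule.mem_map_of_mem (f := LinearMap.mulLeft F (γ : ℍ[F, a, b])) h1
  rw [Submodule.map_span, LinearMap.mulLeft_apply, Units.mul_inv_cancel_left] at h2
  exact h2

theorem fg_leftMul (γ : ℍ[F, a, b]ˣ) {I : Submodule (𝓞 F) ℍ[F, a, b]} (hI : I.FG) :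
    (leftMul γ I).FG := hI.map _

/-- The ideles of `B`: the elements of `∏ v, B_vˣ` that lie in `O_vˣ` for almost all `v`. -/
def ideles (O : Subalgebra (𝓞 F) ℍ[F, a, b]) :
    Subgroup (∀ v : HeightOneSpectrum (𝓞 F), (BaseChange (v.adicCompletion F) a b)ˣ) where
  carrier := {x | {v | x v ∉ localUnits v O}.Finite}
  one_mem' := by simp [one_mem]
  mul_mem' {x y} hx hy := (hx.union hy).subset fun v hv => by
    by_contra h
    simp only [Set.mem_union, Set.mem_ofPred_eq, not_or, not_not] at h hv
    exact hv (mul_mem h.1 h.2)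
  inv_mem' {x} hx := hx.subset fun v hv => by
    simpa using hv

theorem mem_ideles {x : ∀ v : HeightOneSpectrum (𝓞 F), (BaseChange (v.adicCompletion F) a b)ˣ} :
    x ∈ ideles O ↔ {v | x v ∉ localUnits v O}.Finite := Iff.rfl

theorem adelicUnits_le_ideles (O : Subalgebra (𝓞 F) ℍ[F, a, b]) : adelicUnits O ≤ ideles O := by
  intro x hx
  rw [mem_ideles]
  convert Set.finite_empty
  ext v
  simpa using hx v (Set.mem_univ v)

theorem mem_adelicUnits {x : ∀ v : HeightOneSpectrum (𝓞 F), (BaseChange (v.adicCompletion F) a b)ˣ} :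
    x ∈ adelicUnits O ↔ ∀ v, x v ∈ localUnits v O := by
  simp [adelicUnits, Subgroup.mem_pi]

theorem finite_completion_ne {I J : Submodule (𝓞 F) ℍ[F, a, b]} (hI : I.FG) (hJ : J.FG)
    (hI' : Submodule.span F (I : Set ℍ[F, a, b]) = ⊤)
    (hJ' : Submodule.span F (J : Set ℍ[F, a, b]) = ⊤) :
    {v : HeightOneSpectrum (𝓞 F) | completion v I ≠ completion v J}.Finite := by
  refine ((isAdelicLattice_completion hI hI').2.union
    (isAdelicLattice_completion hJ hJ').2).subset fun v hv => ?_
  by_contra h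
  simp only [Set.mem_union, Set.mem_ofPred_eq, not_or, not_not] at h
  exact hv (h.1.trans h.2.symm)

theorem finite_completionOrder_ne {O O' : Subalgebra (𝓞 F) ℍ[F, a, b]} (hO : IsOrder O)
    (hO' : IsOrder O') :
    {v : HeightOneSpectrum (𝓞 F) | completionOrder v O ≠ completionOrder v O'}.Finite := by
  refine (finite_completion_ne hO.1 hO'.1 hO.2 hO'.2).subset fun v hv h => hv ?_
  rw [← toSubmodule_completionOrder, ← toSubmodule_completionOrder] at h
  exact Subalgebra.toSubmodule_injective h

/-- Two orders have the same completion at almost all primes; by symmetry the idele group does not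
depend on the order. -/
theorem ideles_le {O O' : Subalgebra (𝓞 F) ℍ[F, a, b]} (hO : IsOrder O) (hO' : IsOrder O') :
    ideles O ≤ ideles O' := by
  intro x hx
  refine (hx.union (finite_completionOrder_ne hO hO')).subset fun v hv => ?_
  by_contra h
  simp only [Set.mem_union, Set.mem_ofPred_eq, not_or, not_not] at h hv
  exact hv (by rw [localUnits, ← h.2]; exact h.1)

theorem ideles_eq {O O' : Subalgebra (𝓞 F) ℍ[F, a, b]} (hO : IsOrder O) (hO' : IsOrder O') :
    ideles O = ideles O' := le_antisymm (ideles_le hO hO') (ideles_le hO' hO)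

theorem mem_ideles_of_completion_eq (hO : IsOrder O) {I : Submodule (𝓞 F) ℍ[F, a, b]} (hI : I.FG)
    (hI' : Submodule.span F (I : Set ℍ[F, a, b]) = ⊤)
    {x : ∀ v : HeightOneSpectrum (𝓞 F), (BaseChange (v.adicCompletion F) a b)ˣ}
    (h : ∀ v, completion v I = localTranslate v O (x v)) : x ∈ ideles O := by
  refine (finite_completion_ne hI hO.1 hI' hO.2).subset fun v hv hv' => hv ?_
  rw [h, ← localTranslate_one] at hv'
  have := localTranslate_eq_iff.mp hv'.symm
  rwa [inv_one, one_mul] at this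

theorem diagUnits_mem_ideles (hO : IsOrder O) (γ : ℍ[F, a, b]ˣ) : diagUnits a b γ ∈ ideles O := by
  refine mem_ideles_of_completion_eq hO (fg_leftMul γ hO.1) (span_leftMul γ hO.2) fun v => ?_
  rw [completion_leftMul_of_eq localTranslate_one.symm, mul_one]

theorem isAdelicLattice_localTranslate (hO : IsOrder O)
    {x : ∀ v : HeightOneSpectrum (𝓞 F), (BaseChange (v.adicCompletion F) a b)ˣ}
    (hx : x ∈ ideles O) : IsAdelicLattice fun v => localTranslate v O (x v) := by
  obtain ⟨h1, h2⟩ := isAdelicLattice_completion hO.1 hO.2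
  refine ⟨fun v => ?_, (h2.union hx).subset fun v hv => ?_⟩
  · obtain ⟨n, hn, hn'⟩ := h1 v
    obtain ⟨m, hm⟩ := exists_map_ball_le (LinearMap.mulLeft (v.adicCompletion F)
      (x v : BaseChange (v.adicCompletion F) a b))
    obtain ⟨k, hk⟩ := exists_map_ball_le (LinearMap.mulLeft (v.adicCompletion F)
      (↑(x v)⁻¹ : BaseChange (v.adicCompletion F) a b))
    refine ⟨n + m + k, fun z hz => ?_, ?_⟩
    · rw [mem_localTranslate, mem_completionOrder_iff]
      exact hn (ball_mono (by push_cast; omega) (hk _ _ hz))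
    · rintro _ ⟨y, hy, rfl⟩
      exact ball_mono (by push_cast; omega) (hm _ _ (hn' hy))
  · by_contra h
    simp only [Set.mem_union, Set.mem_ofPred_eq, not_or, not_not] at h
    refine hv (Eq.trans ?_ h.1)
    change localTranslate v O (x v) = _
    rw [← localTranslate_one, localTranslate_eq_iff, mul_one]
    exact inv_mem h.2

end Translates

/-! ### The class set as a set of double cosets. -/

section DoubleCosets

open WithZero

variable {F : Type*} [Field F] [NumberField F] {a b : F} {O : Subalgebra (𝓞 F) ℍ[F, a, b]}

theorem mem_scalarUnits_commute {z : ℍ[F, a, b]ˣ} (hz : z ∈ scalarUnits a b) (x : ℍ[F, a, b]) :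
    z * x = x * z := by
  obtain ⟨r, rfl⟩ := hz
  exact Algebra.commutes (r : 𝓞 F) x

instance scalarUnits_normal : (scalarUnits a b).Normal where
  conj_mem z hz g := by
    have : g * z * g⁻¹ = z := by
      ext1
      rw [Units.val_mul, Units.val_mul, ← mem_scalarUnits_commute hz, mul_assoc, Units.mul_inv,
        mul_one]
    rwa [this]

theorem diagUnits_scalar_commute {z : ℍ[F, a, b]ˣ} (hz : z ∈ scalarUnits a b)
    (g : ∀ v : HeightOneSpectrum (𝓞 F), (BaseChange (v.adicCompletion F) a b)ˣ) :
    diagUnits a b z * g = g * diagUnits a b z := by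
  obtain ⟨r, rfl⟩ := hz
  ext1 v
  ext1
  rw [Pi.mul_apply, Pi.mul_apply, Units.val_mul, Units.val_mul, coe_diagUnits]
  have : toBaseChange (v.adicCompletion F) ((Units.map (algebraMap (𝓞 F) ℍ[F, a, b] :
      𝓞 F →* ℍ[F, a, b]) r : ℍ[F, a, b]ˣ) : ℍ[F, a, b]) =
      algebraMap (v.adicCompletion F) (BaseChange (v.adicCompletion F) a b)
        (algebraMap F (v.adicCompletion F) (algebraMap (𝓞 F) F r)) :=
    toBaseChange_algebraMap (algebraMap (𝓞 F) F r)
  rw [this]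
  exact Algebra.commutes _ _

theorem mem_localUnits_of_mem {z : ℍ[F, a, b]ˣ} (h1 : (z : ℍ[F, a, b]) ∈ O)
    (h2 : (↑z⁻¹ : ℍ[F, a, b]) ∈ O) : diagUnits a b z ∈ adelicUnits O := by
  rw [mem_adelicUnits]
  intro v
  rw [mem_localUnits, mem_completionOrder_iff, mem_completionOrder_iff, ← Pi.inv_apply, ← map_inv]
  exact ⟨toBaseChange_mem_completion h1, toBaseChange_mem_completion h2⟩

theorem diagUnits_scalar_mem {z : ℍ[F, a, b]ˣ} (hz : z ∈ scalarUnits a b) :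
    diagUnits a b z ∈ adelicUnits O := by
  obtain ⟨r, rfl⟩ := hz
  refine mem_localUnits_of_mem (O.algebraMap_mem (r : 𝓞 F)) ?_
  rw [← map_inv]
  exact O.algebraMap_mem ((r⁻¹ : (𝓞 F)ˣ) : 𝓞 F)

/-- An idele that locally generates `I`. -/
def LPIdeal.idele (I : LPIdeal O) (v : HeightOneSpectrum (𝓞 F)) :
    (BaseChange (v.adicCompletion F) a b)ˣ := (I.locallyPrincipal v).choose

theorem LPIdeal.completion_eq (I : LPIdeal O) (v : HeightOneSpectrum (𝓞 F)) :
    completion v I.carrier = localTranslate v O (I.idele v) := (I.locallyPrincipal v).choose_spec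

/-- The ideal locally generated by an idele. -/
def LPIdeal.ofIdele (hO : IsOrder O)
    {x : ∀ v : HeightOneSpectrum (𝓞 F), (BaseChange (v.adicCompletion F) a b)ˣ}
    (hx : x ∈ ideles O) : LPIdeal O where
  carrier := globalLattice fun v => localTranslate v O (x v)
  fg := (isAdelicLattice_localTranslate hO hx).fg_globalLattice
  span_eq_top := (isAdelicLattice_localTranslate hO hx).span_globalLattice
  mul_mem y hy z hz v := by
    rw [map_mul, mem_localTranslate, ← mul_assoc]
    exact Subalgebra.mul_mem _ (mem_localTranslate.mp (hy v))
      (mem_completionOrder_iff.mpr (toBaseChange_mem_completion hz))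
  locallyPrincipal v :=
    ⟨x v, (isAdelicLattice_localTranslate hO hx).completion_globalLattice v⟩

theorem LPIdeal.completion_ofIdele (hO : IsOrder O)
    {x : ∀ v : HeightOneSpectrum (𝓞 F), (BaseChange (v.adicCompletion F) a b)ˣ}
    (hx : x ∈ ideles O) (v : HeightOneSpectrum (𝓞 F)) :
    completion v (LPIdeal.ofIdele hO hx).carrier = localTranslate v O (x v) :=
  (isAdelicLattice_localTranslate hO hx).completion_globalLattice v

theorem cosetMk_eq_iff
    {x y : ∀ v : HeightOneSpectrum (𝓞 F), (BaseChange (v.adicCompletion F) a b)ˣ} :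
    CosetSpace.mk (diagUnits a b) (adelicUnits O) x =
      CosetSpace.mk (diagUnits a b) (adelicUnits O) y ↔
    ∀ v, localTranslate v O (x v) = localTranslate v O (y v) := by
  rw [CosetSpace.mk_eq_iff, mem_adelicUnits]
  exact forall_congr' fun v => localTranslate_eq_iff.symm

/-- Lattices are determined by their completions, so γI = J can be tested at every prime. This one
equivalence gives both the injectivity of `doubleCoset` and the identification of stabilizers with
unit groups of left orders. -/
theorem leftMul_eq_iff_smul_eq {I J : LPIdeal O} (γ : ℍ[F, a, b]ˣ)
    {x y : ∀ v : HeightOneSpectrum (𝓞 F), (BaseChange (v.adicCompletion F) a b)ˣ}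
    (hx : ∀ v, completion v I.carrier = localTranslate v O (x v))
    (hy : ∀ v, completion v J.carrier = localTranslate v O (y v)) :
    leftMul γ I.carrier = J.carrier ↔
      γ • CosetSpace.mk (diagUnits a b) (adelicUnits O) x =
        CosetSpace.mk (diagUnits a b) (adelicUnits O) y := by
  rw [CosetSpace.smul_mk, cosetMk_eq_iff]
  constructor
  · intro h v
    rw [← hy v, ← h, completion_leftMul_of_eq (hx v)]; rfl
  · intro h
    refine eq_of_completion_eq (span_leftMul γ I.span_eq_top) J.span_eq_top fun v => ?_
    rw [hy v, ← h v, completion_leftMul_of_eq (hx v)]; rfl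

/-- The double coset of a class of ideals. -/
def doubleCoset : Cls O → MulAction.orbitRel.Quotient ℍ[F, a, b]ˣ
    (CosetSpace (diagUnits a b) (adelicUnits O)) :=
  Quotient.lift (fun I => Quotient.mk _ (CosetSpace.mk _ _ I.idele)) (by
    rintro I J ⟨γ, h⟩
    exact (Quotient.sound (MulAction.orbitRel_apply.mpr
      ⟨γ, (leftMul_eq_iff_smul_eq γ I.completion_eq J.completion_eq).mp h⟩)).symm)

theorem doubleCoset_mk {I : LPIdeal O}
    {x : ∀ v : HeightOneSpectrum (𝓞 F), (BaseChange (v.adicCompletion F) a b)ˣ}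
    (hx : ∀ v, completion v I.carrier = localTranslate v O (x v)) :
    doubleCoset (Cls.mk I) = Quotient.mk _ (CosetSpace.mk (diagUnits a b) (adelicUnits O) x) := by
  change Quotient.mk _ _ = _
  congr 1
  rw [cosetMk_eq_iff]
  exact fun v => (I.completion_eq v).symm.trans (hx v)

theorem doubleCoset_injective :
    Function.Injective (doubleCoset : Cls O → _) := by
  intro c d
  induction c using Quotient.inductionOn with | _ I
  induction d using Quotient.inductionOn with | _ J
  intro h
  obtain ⟨γ, hγ⟩ := MulAction.orbitRel_apply.mp (Quotient.exact h.symm)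
  exact Quotient.sound ⟨γ, (leftMul_eq_iff_smul_eq γ I.completion_eq J.completion_eq).mpr hγ⟩

theorem leftMul_eq_self_iff (γ : ℍ[F, a, b]ˣ) (I : Submodule (𝓞 F) ℍ[F, a, b]) :
    leftMul γ I = I ↔ γ ∈ (leftOrder I).toSubmonoid.units := by
  rw [Submonoid.mem_units_iff]
  constructor
  · intro h
    constructor
    · intro x hx
      rw [← h, mem_leftMul, Units.inv_mul_cancel_left]; exact hx
    · intro x hx
      rw [← h, mem_leftMul] at hx; exact hx
  · rintro ⟨h1, h2⟩
    ext x
    rw [mem_leftMul]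
    refine ⟨fun h => ?_, fun h => h2 x h⟩
    have := h1 _ h
    rwa [Units.mul_inv_cancel_left] at this

/-- The stabilizer in Bˣ of the coset of an idele generating I is O_L(I)ˣ. -/
theorem classMass_eq_orbitWeight (c : Cls O) :
    classMass c = orbitWeight (scalarUnits a b) (doubleCoset c) := by
  induction c using Quotient.inductionOn with | _ I
  change 1 / (unitIndex I.carrier : ℝ≥0∞) = 1 / (((scalarUnits a b).relIndex
    (MulAction.stabilizer ℍ[F, a, b]ˣ
      (CosetSpace.mk (diagUnits a b) (adelicUnits O) I.idele)) : ℕ) : ℝ≥0∞)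
  have : (leftOrder I.carrier).toSubmonoid.units = MulAction.stabilizer ℍ[F, a, b]ˣ
      (CosetSpace.mk (diagUnits a b) (adelicUnits O) I.idele) := by
    ext γ
    rw [MulAction.mem_stabilizer_iff, ← leftMul_eq_self_iff,
      leftMul_eq_iff_smul_eq γ I.completion_eq I.completion_eq]
  rw [unitIndex, this]

/-- Masses of sets of classes are masses of sets of double cosets. -/
theorem mass_eq_cosetMass (hO : IsOrder O) {X : Set (Cls O)}
    {Ω : Set (∀ v : HeightOneSpectrum (𝓞 F), (BaseChange (v.adicCompletion F) a b)ˣ)}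
    (hΩ : ∀ x ∈ Ω, x ∈ ideles O)
    (hX : ∀ (I : LPIdeal O)
      (x : ∀ v : HeightOneSpectrum (𝓞 F), (BaseChange (v.adicCompletion F) a b)ˣ),
      (∀ v, completion v I.carrier = localTranslate v O (x v)) → (Cls.mk I ∈ X ↔ x ∈ Ω)) :
    mass X = cosetMass (diagUnits a b) (scalarUnits a b) (adelicUnits O) Ω := by
  rw [mass, tsum_subtype X classMass, cosetMass, orbitMass,
    ← (doubleCoset_injective (O := O)).tsum_eq]
  · refine tsum_congr fun c => ?_
    have hiff : c ∈ X ↔ doubleCoset c ∈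
        {o : MulAction.orbitRel.Quotient ℍ[F, a, b]ˣ
          (CosetSpace (diagUnits a b) (adelicUnits O)) |
          ∃ x ∈ CosetSpace.mk (diagUnits a b) (adelicUnits O) '' Ω, Quotient.mk _ x = o} := by
      induction c using Quotient.inductionOn with | _ I
      constructor
      · intro h
        exact ⟨_, ⟨_, (hX I _ I.completion_eq).mp h, rfl⟩, rfl⟩
      · rintro ⟨_, ⟨x, hx, rfl⟩, h⟩
        have hJ := LPIdeal.completion_ofIdele hO (hΩ x hx)
        have h1 := (hX _ _ hJ).mpr hx
        have h2 : Cls.mk (LPIdeal.ofIdele hO (hΩ x hx)) = Cls.mk I :=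
          doubleCoset_injective ((doubleCoset_mk hJ).trans h)
        rwa [h2] at h1
    by_cases hc : c ∈ X
    · rw [Set.indicator_of_mem hc, Set.indicator_of_mem (hiff.mp hc), classMass_eq_orbitWeight]
    · rw [Set.indicator_of_notMem hc, Set.indicator_of_notMem (fun h => hc (hiff.mpr h))]
  -- The coset space is formed from the full product of the groups B_vˣ, so not every orbit comes
  -- from an ideal. The orbits that contribute meet Ω, whose members are ideles and therefore
  -- generate ideals.
  · intro o ho
    have := Set.mem_of_indicator_ne_zero ho
    obtain ⟨_, ⟨x, hx, rfl⟩, rfl⟩ := this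
    exact ⟨_, doubleCoset_mk (LPIdeal.completion_ofIdele hO (hΩ x hx))⟩

theorem mass_univ_eq (hO : IsOrder O) : mass (Set.univ : Set (Cls O)) =
    cosetMass (diagUnits a b) (scalarUnits a b) (adelicUnits O) (ideles O : Set _) :=
  mass_eq_cosetMass hO (fun _ h => h) fun I _ hx => by
    simpa using mem_ideles_of_completion_eq hO I.fg I.span_eq_top hx

end DoubleCosets

/-! ### The reduced norm of an ideal, prime by prime. -/

section ReducedNorm

open WithZero

variable {F : Type*} [Field F] [NumberField F] {a b : F} {O : Subalgebra (𝓞 F) ℍ[F, a, b]}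

/-- The fractional ideal generated by the reduced norm of an idele. -/
theorem exists_ideal_of_idele (hO : IsOrder O)
    {x : ∀ v : HeightOneSpectrum (𝓞 F), (BaseChange (v.adicCompletion F) a b)ˣ}
    (hx : x ∈ ideles O) : ∃ I : (FractionalIdeal (𝓞 F)⁰ F)ˣ, ∀ v,
      Valued.v (nrd (x v : BaseChange (v.adicCompletion F) a b)) =
        exp (-FractionalIdeal.count F v (I : FractionalIdeal (𝓞 F)⁰ F)) := by
  choose n hn using fun v => valued_eq_exp_log v (nrd_unit_ne_zero (x v))
  obtain ⟨I, hI⟩ := exists_fractionalIdeal_count (F := F) (fun v => -n v) (hx.subset fun v hv hu => hv (by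
    have := valued_nrd_localUnits hO hu
    rw [hn, ← exp_zero, exp_inj] at this
    rw [this, neg_zero]))
  exact ⟨I, fun v => by rw [hn, hI, neg_neg]⟩

variable {I : LPIdeal O}
  {x : ∀ v : HeightOneSpectrum (𝓞 F), (BaseChange (v.adicCompletion F) a b)ˣ}

/-- Norms from I_v = x_v O_v are integral multiples of nrd x_v. Conversely, an element y of I close
to x_v has a norm of the same valuation at v, so f is a multiple of nrd y up to a denominator prime
to v, and `mem_of_locally` concludes. -/
theorem mem_nrdIdeal_iff (hO : IsOrder O)
    (hx : ∀ v, completion v I.carrier = localTranslate v O (x v)) {f : F} :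
    f ∈ nrdIdeal I.carrier ↔
      ∀ v, v.valuation F f ≤ Valued.v (nrd (x v : BaseChange (v.adicCompletion F) a b)) := by
  constructor
  · intro hf v
    induction hf using Submodule.span_induction with
    | mem f h =>
      obtain ⟨y, hy, rfl⟩ := h
      have h1 : toBaseChange (v.adicCompletion F) y ∈ localTranslate v O (x v) :=
        hx v ▸ toBaseChange_mem_completion hy
      have h2 := valued_nrd_le_one hO (mem_localTranslate.mp h1)
      rw [map_mul, map_mul, nrd_unit_inv, map_inv₀, nrd_toBaseChange, valued_algebraMap,
        inv_mul_le_one₀ (zero_lt_iff.mpr ((Valuation.ne_zero_iff _).mpr (nrd_unit_ne_zero _)))]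
        at h2
      exact h2
    | zero => simp
    | add f g _ _ hf hg => exact (Valuation.map_add _ _ _).trans (max_le hf hg)
    | smul r f _ hf =>
      rw [Algebra.smul_def, map_mul]
      exact (mul_le_of_le_one_left' (v.valuation_le_one r)).trans hf
  · intro hf
    refine mem_of_locally fun v => ?_
    obtain ⟨y, hy, u, hu, hyu⟩ := exists_mem_eq_mul_localUnits hO (x := x v)
      (hx v ▸ self_mem_localTranslate (x v))
    have hv : v.valuation F (nrd y) =
        Valued.v (nrd (x v : BaseChange (v.adicCompletion F) a b)) := by
      rw [← valued_algebraMap, ← nrd_toBaseChange, hyu, map_mul, map_mul,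
        valued_nrd_localUnits hO hu, one_mul]
    have hy0 : nrd y ≠ 0 := by
      intro h
      rw [h, map_zero] at hv
      exact (Valuation.ne_zero_iff _).mpr (nrd_unit_ne_zero (x v)) hv.symm
    have h1 : v.valuation F (f / nrd y) ≤ 1 := by
      rw [map_div₀, div_le_one₀ (zero_lt_iff.mpr ((Valuation.ne_zero_iff _).mpr hy0)), hv]
      exact hf v
    obtain ⟨n, d, h⟩ := HeightOneSpectrum.exists_primeCompl_mul_eq_of_integer v _ h1
    refine ⟨d, d.2, ?_⟩
    have h2 : (d : 𝓞 F) • f = n • nrd y := by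
      rw [Algebra.smul_def, Algebra.smul_def, ← h]
      field_simp
    rw [h2]
    exact Submodule.smul_mem _ _ (Submodule.subset_span ⟨y, hy, rfl⟩)

theorem coe_eq_nrdIdeal_iff (hO : IsOrder O)
    (hx : ∀ v, completion v I.carrier = localTranslate v O (x v))
    (𝔞 : (FractionalIdeal (𝓞 F)⁰ F)ˣ) :
    ((𝔞 : FractionalIdeal (𝓞 F)⁰ F) : Submodule (𝓞 F) F) = nrdIdeal I.carrier ↔
      ∀ v, Valued.v (nrd (x v : BaseChange (v.adicCompletion F) a b)) =
        exp (-FractionalIdeal.count F v (𝔞 : FractionalIdeal (𝓞 F)⁰ F)) := by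
  have key : ∀ 𝔟 : (FractionalIdeal (𝓞 F)⁰ F)ˣ,
      (∀ v, Valued.v (nrd (x v : BaseChange (v.adicCompletion F) a b)) =
        exp (-FractionalIdeal.count F v (𝔟 : FractionalIdeal (𝓞 F)⁰ F))) →
      ((𝔟 : FractionalIdeal (𝓞 F)⁰ F) : Submodule (𝓞 F) F) = nrdIdeal I.carrier := by
    intro 𝔟 h
    ext f
    rw [mem_nrdIdeal_iff hO hx, FractionalIdeal.mem_coe, mem_fractionalIdeal_iff 𝔟.ne_zero]
    simp only [h]
  refine ⟨fun h => ?_, key 𝔞⟩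
  obtain ⟨𝔟, h𝔟⟩ := exists_ideal_of_idele hO
    (mem_ideles_of_completion_eq hO I.fg I.span_eq_top hx)
  have : 𝔞 = 𝔟 := Units.ext (FractionalIdeal.coeToSubmodule_injective (h.trans (key 𝔟 h𝔟).symm))
  rw [this]; exact h𝔟

/-- The ideles that correspond to the classes in `fibre O S β`. -/
def ideleFibre (O : Subalgebra (𝓞 F) ℍ[F, a, b]) (S : Finset (HeightOneSpectrum (𝓞 F)))
    (β : ClG O S) : Set (∀ v : HeightOneSpectrum (𝓞 F), (BaseChange (v.adicCompletion F) a b)ˣ) :=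
  {x | x ∈ ideles O ∧ ∃ γ : ℍ[F, a, b]ˣ, (∀ v ∈ S, diagUnits a b γ v * x v ∈ localUnits v O) ∧
    ∃ 𝔞 : Idl S, (∀ v, Valued.v (nrd ((diagUnits a b γ v * x v :
      (BaseChange (v.adicCompletion F) a b)ˣ) : BaseChange (v.adicCompletion F) a b)) =
      exp (-FractionalIdeal.count F v
        ((𝔞 : (FractionalIdeal (𝓞 F)⁰ F)ˣ) : FractionalIdeal (𝓞 F)⁰ F))) ∧
      (QuotientGroup.mk 𝔞 : ClG O S) = β}

theorem mk_mem_fibre_iff (hO : IsOrder O) {S : Finset (HeightOneSpectrum (𝓞 F))} {β : ClG O S}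
    (hx : ∀ v, completion v I.carrier = localTranslate v O (x v)) :
    Cls.mk I ∈ fibre O S β ↔ x ∈ ideleFibre O S β := by
  have hxi := mem_ideles_of_completion_eq hO I.fg I.span_eq_top hx
  have hloc : ∀ {v : HeightOneSpectrum (𝓞 F)} {α : (BaseChange (v.adicCompletion F) a b)ˣ},
      localTranslate v O α = completion v (Subalgebra.toSubmodule O) ↔ α ∈ localUnits v O := by
    intro v α
    rw [← localTranslate_one, eq_comm, localTranslate_eq_iff, inv_one, one_mul]
  constructor
  · rintro ⟨J, hJI, hJS, 𝔞, h𝔞, rfl⟩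
    obtain ⟨γ, hγ⟩ := Quotient.exact hJI.symm
    have hJ : ∀ v, completion v J.carrier = localTranslate v O ((diagUnits a b γ * x) v) := by
      intro v
      rw [← hγ, completion_leftMul_of_eq (hx v)]; rfl
    refine ⟨hxi, γ, fun v hv => ?_, 𝔞, (coe_eq_nrdIdeal_iff hO hJ _).mp h𝔞, rfl⟩
    rw [← hloc]
    exact (hJ v).symm.trans (hJS v hv)
  · rintro ⟨-, γ, hγS, 𝔞, h𝔞, rfl⟩
    have hy : diagUnits a b γ * x ∈ ideles O := mul_mem (diagUnits_mem_ideles hO γ) hxi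
    have hJ := LPIdeal.completion_ofIdele hO hy
    refine ⟨LPIdeal.ofIdele hO hy, ?_, fun v hv => ?_, 𝔞, (coe_eq_nrdIdeal_iff hO hJ _).mpr h𝔞, rfl⟩
    · refine doubleCoset_injective ?_
      rw [doubleCoset_mk hx, doubleCoset_mk hJ]
      exact Quotient.sound (MulAction.orbitRel_apply.mpr ⟨γ, rfl⟩)
    · rw [hJ v]
      exact hloc.mpr (hγS v hv)

theorem mass_fibre_eq (hO : IsOrder O) (S : Finset (HeightOneSpectrum (𝓞 F))) (β : ClG O S) :
    mass (fibre O S β) =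
      cosetMass (diagUnits a b) (scalarUnits a b) (adelicUnits O) (ideleFibre O S β) :=
  mass_eq_cosetMass hO (fun _ hx => hx.1) fun _ _ hx => mk_mem_fibre_iff hO hx

end ReducedNorm

/-! ### Positivity of reduced norms. -/

section Definite

/-- Hamilton's quaternions have no zero divisors: for r ≥ 0 the factorization (x - √r)(x + √r) = 0
would make x a scalar. -/
theorem neg_of_algEquiv_quaternion {s t : ℝ} (e : ℍ[ℝ, s, t] ≃ₐ[ℝ] ℍ[ℝ])
    {x : ℍ[ℝ, s, t]} {r : ℝ} (hx : x * x = r • 1) (hx' : ∀ c : ℝ, x ≠ c • 1) : r < 0 := by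
  by_contra h
  push Not at h
  have h1 : (x - √r • 1) * (x + √r • 1) = 0 := by
    rw [sub_mul, mul_add, mul_add, hx]
    simp only [mul_smul_comm, smul_mul_assoc, mul_one, one_mul, smul_smul, Real.mul_self_sqrt h]
    abel
  have h2 := congrArg e h1
  rw [map_mul, map_zero, mul_eq_zero, EmbeddingLike.map_eq_zero_iff,
    EmbeddingLike.map_eq_zero_iff] at h2
  rcases h2 with h2 | h2
  · exact hx' _ (sub_eq_zero.mp h2)
  · refine hx' (-√r) ?_
    rw [neg_smul]; exact eq_neg_of_add_eq_zero_left h2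

/-- Both σ a and σ b are negative, so σ(nrd x) is a sum of squares with positive coefficients. Thus
norms from Bˣ satisfy the positivity condition in `FSO`. -/
theorem IsDefinite.nrd_pos {F : Type*} [Field F] {a b : F} (hB : IsDefinite a b)
    {x : ℍ[F, a, b]} (hx : nrd x ≠ 0) (σ : F →+* ℝ) : 0 < σ (nrd x) := by
  obtain ⟨e⟩ := hB σ
  have h1 : σ a < 0 := by
    refine neg_of_algEquiv_quaternion e (x := ⟨0, 1, 0, 0⟩) ?_ fun c h => ?_
    · ext <;> simp
    · simpa using congrArg QuaternionAlgebra.imI h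
  have h2 : σ b < 0 := by
    refine neg_of_algEquiv_quaternion e (x := ⟨0, 0, 1, 0⟩) ?_ fun c h => ?_
    · ext <;> simp
    · simpa using congrArg QuaternionAlgebra.imJ h
  have h3 : σ (nrd x) = (σ x.re) ^ 2 + (-σ a) * (σ x.imI) ^ 2 + (-σ b) * (σ x.imJ) ^ 2 +
      (σ a * σ b) * (σ x.imK) ^ 2 := by
    rw [nrd_apply]; simp only [map_add, map_sub, map_mul, map_pow]; ring
  have h4 := mul_pos_of_neg_of_neg h1 h2
  have h0 : 0 ≤ σ (nrd x) := by
    rw [h3]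
    have : 0 ≤ -σ a := by linarith
    have : 0 ≤ -σ b := by linarith
    positivity
  exact lt_of_le_of_ne h0 ((map_ne_zero σ).mpr hx).symm

end Definite

/-! ### Finiteness of Cl_{G(O)} R. -/

section ClassGroup

open WithZero

variable {F : Type*} [Field F] [NumberField F] {a b : F}

theorem exists_localUnits_nrd_eq_sq (v : HeightOneSpectrum (𝓞 F))
    (O : Subalgebra (𝓞 F) ℍ[F, a, b]) {s : v.adicCompletion F} (hs : Valued.v s = 1) :
    ∃ u ∈ localUnits v O, nrd (u : BaseChange (v.adicCompletion F) a b) = s ^ 2 := by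
  have hs0 : s ≠ 0 := by rintro rfl; simp at hs
  refine ⟨Units.map (algebraMap (v.adicCompletion F) (BaseChange (v.adicCompletion F) a b) :
    v.adicCompletion F →* BaseChange (v.adicCompletion F) a b) (Units.mk0 s hs0),
    mem_localUnits.mpr ⟨?_, ?_⟩, ?_⟩
  · exact (completionOrder v O).algebraMap_mem (⟨s, hs.le⟩ : v.adicCompletionIntegers F)
  · rw [← map_inv]
    have hs' : Valued.v s⁻¹ ≤ 1 := by rw [map_inv₀, hs, inv_one]
    have := (completionOrder v O).algebraMap_mem (⟨s⁻¹, hs'⟩ : v.adicCompletionIntegers F)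
    convert this using 1
    simp only [Units.coe_map, Units.val_inv_eq_inv_val, Units.val_mk0]
    rfl
  · simp [nrd_apply]

/-- Units that are close to each other differ by the reduced norm of a unit. -/
theorem exists_localUnits_nrd_eq_div (v : HeightOneSpectrum (𝓞 F))
    (O : Subalgebra (𝓞 F) ℍ[F, a, b]) {ϖ x y : v.adicCompletionIntegers F} (hϖ : Irreducible ϖ)
    (hx : IsUnit x) (hxy : y - x ∈ Ideal.span {4 * ϖ}) :
    ∃ u ∈ localUnits v O, nrd (u : BaseChange (v.adicCompletion F) a b) =
      (x : v.adicCompletion F)⁻¹ * (y : v.adicCompletion F) := by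
  obtain ⟨r, hr⟩ := Ideal.mem_span_singleton.mp hxy
  obtain ⟨x, rfl⟩ := hx
  have hm : -(ϖ * (r * ↑x⁻¹)) ∈ IsLocalRing.maximalIdeal (v.adicCompletionIntegers F) := by
    rw [neg_mem_iff, hϖ.maximalIdeal_eq]
    exact Ideal.mul_mem_right _ _ (Ideal.mem_span_singleton_self ϖ)
  -- Here y/x = 1 + 4ϖr/x, and (1 + 2z)² = 1 + 4(z² + z). Solving z² + z = ϖr/x by Hensel makes y/x
  -- the square of a unit, hence the norm of a scalar in O_vˣ.
  obtain ⟨z, hz⟩ := exists_root_of_henselian (α := 1) (β := 1) isUnit_one hm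
  have hsq : (1 + 2 * z) ^ 2 = ↑x⁻¹ * y := by
    have hy : y = x + 4 * ϖ * r := by rw [← hr]; ring
    rw [hy, mul_add, Units.inv_mul]
    linear_combination 4 * hz
  have hval : (x : v.adicCompletion F)⁻¹ =
      ((↑x⁻¹ : v.adicCompletionIntegers F) : v.adicCompletion F) := by
    refine inv_eq_of_mul_eq_one_left ?_
    have := congrArg (Subtype.val) (Units.inv_mul x)
    exact this
  have hx1 := HeightOneSpectrum.adicCompletionIntegers.isUnit_iff_valued_eq_one.mp x.isUnit
  rw [hval]
  have hsq' : (((1 + 2 * z : v.adicCompletionIntegers F)) : v.adicCompletion F) ^ 2 =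
      ((↑x⁻¹ : v.adicCompletionIntegers F) : v.adicCompletion F) * y := by
    exact_mod_cast congrArg Subtype.val hsq
  rw [← hsq']
  refine exists_localUnits_nrd_eq_sq v O ?_
  have hy : IsUnit (1 + 2 * z) := by
    have hz' : IsUnit (1 + ϖ * (4 * (r * ↑x⁻¹))) := by
      have : ϖ * (4 * (r * ↑x⁻¹)) ∈ IsLocalRing.maximalIdeal (v.adicCompletionIntegers F) := by
        rw [hϖ.maximalIdeal_eq]
        exact Ideal.mul_mem_right _ _ (Ideal.mem_span_singleton_self ϖ)
      by_contra h
      have h' : 1 + ϖ * (4 * (r * ↑x⁻¹)) ∈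
          IsLocalRing.maximalIdeal (v.adicCompletionIntegers F) :=
        (IsLocalRing.mem_maximalIdeal _).mpr h
      have h1 := sub_mem h' this
      rw [add_sub_cancel_right] at h1
      exact (Ideal.ne_top_iff_one _).mp (IsLocalRing.maximalIdeal.isMaximal _).ne_top h1
    have : (1 + 2 * z) ^ 2 = 1 + ϖ * (4 * (r * ↑x⁻¹)) := by linear_combination 4 * hz
    rw [← this] at hz'
    exact (isUnit_pow_iff two_ne_zero).mp hz'
  exact HeightOneSpectrum.adicCompletionIntegers.isUnit_iff_valued_eq_one.mp hy

variable {O : Subalgebra (𝓞 F) ℍ[F, a, b]} {S : Finset (HeightOneSpectrum (𝓞 F))}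

theorem mem_FSO {x : Fˣ} : x ∈ FSO O S ↔ (∀ σ : F →+* ℝ, 0 < σ (x : F)) ∧
    ∀ v ∈ S, ∃ u ∈ localUnits v O, nrd (u : BaseChange (v.adicCompletion F) a b) =
      algebraMap F (v.adicCompletion F) x := Iff.rfl

theorem mem_Idl {I : (FractionalIdeal (𝓞 F)⁰ F)ˣ} : I ∈ Idl S ↔
    ∀ v ∈ S, FractionalIdeal.count F v (I : FractionalIdeal (𝓞 F)⁰ F) = 0 := Iff.rfl

theorem toPrincipalIdeal_mem_Idl {x : Fˣ} :
    toPrincipalIdeal (𝓞 F) F x ∈ Idl S ↔ ∀ v ∈ S, v.valuation F (x : F) = 1 := by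
  rw [mem_Idl]
  refine forall₂_congr fun v _ => ?_
  rw [← count_toPrincipalIdeal, ← exp_zero, exp_inj, neg_eq_zero]

theorem valuation_eq_one_of_mem_FSO (hO : IsOrder O) {x : Fˣ} (hx : x ∈ FSO O S) :
    ∀ v ∈ S, v.valuation F (x : F) = 1 := by
  intro v hv
  obtain ⟨u, hu, h⟩ := hx.2 v hv
  rw [← valued_algebraMap, ← h, valued_nrd_localUnits hO hu]

theorem PIdl_le_Idl (hO : IsOrder O) : PIdl O S ≤ Idl S := by
  rintro _ ⟨x, hx, rfl⟩
  exact toPrincipalIdeal_mem_Idl.mpr (valuation_eq_one_of_mem_FSO hO hx)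

theorem relIndex_ne_zero_of_finite {G α : Type*} [Group G] [Finite α] {H K : Subgroup G}
    (φ : K → α) (h : ∀ x y : K, φ x = φ y → (x : G)⁻¹ * y ∈ H) : H.relIndex K ≠ 0 := by
  have : Finite (K ⧸ H.subgroupOf K) := by
    refine Finite.of_injective (fun q : K ⧸ H.subgroupOf K => φ q.out) fun p q hpq => ?_
    rw [← QuotientGroup.out_eq' p, ← QuotientGroup.out_eq' q, QuotientGroup.eq,
      Subgroup.mem_subgroupOf]
    exact h _ _ hpq
  exact Subgroup.index_ne_zero_of_finite

theorem four_mul_ne_zero {v : HeightOneSpectrum (𝓞 F)} {ϖ : v.adicCompletionIntegers F}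
    (hϖ : Irreducible ϖ) : 4 * ϖ ≠ 0 := by
  refine mul_ne_zero (fun h => ?_) hϖ.ne_zero
  have h' : (4 : v.adicCompletion F) = 0 := congrArg Subtype.val h
  have h4 : (4 : v.adicCompletion F) ≠ 0 := by
    have := Nat.cast_ne_zero (R := v.adicCompletion F).mpr (show 4 ≠ 0 by decide)
    exact_mod_cast this
  exact h4 h'

/-- Two elements that are units at S, with the same signs at all real embeddings and the same
residues modulo 4ϖ_v for v ∈ S, differ by an element of `FSO`. There are finitely many such data. -/
theorem relIndex_FSO_ne_zero (O : Subalgebra (𝓞 F) ℍ[F, a, b])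
    (S : Finset (HeightOneSpectrum (𝓞 F))) :
    (FSO O S).relIndex ((Idl S).comap (toPrincipalIdeal (𝓞 F) F)) ≠ 0 := by
  classical
  choose ϖ hϖ _ using fun v : HeightOneSpectrum (𝓞 F) => exists_uniformizer_integers v
  have hfin : ∀ v, Finite (v.adicCompletionIntegers F ⧸ Ideal.span {4 * ϖ v}) := fun v =>
    finite_quotient_integers v (four_mul_ne_zero (hϖ v))
  let E := (Idl S).comap (toPrincipalIdeal (𝓞 F) F)
  have hval : ∀ x : E, ∀ v : S,
      Valued.v (algebraMap F (v.1.adicCompletion F) ((x : Fˣ) : F)) = 1 := fun x v => by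
    rw [valued_algebraMap]
    exact toPrincipalIdeal_mem_Idl.mp x.2 v.1 v.2
  let red : E → ∀ v : S, v.1.adicCompletionIntegers F ⧸ Ideal.span {4 * ϖ v.1} :=
    fun x v => Ideal.Quotient.mk _ ⟨_, (hval x v).le⟩
  let sgn : E → (F →+* ℝ) → Bool := fun x σ => decide (0 < σ ((x : Fˣ) : F))
  refine relIndex_ne_zero_of_finite (fun x : E => (sgn x, red x)) fun x y hxy => ?_
  have hs : sgn x = sgn y := congrArg Prod.fst hxy
  have hr : red x = red y := congrArg Prod.snd hxy
  refine mem_FSO.mpr ⟨fun σ => ?_, fun v hv => ?_⟩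
  · have h3 : (0 < σ ((x : Fˣ) : F)) ↔ (0 < σ ((y : Fˣ) : F)) := by
      simpa [sgn] using congrFun hs σ
    have hx0 : σ ((x : Fˣ) : F) ≠ 0 := (map_ne_zero σ).mpr (Units.ne_zero _)
    have hy0 : σ ((y : Fˣ) : F) ≠ 0 := (map_ne_zero σ).mpr (Units.ne_zero _)
    rw [Units.val_mul, map_mul, Units.val_inv_eq_inv_val, map_inv₀]
    rcases lt_or_gt_of_ne hx0 with h | h
    · exact mul_pos_of_neg_of_neg (inv_lt_zero.mpr h)
        (lt_of_le_of_ne (not_lt.mp fun h' => lt_asymm h (h3.mpr h')) hy0)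
    · exact mul_pos (inv_pos.mpr h) (h3.mp h)
  · have h4 := Ideal.Quotient.eq.mp (congrFun hr ⟨v, hv⟩).symm
    obtain ⟨u, hu, hn⟩ := exists_localUnits_nrd_eq_div v O
      (x := ⟨algebraMap F (v.adicCompletion F) ((x : Fˣ) : F), (hval x ⟨v, hv⟩).le⟩)
      (y := ⟨algebraMap F (v.adicCompletion F) ((y : Fˣ) : F), (hval y ⟨v, hv⟩).le⟩) (hϖ v)
      (HeightOneSpectrum.adicCompletionIntegers.isUnit_iff_valued_eq_one.mpr (hval x ⟨v, hv⟩)) h4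
    refine ⟨u, hu, hn.trans ?_⟩
    rw [Units.val_mul, map_mul, Units.val_inv_eq_inv_val, map_inv₀]

/-- Insert the principal ideals of `Idl S` between `PIdl O S` and `Idl S`: the lower index is finite
by `relIndex_FSO_ne_zero`, the upper one by finiteness of the class group. -/
theorem finite_ClG (O : Subalgebra (𝓞 F) ℍ[F, a, b]) (hO : IsOrder O)
    (S : Finset (HeightOneSpectrum (𝓞 F))) : Finite (ClG O S) := by
  set P := (toPrincipalIdeal (𝓞 F) F).range with hP
  have h1 : P.relIndex (Idl S) ≠ 0 := by
    have : Finite ((FractionalIdeal (𝓞 F)⁰ F)ˣ ⧸ P) :=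
      Finite.of_equiv _ (ClassGroup.equiv (R := 𝓞 F) F).toEquiv
    exact mt Subgroup.index_eq_zero_of_relIndex_eq_zero Subgroup.index_ne_zero_of_finite
  have h2 : (PIdl O S).relIndex (P ⊓ Idl S) ≠ 0 := by
    rw [hP, ← Subgroup.map_comap_eq, ← Subgroup.relIndex_comap]
    exact fun h => relIndex_FSO_ne_zero O S
      (Subgroup.relIndex_eq_zero_of_le_left (Subgroup.le_comap_map _ _) h)
  have hle : PIdl O S ≤ P ⊓ Idl S :=
    le_inf (by rintro _ ⟨x, -, rfl⟩; exact ⟨x, rfl⟩) (PIdl_le_Idl hO)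
  have h3 := Subgroup.relIndex_mul_relIndex (PIdl O S) (P ⊓ Idl S) (Idl S) hle inf_le_right
  rw [Subgroup.inf_relIndex_right] at h3
  have h4 : (PIdl O S).relIndex (Idl S) ≠ 0 := h3 ▸ mul_ne_zero h2 h1
  have : ((PIdl O S).subgroupOf (Idl S)).FiniteIndex := ⟨h4⟩
  exact Subgroup.finite_quotient_of_finiteIndex

theorem card_ClG_ne_zero (O : Subalgebra (𝓞 F) ℍ[F, a, b]) (hO : IsOrder O)
    (S : Finset (HeightOneSpectrum (𝓞 F))) : Nat.card (ClG O S) ≠ 0 := by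
  have := finite_ClG O hO S
  exact Nat.card_pos.ne'

/-- The group of fractional ideals prime to `S` is generated by the primes outside `S`. -/
theorem Idl_le_of_forall_prime {H : Subgroup (FractionalIdeal (𝓞 F)⁰ F)ˣ}
    (h : ∀ v ∉ S, ∀ I : (FractionalIdeal (𝓞 F)⁰ F)ˣ,
      (I : FractionalIdeal (𝓞 F)⁰ F) = v.asIdeal → I ∈ H) : Idl S ≤ H := by
  classical
  intro I hI
  have hfin : {v : HeightOneSpectrum (𝓞 F) |
      FractionalIdeal.count F v (I : FractionalIdeal (𝓞 F)⁰ F) ≠ 0}.Finite :=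
    FractionalIdeal.finite_factors (I : FractionalIdeal (𝓞 F)⁰ F)
  let p : HeightOneSpectrum (𝓞 F) → (FractionalIdeal (𝓞 F)⁰ F)ˣ := fun v =>
    Units.mk0 v.asIdeal (FractionalIdeal.coeIdeal_ne_zero.mpr v.ne_bot)
  have hprod : I = ∏ w ∈ hfin.toFinset, p w ^ FractionalIdeal.count F w I.val := by
    refine fractionalIdeal_ext_count fun v => ?_
    rw [Units.coe_prod, FractionalIdeal.count_prod F v _ _ fun w _ => Units.ne_zero _]
    simp only [Units.val_zpow_eq_zpow_val, p, Units.val_mk0, FractionalIdeal.count_zpow,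
      FractionalIdeal.count_maximal, mul_ite, mul_one, mul_zero, Finset.sum_ite_eq']
    split_ifs with hv
    · rfl
    · simpa using hv
  rw [hprod]
  refine H.prod_mem fun v hv => H.zpow_mem (h v (fun hvS => ?_) _ rfl) _
  exact (hfin.mem_toFinset.mp hv) (hI v hvS)

end ClassGroup

/-! ### The fibres of the reduced norm as sets of ideles. -/

section IdeleFibre

open WithZero

variable {F : Type*} [Field F] [NumberField F] {a b : F} {O : Subalgebra (𝓞 F) ℍ[F, a, b]}
  {S : Finset (HeightOneSpectrum (𝓞 F))}

theorem diagUnits_mul_mem_ideleFibre (hO : IsOrder O) {β : ClG O S}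
    {x : ∀ v : HeightOneSpectrum (𝓞 F), (BaseChange (v.adicCompletion F) a b)ˣ}
    (hx : x ∈ ideleFibre O S β) (γ : ℍ[F, a, b]ˣ) :
    diagUnits a b γ * x ∈ ideleFibre O S β := by
  obtain ⟨h1, δ, h2, 𝔞, h3, h4⟩ := hx
  have key : ∀ v, diagUnits a b (δ * γ⁻¹) v * (diagUnits a b γ * x) v =
      diagUnits a b δ v * x v := by
    intro v
    rw [map_mul, map_inv, Pi.mul_apply, Pi.mul_apply, Pi.inv_apply, mul_assoc,
      inv_mul_cancel_left]
  refine ⟨mul_mem (diagUnits_mem_ideles hO γ) h1, δ * γ⁻¹, fun v hv => ?_, 𝔞, fun v => ?_, h4⟩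
  · rw [key]; exact h2 v hv
  · rw [key]; exact h3 v

/-- The condition at S keeps xy normalized by the same γ, and norms multiply. This moves one fibre
to another by right translation. -/
theorem mul_mem_ideleFibre {β : ClG O S}
    {x y : ∀ v : HeightOneSpectrum (𝓞 F), (BaseChange (v.adicCompletion F) a b)ˣ}
    (hx : x ∈ ideleFibre O S β) (hy : y ∈ ideles O) (hyS : ∀ v ∈ S, y v ∈ localUnits v O)
    {𝔟 : Idl S} (h𝔟 : ∀ v, Valued.v (nrd (y v : BaseChange (v.adicCompletion F) a b)) =
      exp (-FractionalIdeal.count F v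
        ((𝔟 : (FractionalIdeal (𝓞 F)⁰ F)ˣ) : FractionalIdeal (𝓞 F)⁰ F))) :
    x * y ∈ ideleFibre O S (β * QuotientGroup.mk 𝔟) := by
  obtain ⟨h1, γ, h2, 𝔞, h3, rfl⟩ := hx
  refine ⟨mul_mem h1 hy, γ, fun v hv => ?_, 𝔞 * 𝔟, fun v => ?_, rfl⟩
  · rw [Pi.mul_apply, ← mul_assoc]
    exact mul_mem (h2 v hv) (hyS v hv)
  · rw [Pi.mul_apply, ← mul_assoc, Units.val_mul, map_mul, map_mul, h3, h𝔟, ← exp_add,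
      Subgroup.coe_mul, Units.val_mul, FractionalIdeal.count_mul _ _ (Units.ne_zero _)
      (Units.ne_zero _)]
    congr 1; ring

theorem mul_mem_ideleFibre_of_valued_eq_one {β : ClG O S}
    {x y : ∀ v : HeightOneSpectrum (𝓞 F), (BaseChange (v.adicCompletion F) a b)ˣ}
    (hx : x ∈ ideleFibre O S β) (hy : y ∈ ideles O) (hyS : ∀ v ∈ S, y v ∈ localUnits v O)
    (h : ∀ v, Valued.v (nrd (y v : BaseChange (v.adicCompletion F) a b)) = 1) :
    x * y ∈ ideleFibre O S β := by
  have := mul_mem_ideleFibre (𝔟 := 1) hx hy hyS (fun v => by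
    rw [h v, Subgroup.coe_one, Units.val_one, FractionalIdeal.count_one, neg_zero, exp_zero])
  have e : β * (QuotientGroup.mk (1 : Idl S) : ClG O S) = β := mul_one β
  rwa [e] at this

theorem exists_mem_ideleFibre (hO : IsOrder O) (S : Finset (HeightOneSpectrum (𝓞 F)))
    {x : ∀ v : HeightOneSpectrum (𝓞 F), (BaseChange (v.adicCompletion F) a b)ˣ}
    (hx : x ∈ ideles O) : ∃ β : ClG O S, x ∈ ideleFibre O S β := by
  obtain ⟨γ, hγ⟩ := exists_diagUnits_mul_mem_localUnits hO S x
  obtain ⟨𝔞, h𝔞⟩ := exists_ideal_of_idele hO (mul_mem (diagUnits_mem_ideles hO γ) hx)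
  have h𝔞S : 𝔞 ∈ Idl S := fun v hv => by
    have h1 := h𝔞 v
    rw [Pi.mul_apply, valued_nrd_localUnits hO (hγ v hv), ← exp_zero, exp_inj] at h1
    omega
  exact ⟨QuotientGroup.mk ⟨𝔞, h𝔞S⟩, hx, γ, hγ, ⟨𝔞, h𝔞S⟩, h𝔞, rfl⟩

/-- Two normalizations of x differ by some δ ∈ Bˣ. Its norm is totally positive by definiteness and
is the norm of a local unit at S, so it lies in `FSO` and the two ideals have the same class. -/
theorem ideleFibre_unique (hB : IsDefinite a b) {β β' : ClG O S}
    {x : ∀ v : HeightOneSpectrum (𝓞 F), (BaseChange (v.adicCompletion F) a b)ˣ}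
    (hx : x ∈ ideleFibre O S β) (hx' : x ∈ ideleFibre O S β') : β = β' := by
  obtain ⟨-, γ, h2, 𝔞, h3, rfl⟩ := hx
  obtain ⟨-, γ', h2', 𝔞', h3', rfl⟩ := hx'
  let δ := γ' * γ⁻¹
  have hδ : ∀ v, diagUnits a b δ v * (diagUnits a b γ v * x v) = diagUnits a b γ' v * x v := by
    intro v
    simp only [δ, map_mul, map_inv, Pi.mul_apply, Pi.inv_apply, mul_assoc, inv_mul_cancel_left]
  have hn0 := nrd_unit_ne_zero δ
  let f : Fˣ := Units.mk0 _ hn0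
  have hf : f ∈ FSO O S := by
    refine mem_FSO.mpr ⟨fun σ => hB.nrd_pos hn0 σ, fun v hv => ?_⟩
    refine ⟨diagUnits a b δ v, ?_, nrd_diagUnits δ v⟩
    have : diagUnits a b δ v = (diagUnits a b γ' v * x v) * (diagUnits a b γ v * x v)⁻¹ :=
      eq_mul_inv_of_mul_eq (hδ v)
    rw [this]
    exact mul_mem (h2' v hv) (inv_mem (h2 v hv))
  rw [QuotientGroup.eq, Subgroup.mem_subgroupOf]
  refine ⟨f, hf, ?_⟩
  refine fractionalIdeal_ext_count fun v => ?_
  have e1 := h3' v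
  rw [← hδ v, Units.val_mul, map_mul, map_mul, h3 v, nrd_diagUnits, valued_algebraMap] at e1
  have e2 := count_toPrincipalIdeal v f
  rw [show ((f : Fˣ) : F) = nrd (δ : ℍ[F, a, b]) from rfl] at e2
  rw [← e2, ← exp_add, exp_inj] at e1
  rw [Subgroup.coe_mul, Subgroup.coe_inv, Units.val_mul, FractionalIdeal.count_mul _ _
    (Units.ne_zero _) (Units.ne_zero _), Units.val_inv_eq_inv_val, FractionalIdeal.count_inv]
  omega

/-- The mass of `Cls O` is the sum of the masses of the fibres. -/
theorem mass_univ_eq_tsum (hB : IsDefinite a b) (hO : IsOrder O)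
    (S : Finset (HeightOneSpectrum (𝓞 F))) :
    mass (Set.univ : Set (Cls O)) = ∑' β : ClG O S, mass (fibre O S β) := by
  classical
  simp only [mass, tsum_subtype _ classMass]
  rw [ENNReal.tsum_comm]
  refine tsum_congr fun c => ?_
  rw [Set.indicator_of_mem (Set.mem_univ c)]
  obtain ⟨I, rfl⟩ : ∃ I, Cls.mk I = c := Quotient.exists_rep c
  obtain ⟨β, hβ⟩ := exists_mem_ideleFibre hO S
    (mem_ideles_of_completion_eq hO I.fg I.span_eq_top I.completion_eq)
  rw [tsum_eq_single β]
  · rw [Set.indicator_of_mem]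
    exact (mk_mem_fibre_iff hO I.completion_eq).mpr hβ
  · intro β' hβ'
    refine Set.indicator_of_notMem (fun h => hβ' ?_) _
    exact ideleFibre_unique hB ((mk_mem_fibre_iff hO I.completion_eq).mp h) hβ

end IdeleFibre

/-! ### Commensurability of unit groups. -/

section FiniteIndex

open WithZero

variable {F : Type*} [Field F] [NumberField F] {a b : F}

/-- Only finitely many factors impose a condition, so the intersection of the two products is cut
out by finitely many finite-index subgroups. -/
theorem relIndex_pi_ne_zero {ι : Type*} {G : ι → Type*} [∀ i, Group (G i)]
    {H K : ∀ i, Subgroup (G i)} (h : ∀ i, (H i).relIndex (K i) ≠ 0) (hfin : {i | ¬ K i ≤ H i}.Finite) :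
    (Subgroup.pi Set.univ H).relIndex (Subgroup.pi Set.univ K) ≠ 0 := by
  have : Finite {i | ¬ K i ≤ H i} := hfin
  set L := ⨅ i : {i | ¬ K i ≤ H i}, (H i).comap (Pi.evalMonoidHom G i)
  have h1 : L.relIndex (Subgroup.pi Set.univ K) ≠ 0 := by
    refine Subgroup.relIndex_iInf_ne_zero fun i => ?_
    rw [Subgroup.relIndex_comap]
    refine fun h0 => h i (Subgroup.relIndex_eq_zero_of_le_right ?_ h0)
    rintro _ ⟨x, hx, rfl⟩
    exact hx i (Set.mem_univ _)
  rw [← Subgroup.inf_relIndex_right] at h1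
  refine fun h0 => h1 (Subgroup.relIndex_eq_zero_of_le_left ?_ h0)
  rintro x ⟨hx, hx'⟩ i -
  by_cases hi : K i ≤ H i
  · exact hi (hx' i (Set.mem_univ i))
  · have := (Subgroup.mem_iInf.mp hx) ⟨i, hi⟩
    exact this

theorem finite_completionOrder_quotient (v : HeightOneSpectrum (𝓞 F))
    {O : Subalgebra (𝓞 F) ℍ[F, a, b]} (hO : IsOrder O) {r : v.adicCompletionIntegers F}
    (hr : r ≠ 0) : Finite (completionOrder v O ⧸
      (Ideal.span {r} • ⊤ : Submodule (v.adicCompletionIntegers F) (completionOrder v O))) := by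
  have h1 : Module.Finite (v.adicCompletionIntegers F) (completionOrder v O) :=
    Module.Finite.iff_fg.mpr (isOrder_completionOrder v hO).1
  have := finite_quotient_integers v hr
  exact Module.finite_of_finite (v.adicCompletionIntegers F ⧸ Ideal.span {r})

/-- Unit groups of local orders are commensurable up to conjugation. -/
theorem relIndex_localUnits_conj_ne_zero (v : HeightOneSpectrum (𝓞 F))
    {O O' : Subalgebra (𝓞 F) ℍ[F, a, b]} (hO : IsOrder O) (hO' : IsOrder O')
    (p : (BaseChange (v.adicCompletion F) a b)ˣ) :
    ((localUnits v O).map (MulAut.conj p).toMonoidHom).relIndex (localUnits v O') ≠ 0 := by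
  obtain ⟨n, hn⟩ := exists_ball_one_add v hO
  obtain ⟨k, -, hk⟩ := (isAdelicLattice_completion hO'.1 hO'.2).1 v
  obtain ⟨m, hm⟩ := exists_map_ball_le ((LinearMap.mulLeft (v.adicCompletion F)
    (↑p⁻¹ : BaseChange (v.adicCompletion F) a b)) ∘ₗ LinearMap.mulRight (v.adicCompletion F)
      (p : BaseChange (v.adicCompletion F) a b))
  obtain ⟨ϖ, hϖ, hv⟩ := exists_uniformizer_integers v
  have hfin := finite_completionOrder_quotient v hO' (pow_ne_zero (n + k + m) hϖ.ne_zero)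
  -- Congruent units u, w of O'_v satisfy u⁻¹w ∈ 1 + ϖ^(n+k+m) O'_v. Here k bounds O'_v, m is the
  -- loss under conjugation by p, and n is the radius at which 1 + z is a unit of O_v.
  refine relIndex_ne_zero_of_finite (fun u : localUnits v O' =>
    (Submodule.Quotient.mk (⟨((u : (BaseChange (v.adicCompletion F) a b)ˣ) :
      BaseChange (v.adicCompletion F) a b), (mem_localUnits.mp u.2).1⟩ : completionOrder v O') :
      completionOrder v O' ⧸ (Ideal.span {ϖ ^ (n + k + m)} • ⊤ :
        Submodule (v.adicCompletionIntegers F) (completionOrder v O')))) ?_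
  rintro ⟨u, hu⟩ ⟨w, hw⟩ huw
  have h1 := (Submodule.Quotient.eq _).mp huw.symm
  rw [Submodule.ideal_span_singleton_smul, Submodule.mem_smul_pointwise_iff_exists] at h1
  obtain ⟨t, -, ht⟩ := h1
  have ht' : (ϖ ^ (n + k + m) : v.adicCompletionIntegers F) •
      (t : BaseChange (v.adicCompletion F) a b) = w - u := congrArg Subtype.val ht
  have hs : (↑u⁻¹ : BaseChange (v.adicCompletion F) a b) * t ∈ completionOrder v O' :=
    mul_mem (mem_localUnits.mp hu).2 t.2
  have hval : Valued.v ((ϖ ^ (n + k + m) : v.adicCompletionIntegers F) : v.adicCompletion F) ≤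
      exp (-((n + k + m : ℕ) : ℤ)) := by
    rw [← mem_maximalIdeal_pow_iff, hϖ.maximalIdeal_eq, Ideal.span_singleton_pow]
    exact Ideal.mem_span_singleton_self _
  have h2 := hm _ _ (smul_mem_ball hval (hk (mem_completionOrder_iff.mp hs)))
  obtain ⟨z, hz, hz'⟩ := hn _ (ball_mono (by push_cast; omega) h2)
  rw [Subgroup.mem_map_equiv, MulAut.conj_symm_apply]
  have : p⁻¹ * (u⁻¹ * w) * p = z := by
    ext1
    have hw' : (w : BaseChange (v.adicCompletion F) a b) = u +
        (ϖ ^ (n + k + m) : v.adicCompletionIntegers F) •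
          (t : BaseChange (v.adicCompletion F) a b) := by rw [ht']; abel
    rw [hz', LinearMap.comp_apply, LinearMap.mulRight_apply, LinearMap.mulLeft_apply,
      Units.val_mul, Units.val_mul, Units.val_mul, hw', mul_add, Units.inv_mul, mul_add, mul_one,
      add_mul, Units.inv_mul, integers_smul_def, mul_smul_comm, mul_assoc]
  change p⁻¹ * (u⁻¹ * w) * p ∈ _
  rw [this]
  exact hz

theorem map_conj_adelicUnits (O : Subalgebra (𝓞 F) ℍ[F, a, b])
    (x : ∀ v : HeightOneSpectrum (𝓞 F), (BaseChange (v.adicCompletion F) a b)ˣ) :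
    (adelicUnits O).map (MulAut.conj x).toMonoidHom =
      Subgroup.pi Set.univ fun v => (localUnits v O).map (MulAut.conj (x v)).toMonoidHom := by
  ext y
  rw [Subgroup.mem_map_equiv, MulAut.conj_symm_apply, mem_adelicUnits, Subgroup.mem_pi]
  simp only [Set.mem_univ, forall_true_left]
  refine forall_congr' fun v => ?_
  rw [Subgroup.mem_map_equiv, MulAut.conj_symm_apply]
  rfl

/-- At almost all primes x_v ∈ O_vˣ and O_v = O'_v, and there conjugation changes nothing. -/
theorem relIndex_adelicUnits_conj_ne_zero {O O' : Subalgebra (𝓞 F) ℍ[F, a, b]} (hO : IsOrder O)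
    (hO' : IsOrder O')
    {x : ∀ v : HeightOneSpectrum (𝓞 F), (BaseChange (v.adicCompletion F) a b)ˣ}
    (hx : x ∈ ideles O) :
    ((adelicUnits O).map (MulAut.conj x).toMonoidHom).relIndex (adelicUnits O') ≠ 0 := by
  rw [map_conj_adelicUnits, adelicUnits]
  refine relIndex_pi_ne_zero (fun v => relIndex_localUnits_conj_ne_zero v hO hO' (x v))
    ((hx.union (finite_completionOrder_ne hO hO')).subset fun v hv => ?_)
  by_contra h
  simp only [Set.mem_union, Set.mem_ofPred_eq, not_or, not_not] at h
  refine hv fun y hy => ?_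
  rw [Subgroup.mem_map_equiv, MulAut.conj_symm_apply]
  have hy' : y ∈ localUnits v O := by rw [localUnits, h.2]; exact hy
  exact mul_mem (mul_mem (inv_mem h.1) hy') h.1

theorem relIndex_adelicUnits_ne_zero {O O' : Subalgebra (𝓞 F) ℍ[F, a, b]} (hO : IsOrder O)
    (hO' : IsOrder O') : (adelicUnits O).relIndex (adelicUnits O') ≠ 0 := by
  have := relIndex_adelicUnits_conj_ne_zero hO hO' (one_mem (ideles O))
  rw [map_one] at this
  convert this
  exact (Subgroup.map_id _).symm

end FiniteIndex

/-! ### All fibres of the reduced norm have the same mass. -/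

section EqualMasses

open WithZero

variable {F : Type*} [Field F] [NumberField F] {a b : F} {O : Subalgebra (𝓞 F) ℍ[F, a, b]}
  {S : Finset (HeightOneSpectrum (𝓞 F))}

/-- Elements of y Ôˣ y⁻¹ have unit norm everywhere and lie in O_vˣ at S. Hence the fibre is stable
at this level too, as the change of level requires. -/
theorem adelicUnits_conj_mul_mem_ideleFibre (hO : IsOrder O) {β : ClG O S}
    {x y : ∀ v : HeightOneSpectrum (𝓞 F), (BaseChange (v.adicCompletion F) a b)ˣ}
    (hy : y ∈ ideles O) (hyS : ∀ v ∈ S, y v ∈ localUnits v O) (hx : x ∈ ideleFibre O S β)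
    {u : ∀ v : HeightOneSpectrum (𝓞 F), (BaseChange (v.adicCompletion F) a b)ˣ}
    (hu : u ∈ (adelicUnits O).map (MulAut.conj y).toMonoidHom) :
    x * u ∈ ideleFibre O S β := by
  obtain ⟨w, hw, rfl⟩ := hu
  have hw' := mem_adelicUnits.mp hw
  change x * (y * w * y⁻¹) ∈ _
  refine mul_mem_ideleFibre_of_valued_eq_one hx
    (mul_mem (mul_mem hy (adelicUnits_le_ideles O hw)) (inv_mem hy))
    (fun v hv => mul_mem (mul_mem (hyS v hv) (hw' v)) (inv_mem (hyS v hv))) fun v => ?_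
  have h0 : Valued.v (nrd (y v : BaseChange (v.adicCompletion F) a b)) ≠ 0 :=
    (Valuation.ne_zero_iff _).mpr (nrd_unit_ne_zero (y v))
  rw [Pi.mul_apply, Pi.mul_apply, Pi.inv_apply, Units.val_mul, Units.val_mul, map_mul, map_mul,
    map_mul, map_mul, valued_nrd_localUnits hO (hw' v), nrd_unit_inv, map_inv₀, mul_one,
    mul_inv_cancel₀ h0]

/-- Translating by an idele whose square is central does not change the mass. -/
theorem cosetMass_mul_right_of_sq_central (hO : IsOrder O)
    {Ω : Set (∀ v : HeightOneSpectrum (𝓞 F), (BaseChange (v.adicCompletion F) a b)ˣ)}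
    {y : ∀ v : HeightOneSpectrum (𝓞 F), (BaseChange (v.adicCompletion F) a b)ˣ}
    (hy : y ∈ ideles O) (hcent : ∀ g, y * y * g = g * (y * y))
    (hΓ : ∀ γ : ℍ[F, a, b]ˣ, ∀ x ∈ Ω, diagUnits a b γ * x ∈ Ω)
    (hU : ∀ u ∈ adelicUnits O, ∀ x ∈ Ω, x * u ∈ Ω)
    (hU' : ∀ u ∈ (adelicUnits O).map (MulAut.conj y).toMonoidHom, ∀ x ∈ Ω, x * u ∈ Ω) :
    cosetMass (diagUnits a b) (scalarUnits a b) (adelicUnits O) ((· * y) '' Ω) =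
      cosetMass (diagUnits a b) (scalarUnits a b) (adelicUnits O) Ω := by
  set U := adelicUnits O with hUdef
  set V := U.map (MulAut.conj y).toMonoidHom with hV
  have hZc : ∀ z ∈ scalarUnits a b, ∀ g, diagUnits a b z * g = g * diagUnits a b z :=
    fun z hz g => diagUnits_scalar_commute hz g
  have hZU : ∀ z ∈ scalarUnits a b, diagUnits a b z ∈ U := fun z hz => diagUnits_scalar_mem hz
  have hZV : ∀ z ∈ scalarUnits a b, diagUnits a b z ∈ V := fun z hz => by
    rw [hV, Subgroup.mem_map_equiv, MulAut.conj_symm_apply, ← hZc z hz, inv_mul_cancel_right]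
    exact hZU z hz
  -- Centrality of y² means that conjugation by y also sends V back to U.
  have hVV : V.map (MulAut.conj y).toMonoidHom = U := by
    ext g
    rw [Subgroup.mem_map_equiv, MulAut.conj_symm_apply, hV, Subgroup.mem_map_equiv,
      MulAut.conj_symm_apply]
    have : y⁻¹ * (y⁻¹ * g * y) * y = g := by
      have h1 : y⁻¹ * (y⁻¹ * g * y) * y = (y * y)⁻¹ * (g * (y * y)) := by group
      rw [h1, ← hcent, inv_mul_cancel_left]
    rw [this]
  have hW : (U ⊓ V).map (MulAut.conj y).toMonoidHom = U ⊓ V := by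
    rw [Subgroup.map_inf _ _ _ (MulAut.conj y).injective, hVV, ← hV, inf_comm]
  -- The swap preserves U ∩ V, so both indices agree. This replaces the unimodularity of Haar
  -- measure.
  have hidx : (U ⊓ V).relIndex V = (U ⊓ V).relIndex U := by
    have := Subgroup.relIndex_map_map_of_injective (f := (MulAut.conj y).toMonoidHom) (U ⊓ V) U
      (MulAut.conj y).injective
    rwa [hW] at this
  have hne : (U ⊓ V).relIndex U ≠ 0 := by
    rw [Subgroup.inf_relIndex_left]
    exact relIndex_adelicUnits_conj_ne_zero hO hO hy
  have hZW : ∀ z ∈ scalarUnits a b, diagUnits a b z ∈ U ⊓ V := fun z hz => ⟨hZU z hz, hZV z hz⟩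
  rw [cosetMass_mul_right hZc hZU hΓ y]
  have h1 := cosetMass_of_le hZc (inf_le_left : U ⊓ V ≤ U) hne hZW hΓ hU
  have h2 := cosetMass_of_le hZc (inf_le_right : U ⊓ V ≤ V) (hidx ▸ hne) hZW hΓ hU'
  rw [h1, hidx] at h2
  exact ((ENNReal.mul_right_inj (by exact_mod_cast hne) (by simp)).mp h2).symm

/-- The idele is p at v and 1 elsewhere, with p of trace zero so that its square is central. -/
theorem exists_idele_prime (ha : a ≠ 0) (hb : b ≠ 0) {v : HeightOneSpectrum (𝓞 F)}
    (hmax : IsMaximalOrder (completionOrder v O)) :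
    ∃ y : ∀ v : HeightOneSpectrum (𝓞 F), (BaseChange (v.adicCompletion F) a b)ˣ,
      (∀ w, w ≠ v → y w = 1) ∧
      Valued.v (nrd (y v : BaseChange (v.adicCompletion F) a b)) = exp (-1 : ℤ) ∧
      ∀ g, y * y * g = g * (y * y) := by
  classical
  obtain ⟨p, ht, hn⟩ := exists_pure_unit_valued_nrd ha hb hmax
  refine ⟨Pi.mulSingle v p, fun w hw => by simp [Pi.mulSingle_eq_of_ne hw], ?_, fun g => ?_⟩
  · rw [Pi.mulSingle_eq_same]; exact hn
  · ext1 w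
    by_cases hw : w = v
    · subst hw
      rw [Pi.mul_apply, Pi.mul_apply, Pi.mul_apply, Pi.mul_apply, Pi.mulSingle_eq_same]
      ext1
      have hpp : (p : BaseChange (w.adicCompletion F) a b) * p =
          (-nrd (p : BaseChange (w.adicCompletion F) a b)) • 1 := by
        rw [mul_self_eq, ht]; simp
      rw [Units.val_mul, Units.val_mul, Units.val_mul, Units.val_mul, hpp, smul_mul_assoc, one_mul,
        mul_smul_comm, mul_one]
    · simp [Pi.mulSingle_eq_of_ne hw]

theorem mem_ideles_of_eq_one {v : HeightOneSpectrum (𝓞 F)}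
    {y : ∀ v : HeightOneSpectrum (𝓞 F), (BaseChange (v.adicCompletion F) a b)ˣ}
    (hy : ∀ w, w ≠ v → y w = 1) : y ∈ ideles O := by
  refine (Set.finite_singleton v).subset fun w hw => ?_
  by_contra h
  exact hw (by rw [hy w h]; exact one_mem _)

/-- All fibres of the reduced norm have the same mass. -/
theorem mass_fibre_const (ha : a ≠ 0) (hb : b ≠ 0) (hO : IsOrder O)
    (hS : ContainsNonmaximal S O) (β β' : ClG O S) :
    mass (fibre O S β) = mass (fibre O S β') := by
  let M : ClG O S → ℝ≥0∞ := fun β => mass (fibre O S β)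
  -- Since the classes that preserve masses form a subgroup, only primes outside S need to be
  -- checked, and there O_v is maximal.
  let H : Subgroup (ClG O S) :=
    { carrier := {δ | ∀ β, M (β * δ) = M β}
      one_mem' := fun β => by rw [mul_one]
      mul_mem' := fun {δ ε} hδ hε β => by rw [← mul_assoc, hε, hδ]
      inv_mem' := fun {δ} hδ β => by rw [← hδ (β * δ⁻¹), inv_mul_cancel_right] }
  have hH : ∀ 𝔞 : Idl S, (QuotientGroup.mk 𝔞 : ClG O S) ∈ H := by
    intro 𝔞
    have hle : Idl S ≤ (H.comap (QuotientGroup.mk' ((PIdl O S).subgroupOf (Idl S)))).map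
        (Idl S).subtype := by
      refine Idl_le_of_forall_prime fun v hv I hI => ?_
      have hmax : IsMaximalOrder (completionOrder v O) := by
        by_contra h; exact hv (hS v h)
      obtain ⟨y, hy1, hyv, hyc⟩ := exists_idele_prime ha hb hmax
      have hyi : y ∈ ideles O := mem_ideles_of_eq_one hy1
      have hyS : ∀ w ∈ S, y w ∈ localUnits w O := fun w hw => by
        rw [hy1 w (by rintro rfl; exact hv hw)]; exact one_mem _
      have hcount : ∀ w, Valued.v (nrd (y w : BaseChange (w.adicCompletion F) a b)) =
          exp (-FractionalIdeal.count F w (I : FractionalIdeal (𝓞 F)⁰ F)) := by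
        intro w
        classical
        rw [hI, FractionalIdeal.count_maximal]
        split_ifs with h
        · subst h; exact hyv
        · rw [hy1 w (Ne.symm h)]; simp
      have hIS : I ∈ Idl S := fun w hw => by
        have := hcount w
        rw [valued_nrd_localUnits hO (hyS w hw), ← exp_zero, exp_inj] at this
        omega
      refine ⟨⟨I, hIS⟩, fun β => ?_, rfl⟩
      -- Translation by y⁻¹ gives the reverse inclusion, since y⁻¹ carries the inverse ideal class.
      have himg : (· * y) '' ideleFibre O S β =
          ideleFibre O S (β * QuotientGroup.mk (⟨I, hIS⟩ : Idl S)) := by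
        ext x
        constructor
        · rintro ⟨z, hz, rfl⟩
          exact mul_mem_ideleFibre (𝔟 := ⟨I, hIS⟩) hz hyi hyS hcount
        · intro hx
          have h1 := mul_mem_ideleFibre (𝔟 := (⟨I, hIS⟩ : Idl S)⁻¹) hx (inv_mem hyi)
            (fun w hw => inv_mem (hyS w hw)) (fun w => by
              rw [Pi.inv_apply, nrd_unit_inv, map_inv₀, hcount w, Subgroup.coe_inv,
                Units.val_inv_eq_inv_val, FractionalIdeal.count_inv, exp_neg (-_)])
          have e : β * QuotientGroup.mk (⟨I, hIS⟩ : Idl S) *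
              (QuotientGroup.mk ((⟨I, hIS⟩ : Idl S)⁻¹) : ClG O S) = β :=
            mul_inv_cancel_right β _
          rw [e] at h1
          exact ⟨_, h1, by simp⟩
      change mass (fibre O S (β * QuotientGroup.mk (⟨I, hIS⟩ : Idl S))) = mass (fibre O S β)
      rw [mass_fibre_eq hO, mass_fibre_eq hO, ← himg]
      refine cosetMass_mul_right_of_sq_central hO hyi hyc
        (fun γ x hx => diagUnits_mul_mem_ideleFibre hO hx γ) (fun u hu x hx => ?_)
        (fun u hu x hx => adelicUnits_conj_mul_mem_ideleFibre hO hyi hyS hx hu)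
      exact mul_mem_ideleFibre_of_valued_eq_one hx (adelicUnits_le_ideles O hu)
        (fun v _ => mem_adelicUnits.mp hu v)
        (fun v => valued_nrd_localUnits hO (mem_adelicUnits.mp hu v))
    obtain ⟨𝔟, h𝔟, e⟩ := hle 𝔞.2
    have : 𝔟 = 𝔞 := Subtype.ext e
    subst this
    exact h𝔟
  obtain ⟨𝔞, h𝔞⟩ := QuotientGroup.mk_surjective (β'⁻¹ * β)
  have := hH 𝔞 β'
  rw [h𝔞, mul_inv_cancel_left] at this
  exact this

theorem mass_fibre_eq_div (ha : a ≠ 0) (hb : b ≠ 0) (hB : IsDefinite a b) (hO : IsOrder O)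
    (hS : ContainsNonmaximal S O) (β : ClG O S) :
    mass (fibre O S β) = mass (Set.univ : Set (Cls O)) / (Nat.card (ClG O S) : ℝ≥0∞) := by
  have := finite_ClG O hO S
  have h0 := card_ClG_ne_zero O hO S
  rw [mass_univ_eq_tsum hB hO S, tsum_congr fun β' => mass_fibre_const ha hb hO hS β' β,
    ENNReal.tsum_const, ENat.card_eq_coe_natCard, ENat.toENNReal_coe, mul_comm,
    ENNReal.mul_div_cancel_right (by exact_mod_cast h0) (by simp)]

end EqualMasses

/-! ### Independence of the order of Cl_{G(O)} R from S. -/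

section ClassGroupComparison

open WithZero

variable {F : Type*} [Field F] [NumberField F] {a b : F} {O : Subalgebra (𝓞 F) ℍ[F, a, b]}
  {S T : Finset (HeightOneSpectrum (𝓞 F))}

theorem exists_unit_valued_nrd (ha : a ≠ 0) (hb : b ≠ 0) {v : HeightOneSpectrum (𝓞 F)}
    (hmax : IsMaximalOrder (completionOrder v O)) (n : ℤ) :
    ∃ p : (BaseChange (v.adicCompletion F) a b)ˣ,
      Valued.v (nrd (p : BaseChange (v.adicCompletion F) a b)) = exp n := by
  obtain ⟨p, -, hp⟩ := exists_pure_unit_valued_nrd ha hb hmax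
  have hf : (Units.map (((Valued.v : Valuation (v.adicCompletion F) ℤᵐ⁰) :
      v.adicCompletion F →* ℤᵐ⁰).comp nrd) (p ^ (-n)) : ℤᵐ⁰) = exp n := by
    rw [map_zpow, Units.val_zpow_eq_zpow_val]
    change (Valued.v (nrd (p : BaseChange (v.adicCompletion F) a b))) ^ (-n) = _
    rw [hp, ← exp_zsmul]; simp
  exact ⟨p ^ (-n), hf⟩

/-- Weak approximation by elements of `F_{S,O}ˣ`. -/
theorem exists_mem_FSO_valuation_eq (ha : a ≠ 0) (hb : b ≠ 0) (hB : IsDefinite a b)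
    (hO : IsOrder O) (hS : ContainsNonmaximal S O) (hST : S ⊆ T) {n : HeightOneSpectrum (𝓞 F) → ℤ}
    (hn : ∀ v ∈ S, n v = 0) :
    ∃ x ∈ FSO O S, ∀ v ∈ T, v.valuation F ((x : Fˣ) : F) = exp (n v) := by
  have h1 : ∀ v : HeightOneSpectrum (𝓞 F), ∃ p : (BaseChange (v.adicCompletion F) a b)ˣ,
      Valued.v (nrd (p : BaseChange (v.adicCompletion F) a b)) = exp (-n v) ∧ (v ∈ S → p = 1) := by
    intro v
    by_cases hv : v ∈ S
    · exact ⟨1, by rw [hn v hv]; simp, fun _ => rfl⟩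
    · obtain ⟨p, hp⟩ := exists_unit_valued_nrd ha hb (by_contra fun h => hv (hS v h)) (-n v)
      exact ⟨p, hp, fun h => absurd h hv⟩
  choose p hp hpS using h1
  -- Up to a local unit, γ is inverse to p at each prime of T. So nrd γ has valuation exp(n v) on T,
  -- and at S, where p = 1, it is the norm of a local unit; positivity is automatic.
  obtain ⟨γ, hγ⟩ := exists_diagUnits_mul_mem_localUnits hO T p
  have hγ0 := nrd_unit_ne_zero γ
  refine ⟨Units.mk0 _ hγ0, mem_FSO.mpr ⟨fun σ => hB.nrd_pos hγ0 σ, fun v hv => ?_⟩, fun v hv => ?_⟩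
  · have := hγ v (hST hv)
    rw [hpS v hv, mul_one] at this
    exact ⟨_, this, nrd_diagUnits γ v⟩
  · have := valued_nrd_localUnits hO (hγ v hv)
    rw [Units.val_mul, map_mul, map_mul, hp, nrd_diagUnits, valued_algebraMap] at this
    rw [Units.val_mk0, eq_inv_of_mul_eq_one_left this, ← exp_neg, neg_neg]

/-- The class group `Cl_{G(O)} R` does not depend on `S`. -/
theorem card_ClG_of_subset (ha : a ≠ 0) (hb : b ≠ 0) (hB : IsDefinite a b)
    (hO : IsOrder O) (hS : ContainsNonmaximal S O) (hST : S ⊆ T) :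
    Nat.card (ClG O T) = Nat.card (ClG O S) := by
  have hIdl : Idl (F := F) T ≤ Idl S := fun I hI v hv => hI v (hST hv)
  -- At primes of T outside S the order is maximal, so every unit is a norm from O_vˣ and the norm
  -- condition reduces to valuation one.
  have hFSO : ∀ {x : Fˣ}, x ∈ FSO O T ↔ x ∈ FSO O S ∧ ∀ v ∈ T, v.valuation F (x : F) = 1 := by
    intro x
    constructor
    · exact fun hx => ⟨⟨hx.1, fun v hv => hx.2 v (hST hv)⟩, valuation_eq_one_of_mem_FSO hO hx⟩
    · rintro ⟨⟨h1, h2⟩, h3⟩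
      refine ⟨h1, fun v hv => ?_⟩
      by_cases hvS : v ∈ S
      · exact h2 v hvS
      · exact exists_localUnits_nrd_eq hO (by_contra fun h => hvS (hS v h))
          (by rw [valued_algebraMap, h3 v hv])
  have hPIdl : ∀ I ∈ Idl T, I ∈ PIdl O S ↔ I ∈ PIdl O T := by
    intro I hI
    constructor
    · rintro ⟨x, hx, rfl⟩
      exact ⟨x, hFSO.mpr ⟨hx, toPrincipalIdeal_mem_Idl.mp hI⟩, rfl⟩
    · rintro ⟨x, hx, rfl⟩
      exact ⟨x, (hFSO.mp hx).1, rfl⟩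
  let f : Idl T →* ClG O S := (QuotientGroup.mk' _).comp (Subgroup.inclusion hIdl)
  have hker : f.ker = (PIdl O T).subgroupOf (Idl T) := by
    ext I
    rw [MonoidHom.mem_ker, Subgroup.mem_subgroupOf, ← hPIdl I I.2]
    exact QuotientGroup.eq_one_iff (Subgroup.inclusion hIdl I)
  have hsurj : Function.Surjective f := by
    intro β
    obtain ⟨I, rfl⟩ := QuotientGroup.mk_surjective β
    -- Multiplying I by xR cancels its valuations at T without changing its class.
    obtain ⟨x, hx, hxT⟩ := exists_mem_FSO_valuation_eq ha hb hB hO hS hST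
      (n := fun v => FractionalIdeal.count F v I.1.val) I.2
    have hmem : toPrincipalIdeal (𝓞 F) F x * I.1 ∈ Idl T := fun v hv => by
      have h1 := count_toPrincipalIdeal v x
      rw [hxT v hv, exp_inj] at h1
      rw [Units.val_mul, FractionalIdeal.count_mul _ _ (Units.ne_zero _) (Units.ne_zero _), ← h1]
      omega
    refine ⟨⟨_, hmem⟩, ?_⟩
    refine QuotientGroup.eq.mpr ?_
    rw [Subgroup.mem_subgroupOf]
    refine ⟨x⁻¹, inv_mem hx, ?_⟩
    rw [map_inv]
    change _ = (toPrincipalIdeal (𝓞 F) F x * I.1)⁻¹ * I.1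
    rw [mul_inv_rev, mul_comm I.1⁻¹, inv_mul_cancel_right]
  rw [ClG, ← hker]
  exact Nat.card_congr (QuotientGroup.quotientKerEquivOfSurjective f hsurj).toEquiv

theorem FSO_le_of_conj {O' : Subalgebra (𝓞 F) ℍ[F, a, b]}
    {β : ∀ v : HeightOneSpectrum (𝓞 F), (BaseChange (v.adicCompletion F) a b)ˣ}
    (hβ : ∀ v, localUnits v O' = (localUnits v O).map (MulAut.conj (β v)).toMonoidHom) :
    FSO O S = FSO O' S := by
  have key : ∀ (v : HeightOneSpectrum (𝓞 F)) (z : v.adicCompletion F),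
      (∃ u ∈ localUnits v O, nrd (u : BaseChange (v.adicCompletion F) a b) = z) ↔
      ∃ u ∈ localUnits v O', nrd (u : BaseChange (v.adicCompletion F) a b) = z := by
    intro v z
    have hnrd : ∀ u : (BaseChange (v.adicCompletion F) a b)ˣ,
        nrd ((β v * u * (β v)⁻¹ : (BaseChange (v.adicCompletion F) a b)ˣ) :
          BaseChange (v.adicCompletion F) a b) = nrd (u : BaseChange (v.adicCompletion F) a b) := by
      intro u
      rw [Units.val_mul, Units.val_mul, map_mul, map_mul, nrd_unit_inv, mul_comm (nrd _),
        mul_inv_cancel_right₀ (nrd_unit_ne_zero _)]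
    rw [hβ]
    constructor
    · rintro ⟨u, hu, rfl⟩
      exact ⟨_, ⟨u, hu, rfl⟩, hnrd u⟩
    · rintro ⟨_, ⟨u, hu, rfl⟩, rfl⟩
      exact ⟨u, hu, (hnrd u).symm⟩
  ext x
  rw [mem_FSO, mem_FSO]
  exact and_congr_right fun _ => forall₂_congr fun v _ => key v _

end ClassGroupComparison

/-! ### Isomorphic orders are conjugate. -/

section SkolemNoether

variable {A K : Type*} [CommRing A] [IsDomain A] [Field K] [Algebra A K] [IsFractionRing A K]
  {a b : K} {O O' : Subalgebra A ℍ[K, a, b]}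

theorem algebraMap_smul_quaternion (c : A) (x : ℍ[K, a, b]) : algebraMap A K c • x = c • x :=
  algebraMap_smul K c x

/-- An isomorphism of orders extends to the quaternion algebra. -/
theorem exists_algHom_extension (hO : IsOrder O) (e : O ≃ₐ[A] O') :
    ∃ φ : ℍ[K, a, b] →ₐ[K] ℍ[K, a, b], ∀ x : O, φ x = e x := by
  have hex : ∀ x : ℍ[K, a, b], ∃ d : A, d ≠ 0 ∧ d • x ∈ O := fun x =>
    exists_smul_mem_of_mem_span (N := Subalgebra.toSubmodule O) (hO.2 ▸ Submodule.mem_top)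
  choose d hd hdO using hex
  have hK : ∀ {c : A}, c ≠ 0 → algebraMap A K c ≠ 0 := fun h =>
    (map_ne_zero_iff _ (IsFractionRing.injective A K)).mpr h
  have hcancel : ∀ {c : A} {x y : ℍ[K, a, b]}, c ≠ 0 → c • x = c • y → x = y := by
    intro c x y hc h
    rw [← algebraMap_smul_quaternion c x, ← algebraMap_smul_quaternion c y] at h
    exact smul_right_injective _ (hK hc) h
  let f : ℍ[K, a, b] → ℍ[K, a, b] := fun x =>
    (algebraMap A K (d x))⁻¹ • (e ⟨d x • x, hdO x⟩ : ℍ[K, a, b])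
  have hf0 : ∀ x, d x • f x = (e ⟨d x • x, hdO x⟩ : ℍ[K, a, b]) := fun x => by
    rw [← algebraMap_smul_quaternion, smul_smul, mul_inv_cancel₀ (hK (hd x)), one_smul]
  -- Independence of the chosen denominator. Each algebraic property of f then follows by clearing
  -- denominators.
  have hf : ∀ (c : A) (x : ℍ[K, a, b]) (h : c • x ∈ O), c • f x = (e ⟨c • x, h⟩ : ℍ[K, a, b]) := by
    intro c x h
    refine hcancel (hd x) ?_
    rw [smul_comm, hf0]
    have : c • (⟨d x • x, hdO x⟩ : O) = d x • (⟨c • x, h⟩ : O) := Subtype.ext (smul_comm _ _ _)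
    have h2 := congrArg (fun z : O => (e z : ℍ[K, a, b])) this
    simp only [map_smul] at h2
    exact h2
  have hfO : ∀ x : O, f x = e x := fun x => by
    have h := hf 1 x (by rw [one_smul]; exact x.2)
    simpa using h
  have hadd : ∀ x y, f (x + y) = f x + f y := by
    intro x y
    have hx : (d x * d y) • x ∈ O := by
      rw [mul_comm, mul_smul]; exact O.smul_mem (hdO x) _
    have hy : (d x * d y) • y ∈ O := by
      rw [mul_smul]; exact O.smul_mem (hdO y) _
    have hxy : (d x * d y) • (x + y) ∈ O := by rw [smul_add]; exact add_mem hx hy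
    refine hcancel (mul_ne_zero (hd x) (hd y)) ?_
    rw [smul_add, hf _ _ hx, hf _ _ hy, hf _ _ hxy]
    have : (⟨(d x * d y) • (x + y), hxy⟩ : O) = ⟨(d x * d y) • x, hx⟩ + ⟨(d x * d y) • y, hy⟩ :=
      Subtype.ext (smul_add _ _ _)
    rw [this, map_add]; rfl
  have hmul : ∀ x y, f (x * y) = f x * f y := by
    intro x y
    have hxy : (d x * d y) • (x * y) = (d x • x) * (d y • y) := by
      rw [smul_mul_smul_comm]
    have hxyO : (d x * d y) • (x * y) ∈ O := hxy ▸ mul_mem (hdO x) (hdO y)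
    refine hcancel (mul_ne_zero (hd x) (hd y)) ?_
    rw [← smul_mul_smul_comm, hf0, hf0, hf _ _ hxyO]
    have : (⟨(d x * d y) • (x * y), hxyO⟩ : O) = ⟨d x • x, hdO x⟩ * ⟨d y • y, hdO y⟩ :=
      Subtype.ext hxy
    rw [this, map_mul]; rfl
  have halg : ∀ r : K, f (algebraMap K _ r) = algebraMap K _ r := by
    intro r
    obtain ⟨n, m, hm, rfl⟩ := IsFractionRing.div_surjective (A := A) r
    have hm0 := nonZeroDivisors.ne_zero hm
    have h1 : m • algebraMap K ℍ[K, a, b] (algebraMap A K n / algebraMap A K m) =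
        algebraMap A ℍ[K, a, b] n := by
      rw [← algebraMap_smul_quaternion, Algebra.smul_def, ← map_mul, mul_div_cancel₀ _ (hK hm0)]
      exact (IsScalarTower.algebraMap_apply A K ℍ[K, a, b] n).symm
    have h2 : m • algebraMap K ℍ[K, a, b] (algebraMap A K n / algebraMap A K m) ∈ O :=
      h1 ▸ O.algebraMap_mem n
    refine hcancel hm0 ?_
    refine (hf _ _ h2).trans ?_
    have : (⟨_, h2⟩ : O) = algebraMap A O n := Subtype.ext h1
    rw [this, AlgEquiv.commutes, h1]; rfl
  exact ⟨{
    toFun := f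
    map_one' := by simpa using halg 1
    map_mul' := hmul
    map_zero' := by simpa using halg 0
    map_add' := hadd
    commutes' := halg }, hfO⟩

/-- Isomorphic orders are conjugate. -/
theorem exists_conj_of_algEquiv (h2 : (2 : K) ≠ 0) (ha : a ≠ 0) (hb : b ≠ 0) (hO : IsOrder O)
    (e : O ≃ₐ[A] O') : ∃ u : ℍ[K, a, b]ˣ, ∀ x, x ∈ O' ↔ ↑u⁻¹ * x * u ∈ O := by
  obtain ⟨φ, hφ⟩ := exists_algHom_extension hO e
  obtain ⟨u, hu⟩ := exists_intertwiner h2 ha hb φ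
  have hx : ∀ x : O, (↑u⁻¹ : ℍ[K, a, b]) * e x * u = x := by
    intro x
    rw [← hφ, mul_assoc, hu, Units.inv_mul_cancel_left]
  refine ⟨u, fun x => ⟨fun h => ?_, fun h => ?_⟩⟩
  · have := hx (e.symm ⟨x, h⟩)
    rw [AlgEquiv.apply_symm_apply] at this
    rw [this]; exact (e.symm ⟨x, h⟩).2
  · have h1 : (e ⟨_, h⟩ : ℍ[K, a, b]) * u = x * u := by
      rw [← hφ ⟨_, h⟩, hu]
      change (u : ℍ[K, a, b]) * (↑u⁻¹ * x * u) = _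
      rw [mul_assoc, Units.mul_inv_cancel_left]
    rw [← (Units.mul_left_inj u).mp h1]
    exact (e ⟨_, h⟩).2

end SkolemNoether

/-! ### Total masses of locally isomorphic orders and of superorders. -/

section LocallyIsomorphicOrders

variable {F : Type*} [Field F] [NumberField F] {a b : F} {O O' : Subalgebra (𝓞 F) ℍ[F, a, b]}

/-- Locally isomorphic orders are conjugate by an idele. -/
theorem LocallyIsomorphic.exists_idele (ha : a ≠ 0) (hb : b ≠ 0) (hO : IsOrder O)
    (hO' : IsOrder O') (h : LocallyIsomorphic O O') : ∃ β ∈ ideles O,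
      ∀ v, localUnits v O' = (localUnits v O).map (MulAut.conj (β v)).toMonoidHom := by
  have hloc : ∀ v : HeightOneSpectrum (𝓞 F), ∃ u : (BaseChange (v.adicCompletion F) a b)ˣ,
      (∀ x, x ∈ completionOrder v O' ↔
        (↑u⁻¹ : BaseChange (v.adicCompletion F) a b) * x * u ∈ completionOrder v O) ∧
      (completionOrder v O = completionOrder v O' → u = 1) := by
    intro v
    -- Choosing u = 1 wherever the completions agree, hence at almost all primes, ensures that the
    -- family is an idele.
    by_cases hv : completionOrder v O = completionOrder v O'
    · exact ⟨1, fun x => by rw [hv]; simp, fun _ => rfl⟩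
    · obtain ⟨e⟩ := h v
      obtain ⟨u, hu⟩ := exists_conj_of_algEquiv two_ne_zero (by simpa using ha) (by simpa using hb)
        (isOrder_completionOrder v hO) e
      exact ⟨u, hu, fun h => absurd h hv⟩
  choose β hβ hβ1 using hloc
  refine ⟨β, (finite_completionOrder_ne hO hO').subset fun v hv h => ?_, fun v => ?_⟩
  · exact hv (by rw [hβ1 v h]; exact one_mem _)
  · ext x
    rw [Subgroup.mem_map_equiv, MulAut.conj_symm_apply, mem_localUnits, mem_localUnits, hβ, hβ,
      mul_inv_rev, mul_inv_rev, inv_inv, ← mul_assoc]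
    simp only [Units.val_mul]

theorem mass_univ_of_conj (hO : IsOrder O) (hO' : IsOrder O')
    {β : ∀ v : HeightOneSpectrum (𝓞 F), (BaseChange (v.adicCompletion F) a b)ˣ}
    (hβi : β ∈ ideles O)
    (hβ : ∀ v, localUnits v O' = (localUnits v O).map (MulAut.conj (β v)).toMonoidHom) :
    mass (Set.univ : Set (Cls O)) = mass (Set.univ : Set (Cls O')) := by
  -- The whole idele group is stable under right translation, so only the level changes, from Ôˣ to
  -- its conjugate Ô'ˣ.
  have himg : (· * β) '' (ideles O : Set (∀ v : HeightOneSpectrum (𝓞 F),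
      (BaseChange (v.adicCompletion F) a b)ˣ)) = ideles O := by
    ext x
    constructor
    · rintro ⟨y, hy, rfl⟩
      exact mul_mem hy hβi
    · intro hx
      exact ⟨x * β⁻¹, mul_mem hx (inv_mem hβi), by simp⟩
  have hU : (adelicUnits O).map (MulAut.conj β).toMonoidHom = adelicUnits O' := by
    rw [map_conj_adelicUnits, adelicUnits]
    simp only [hβ]
  have h := cosetMass_mul_right (fun _ hz g => diagUnits_scalar_commute hz g)
    (fun _ hz => diagUnits_scalar_mem (O := O) hz)
    (fun γ x hx => mul_mem (diagUnits_mem_ideles hO γ) hx : ∀ γ : ℍ[F, a, b]ˣ,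
      ∀ x ∈ (ideles O : Set (∀ v : HeightOneSpectrum (𝓞 F),
        (BaseChange (v.adicCompletion F) a b)ˣ)), diagUnits a b γ * x ∈ _) β
  rw [himg, hU] at h
  rw [mass_univ_eq hO, mass_univ_eq hO', h, ideles_eq hO hO']

/-- Masses of class sets are proportional to the indices of adelic unit groups. -/
theorem mass_univ_of_le (hO : IsOrder O) (hO' : IsOrder O') (hle : O ≤ O') :
    mass (Set.univ : Set (Cls O)) =
      (adelicUnits O).relIndex (adelicUnits O') * mass (Set.univ : Set (Cls O')) := by
  have hloc : ∀ v : HeightOneSpectrum (𝓞 F), completionOrder v O ≤ completionOrder v O' := fun v =>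
    Algebra.adjoin_mono (Set.image_mono hle)
  have hUU : adelicUnits O ≤ adelicUnits O' := by
    intro x hx
    rw [mem_adelicUnits] at hx ⊢
    intro v
    have := mem_localUnits.mp (hx v)
    exact mem_localUnits.mpr ⟨hloc v this.1, hloc v this.2⟩
  rw [mass_univ_eq hO, mass_univ_eq hO', ideles_eq hO hO']
  exact cosetMass_of_le (fun _ hz g => diagUnits_scalar_commute hz g) hUU
    (relIndex_adelicUnits_ne_zero hO hO') (fun _ hz => diagUnits_scalar_mem hz)
    (fun γ x hx => mul_mem (diagUnits_mem_ideles hO' γ) hx)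
    (fun u hu x hx => mul_mem hx (adelicUnits_le_ideles O' hu))

end LocallyIsomorphicOrders

end

end StablyFreeMass

theorem theorem5p6 {F : Type*} [Field F] [NumberField F] [NumberField.IsTotallyReal F]
    (a b : F) (ha : a ≠ 0) (hb : b ≠ 0) (hB : IsDefinite a b)
    (O : Subalgebra (𝓞 F) ℍ[F, a, b]) (hO : IsOrder O)
    (S : Finset (HeightOneSpectrum (𝓞 F))) (hS : ContainsNonmaximal S O) :
    -- locally isomorphic orders have the same stably free mass
    (∀ (O' : Subalgebra (𝓞 F) ℍ[F, a, b]) (S' : Finset (HeightOneSpectrum (𝓞 F))),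
      IsOrder O' → ContainsNonmaximal S' O' → LocallyIsomorphic O O' →
        mass (fibre O S 1) = mass (fibre O' S' 1)) ∧
    -- the stably free mass, and the mass of every other fibre
    mass (fibre O S 1) = mass (Set.univ : Set (Cls O)) / (Nat.card (ClG O S) : ℝ≥0∞) ∧
    (∀ β : ClG O S,
      mass (fibre O S β) = mass (Set.univ : Set (Cls O)) / (Nat.card (ClG O S) : ℝ≥0∞)) ∧
    -- comparison with a superorder
    (∀ (O' : Subalgebra (𝓞 F) ℍ[F, a, b]) (S' : Finset (HeightOneSpectrum (𝓞 F))),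
      IsOrder O' → ContainsNonmaximal S' O' → O ≤ O' →
        mass (fibre O S 1) =
          (Nat.card (ClG O' S') : ℝ≥0∞) / (Nat.card (ClG O S) : ℝ≥0∞) *
            ((adelicUnits O).relIndex (adelicUnits O') : ℝ≥0∞) * mass (fibre O' S' 1)) := by
  classical
  refine ⟨fun O' S' hO' hS' hiso => ?_, mass_fibre_eq_div ha hb hB hO hS 1,
    mass_fibre_eq_div ha hb hB hO hS, fun O' S' hO' hS' hle => ?_⟩
  · obtain ⟨β, hβi, hβ⟩ := hiso.exists_idele ha hb hO hO'
    -- Over the common set S ∪ S' the two class groups coincide, because conjugate unit groups have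
    -- the same reduced norms.
    have hcard : Nat.card (ClG O S) = Nat.card (ClG O' S') := by
      rw [← card_ClG_of_subset ha hb hB hO hS Finset.subset_union_left,
        ← card_ClG_of_subset ha hb hB hO' hS' (T := S ∪ S') Finset.subset_union_right, ClG, ClG,
        PIdl, PIdl, FSO_le_of_conj hβ]
    rw [mass_fibre_eq_div ha hb hB hO hS, mass_fibre_eq_div ha hb hB hO' hS',
      mass_univ_of_conj hO hO' hβi hβ, hcard]
  -- The class number of O' is finite and nonzero, so it cancels in [0, ∞] with no finiteness
  -- assumption on the masses.
  · have h0 : (Nat.card (ClG O' S') : ℝ≥0∞) ≠ 0 := by exact_mod_cast card_ClG_ne_zero O' hO' S'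
    rw [mass_fibre_eq_div ha hb hB hO hS, mass_fibre_eq_div ha hb hB hO' hS',
      mass_univ_of_le hO hO' hle]
    simp only [div_eq_mul_inv]
    calc _ = ((Nat.card (ClG O' S') : ℝ≥0∞) * (Nat.card (ClG O' S') : ℝ≥0∞)⁻¹) *
          ((adelicUnits O).relIndex (adelicUnits O') * mass (Set.univ : Set (Cls O')) *
            (Nat.card (ClG O S) : ℝ≥0∞)⁻¹) := by
            rw [ENNReal.mul_inv_cancel h0 (by simp), one_mul]
      _ = _ := by ring
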